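/- **Notation.** For $h>0$ put $\delta_{-h}Y(x)=(x-h)\,\frac{Y(x)-Y(x-h)}{h}$, $x^{[s]_h}=x(x+h)\cdots(x+(s-1)h)$, $x^{-[s]_h}=1/x^{[s]_h}$, and $\delta=x\frac{d}{dx}$. A matrix is non-resonant if no two of its eigenvalues differ by a nonzero integer. A Jordan reduction of $\widetilde A_0$ *unfolds* into Jordan reductions of matrices $A_0^{(h)}$ if there are Jordan reductions $\widetilde A_0=\widetilde S\widetilde J\widetilde S^{-1}$ and $A^{(h)}_0=S^{(h)}J^{(h)}(S^{(h)})^{-1}$ with $S^{(h)}\to\widetilde S$ and $J^{(h)}\to\widetilde J$ as $h\to0^+$. **Canonical solutions.** Let $e^{(h)+}_c(x)=h^c\,\Gamma(x/h)/\Gamma(x/h-c)$ and $l^{(k,h)}_c=\frac1{k!}\partial_c^k e^{(h)+}_c$. For a Jordan reduction $A_0=S\,\mathrm{diag}(c_iI+N)\,S^{-1}$ let $e^{(h)+}_{A_0}=S\,\mathrm{diag}(e^{(h)+}_{c_iI+N})\,S^{-1}$, where $e^{(h)+}_{cI+N}$ is the upper triangular matrix with entry $l_c^{(j-i,h)}$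 in place $(i,j)$, $i\le j$. For $A\in M_n(\mathbb C(x))$ holomorphic at $\infty$, the canonical solution at $+\infty$ of $\delta_{-h}Y=AY$ is the meromorphic solution $e^{(h)+}_A$ on $\mathbb C$ that on some right half-plane is $F\,e^{(h)+}_{A(\infty)}$, with $F=I+\sum_{s\ge1}F_sx^{-[s]_h}$ a convergent series of $h$-factorials. The canonical solution at $-\infty$ is the meromorphic solution $e^{(h)-}_A$ that on some left half-plane is $G(-x)\,e^{(h)+}_{A(\infty)}(-x)$ with $G=I+\sum_{s\ge1}G_sx^{-[s]_h}$ a convergent series of $h$-factorials. **Hypothesis (H''').** Let $h_0>0$, let $A^{(h)}\in M_n(\mathbb C(x))$ for $0<h<h_0$, and let $\widetilde A\in M_n(\mathbb C(x))$. No two distinct poles of $\widetilde A$ have the same imaginary part, and no pole of $\widetilde A$ is real. Moreover, one of the following holds. (a) Both $(A^{(h)}(x),\widetilde A(x))$ and $(A^{(h)}(-x),\widetilde A(-x))$ satisfy the following local condition: $A^{(h)}(x)=\sum_{s\ge0}A^{(h)}_sx^{-[s]_h}$ is a convergent series of $h$-factorials for every $h\in{]0,h_0[}$; there are $C,\lambda\ge0$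 such that, for all small $h$ and all $s\ge1$, $\|A^{(h)}_s\|\le C\,\lambda^{[s-1]_h}$; $\|A^{(h)}_0\|$ is bounded on $]0,h_0[$; for every $s$, $A^{(h)}_s\to\widetilde A_s$ as $h\to0^+$, where $\widetilde A(x)=\sum_s\widetilde A_sx^{-s}$ near $\infty$; a Jordan reduction of $\widetilde A_0$ unfolds into Jordan reductions of the $A^{(h)}_0$; and $\widetilde A_0$ is non-resonant. Furthermore $A^{(h)}\to\widetilde A$ uniformly on every compact subset of $\mathbb C\setminus\{\text{poles of }\widetilde A\}$ (the $A^{(h)}$ having no pole on it for small $h$). (b) $\widetilde A$ is holomorphic at $\infty$ with $\widetilde A(\infty)$ non-resonant; $A^{(h)}\to\widetilde A$ uniformly on every compact subset of $\mathbb P^1(\mathbb C)\setminus\{\text{poles of }\widetilde A\}$ (the $A^{(h)}$ having no pole on it for small $h$); and a Jordan reduction of $\widetilde A(\infty)$ unfolds into Jordan reductions of the $A^{(h)}(\infty)$. Let $\widetilde z_1,\dots,\widetilde z_r$ be the elements of $\{\text{poles of }\widetilde A\}\cup\{0\}$, ordered by increasing imaginary part, and put $\widetilde\Omega^\pm=\mathbb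 C\setminus\bigcup_j(\widetilde z_j+\mathbb R^\mp)$ and $\widetilde\Omega=\mathbb C\setminus\bigcup_j(\widetilde z_j+\mathbb R)$. **Theorem.** Assume (H'''). For all sufficiently small $h>0$ the canonical solutions $e^{(h)\pm}_{A^{(h)}}$ exist and are unique. As $h\to0^+$ they converge pointwise on $\widetilde\Omega^{\pm}$ to fundamental systems of solutions $e^\pm_{\widetilde A}$ of $\delta\widetilde Y=\widetilde A\widetilde Y$, which are of the form $(I+\sum_{s\ge1}c_sx^{-s})(\pm x)^{\widetilde A(\infty)}$ (principal logarithm) for $\pm\mathrm{Re}\,x$ large. The connection matrices $P^{(h)}=(e^{(h)+}_{A^{(h)}})^{-1}e^{(h)-}_{A^{(h)}}$ converge pointwise on $\widetilde\Omega$ to $\widetilde P=(e^+_{\widetilde A})^{-1}e^-_{\widetilde A}$, which is constant and invertible on each component of $\widetilde\Omega$. Let $\widetilde P_{j+1}$ be its value on the component whose lower boundary is $\widetilde z_j+\mathbb R$, and $\widetilde P_1$ its value on the lowest component. Then, for $1\le j\le r$, the monodromy of $\delta\widetilde Y=\widetilde A\widetilde Y$ around $\widetilde z_j$ in the basis $e^+_{\widetilde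 A}$ is $\widetilde P_j\widetilde P_{j+1}^{-1}$: analytic continuation along a sufficiently small positively oriented circle around $\widetilde z_j$ transforms $e^+_{\widetilde A}$ into $e^+_{\widetilde A}\,\widetilde P_j\widetilde P_{j+1}^{-1}$. -/

import Mathlib

open Filter Topology

noncomputable section

/-! ### Rational matrices -/

/-- Complex square matrices of size `n`. -/
abbrev CMat (n : ℕ) : Type := Matrix (Fin n) (Fin n) ℂ

/-- Square matrices of size `n` with rational coefficients, i.e. `M_n(ℂ(x))`. -/
abbrev RatMat (n : ℕ) : Type := Matrix (Fin n) (Fin n) (RatFunc ℂ)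

/-- The value of a rational matrix at a point (meaningful outside the poles). -/
def evalMat {n : ℕ} (A : RatMat n) (x : ℂ) : CMat n :=
  A.map fun f => f.eval (RingHom.id ℂ) x

/-- The set of finite poles of a rational matrix (`RatFunc.denom` is the denominator in lowest
terms). -/
def poleSet {n : ℕ} (A : RatMat n) : Set ℂ :=
  {x | ∃ i j, (A i j).denom.eval x = 0}

/-- The rational matrix `A` is holomorphic at infinity, with value `A₀` there. -/
def HasValueAtInfinity {n : ℕ} (A : RatMat n) (A₀ : CMat n) : Prop :=
  Tendsto (evalMat A) (Bornology.cobounded ℂ) (𝓝 A₀)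

/-- Two eigenvalues never differ by a nonzero integer. -/
def NonResonant {n : ℕ} (M : CMat n) : Prop :=
  ∀ a ∈ spectrum ℂ M, ∀ b ∈ spectrum ℂ M, ∀ m : ℤ, a - b = (m : ℂ) → m = 0

/-! ### Jordan reductions -/

/-- `J` is block diagonal with Jordan blocks `c I + N`, with ones on the superdiagonal of each
block. -/
def IsJordanMatrix {n : ℕ} (J : CMat n) : Prop :=
  ∀ i j : Fin n,
    (i ≠ j → j.val ≠ i.val + 1 → J i j = 0) ∧
    (j.val = i.val + 1 → J i j = 0 ∨ (J i j = 1 ∧ J i i = J j j))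

/-- `A = S J S⁻¹` is a Jordan reduction of `A`. -/
def IsJordanReduction {n : ℕ} (A S J : CMat n) : Prop :=
  IsJordanMatrix J ∧ IsUnit S.det ∧ A = S * J * S⁻¹

/-- A Jordan reduction of `At` unfolds into Jordan reductions of the `A h` as `h → 0⁺`. -/
def JordanUnfolds {n : ℕ} (At : CMat n) (A : ℝ → CMat n) : Prop :=
  ∃ (St Jt : CMat n) (S J : ℝ → CMat n),
    IsJordanReduction At St Jt ∧
    (∀ᶠ h in 𝓝[>] (0 : ℝ), IsJordanReduction (A h) (S h) (J h)) ∧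
    Tendsto S (𝓝[>] 0) (𝓝 St) ∧ Tendsto J (𝓝[>] 0) (𝓝 Jt)

/-! ### Series of `h`-factorials -/

/-- `x^{[s]_h} = x (x + h) ⋯ (x + (s - 1) h)`. -/
def hRising {K : Type*} [Field K] (h x : K) (s : ℕ) : K :=
  ∏ k ∈ Finset.range s, (x + (k : K) * h)

/-- On some right half-plane, `f` is the sum of the series of `h`-factorials
`∑ a_s x^{-[s]_h}`. (A series of factorials that converges on some right half-plane converges
absolutely on a smaller one.) -/
def IsFactorialExpansion {n : ℕ} (h : ℝ) (a : ℕ → CMat n) (f : ℂ → CMat n) : Prop :=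
  ∃ R : ℝ, ∀ x : ℂ, R < x.re → HasSum (fun s => (hRising (h : ℂ) x s)⁻¹ • a s) (f x)

/-- The family of series with coefficients `a h s` is of type `(C, lam)`, for the norm of the
maximum of the moduli of the entries. -/
def IsOfType {n : ℕ} (h₀ C lam : ℝ) (a : ℝ → ℕ → CMat n) : Prop :=
  (∃ h₁ ∈ Set.Ioo 0 h₀, ∀ h ∈ Set.Ioo 0 h₁, ∀ s : ℕ, 1 ≤ s → ∀ i j,
    ‖a h s i j‖ ≤ C * hRising h lam (s - 1)) ∧
  ∃ B : ℝ, ∀ h ∈ Set.Ioo 0 h₀, ∀ i j, ‖a h 0 i j‖ ≤ B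

/-! ### Canonical solutions of the systems of step `h` -/

/-- `δ_{-h} Y (x) = (x - h) (Y(x) - Y(x - h)) / h`. -/
def hDelta {n : ℕ} (h : ℝ) (Y : ℂ → CMat n) (x : ℂ) : CMat n :=
  ((x - h) / h) • (Y x - Y (x - h))

/-- `Y` is meromorphic on `ℂ` and `δ_{-h} Y = A Y` as meromorphic functions. The normal form says
that an entry takes its true value wherever it is holomorphic (and the value `0` at its poles). -/
def IsMeromorphicSolution {n : ℕ} (h : ℝ) (A : RatMat n) (Y : ℂ → CMat n) : Prop :=
  (∀ i j, MeromorphicNFOn (fun x => Y x i j) Set.univ) ∧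
  ∀ᶠ x in codiscrete ℂ, hDelta h Y x = evalMat A x * Y x

/-- The character `h^c Γ(x/h) / Γ(x/h - c)`. -/
def hChar (h : ℝ) (c x : ℂ) : ℂ :=
  (h : ℂ) ^ c * (Complex.Gamma (x / h) / Complex.Gamma (x / h - c))

/-- `l_c^{(k,h)}(x)`, which is `1 / k!` times the `k`-th derivative of the character with respect
to the exponent, at the exponent `c`. -/
def hLog (h : ℝ) (k : ℕ) (c x : ℂ) : ℂ :=
  iteratedDeriv k (fun c' => hChar h c' x) c / (k.factorial : ℂ)

open Classical in
/-- The matrix `e_J^{(h)+}(x)` of a Jordan matrix `J`: block diagonal along the Jordan blocks of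
`J`, the block of `c I + N` being upper triangular with entry `l_c^{(j - i, h)}` in place
`(i, j)`. -/
def jordanSolution {n : ℕ} (h : ℝ) (J : CMat n) (x : ℂ) : CMat n :=
  Matrix.of fun i j =>
    if i ≤ j ∧ ∀ k l : Fin n, i ≤ k → l ≤ j → l.val = k.val + 1 → J k l = 1 then
      hLog h (j.val - i.val) (J i i) x
    else 0

/-- On some right half-plane, `Y = F · e_{A₀}^{(h)+}`, where `F` is a convergent series of
`h`-factorials with constant term `I` (hence invertible as a series of `h`-factorials), and
`e_{A₀}^{(h)+} = S e_J^{(h)+} S⁻¹` for a Jordan reduction `A₀ = S J S⁻¹`. -/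
def HasCanonicalForm {n : ℕ} (h : ℝ) (A₀ : CMat n) (Y : ℂ → CMat n) : Prop :=
  ∃ (S J : CMat n) (c : ℕ → CMat n) (F : ℂ → CMat n),
    IsJordanReduction A₀ S J ∧ c 0 = 1 ∧ IsFactorialExpansion h c F ∧
    ∃ R : ℝ, ∀ x : ℂ, R < x.re → Y x = F x * (S * jordanSolution h J x * S⁻¹)

/-- `Y` is the canonical solution at `+∞` of `δ_{-h} Y = A Y`. -/
def IsCanonicalAtPlus {n : ℕ} (h : ℝ) (A : RatMat n) (Y : ℂ → CMat n) : Prop :=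
  IsMeromorphicSolution h A Y ∧
    ∃ A₀, HasValueAtInfinity A A₀ ∧ HasCanonicalForm h A₀ Y

/-- `Y` is the canonical solution at `-∞` of `δ_{-h} Y = A Y`: on a left half-plane it is the
product of a series of `h`-retro-factorials with constant term `I` and of
`e_{A(∞)}^{(h)+}(-x)`. -/
def IsCanonicalAtMinus {n : ℕ} (h : ℝ) (A : RatMat n) (Y : ℂ → CMat n) : Prop :=
  IsMeromorphicSolution h A Y ∧
    ∃ A₀, HasValueAtInfinity A A₀ ∧ HasCanonicalForm h A₀ (fun x => Y (-x))

/-! ### Hypotheses of confluence -/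

/-- As `h → 0⁺`, the `A h` have no pole on `K` and converge to `At` uniformly on `K`. -/
def ConvergesUniformlyOn {n : ℕ} (A : ℝ → RatMat n) (At : RatMat n) (K : Set ℂ) : Prop :=
  (∀ᶠ h in 𝓝[>] (0 : ℝ), Disjoint (poleSet (A h)) K) ∧
  ∀ i j, TendstoUniformlyOn (fun h x => evalMat (A h) x i j) (fun x => evalMat At x i j)
    (𝓝[>] (0 : ℝ)) K

/-- The local hypothesis at `+∞`. The `A h`, for `0 < h < h₀`, are sums of series of
`h`-factorials, of some type `(C, lam)`, whose coefficients converge to those of the power series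
of `At` in `1/x` at infinity; a Jordan reduction of the constant term of `At` unfolds into
Jordan reductions of those of the `A h`, and the constant term of `At` is non-resonant. -/
def LocalConfluence {n : ℕ} (h₀ : ℝ) (A : ℝ → ℂ → CMat n) (At : ℂ → CMat n) : Prop :=
  ∃ (a : ℝ → ℕ → CMat n) (at' : ℕ → CMat n),
    (∀ h ∈ Set.Ioo 0 h₀, IsFactorialExpansion h (a h) (A h)) ∧
    (∃ C lam : ℝ, 0 ≤ C ∧ 0 ≤ lam ∧ IsOfType h₀ C lam a) ∧
    (∀ s, Tendsto (fun h => a h s) (𝓝[>] 0) (𝓝 (at' s))) ∧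
    (∃ R : ℝ, ∀ x : ℂ, R < ‖x‖ → HasSum (fun s => (x⁻¹) ^ s • at' s) (At x)) ∧
    JordanUnfolds (at' 0) (fun h => a h 0) ∧
    NonResonant (at' 0)

/-- The local hypothesis at both `+∞` and `-∞` (through `x ← -x`), with uniform convergence on the
compact sets of `ℂ` that avoid the poles of `At`. -/
def ConfluenceFactorial {n : ℕ} (h₀ : ℝ) (A : ℝ → RatMat n) (At : RatMat n) : Prop :=
  LocalConfluence h₀ (fun h x => evalMat (A h) x) (fun x => evalMat At x) ∧
  LocalConfluence h₀ (fun h x => evalMat (A h) (-x)) (fun x => evalMat At (-x)) ∧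
  ∀ K : Set ℂ, IsCompact K → Disjoint (poleSet At) K → ConvergesUniformlyOn A At K

/-- `At` is holomorphic and non-resonant at infinity, the `A h` converge uniformly to `At` on the
compact sets of the Riemann sphere that avoid the poles of `At` (their traces on `ℂ` are the closed
sets of `ℂ` that avoid these poles), and a Jordan reduction of `At(∞)` unfolds into Jordan
reductions of the `A h (∞)`. -/
def ConfluenceUniform {n : ℕ} (A : ℝ → RatMat n) (At : RatMat n) : Prop :=
  (∀ K : Set ℂ, IsClosed K → Disjoint (poleSet At) K → ConvergesUniformlyOn A At K) ∧
  ∃ (At₀ : CMat n) (A₀ : ℝ → CMat n),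
    HasValueAtInfinity At At₀ ∧ NonResonant At₀ ∧
    (∀ᶠ h in 𝓝[>] (0 : ℝ), HasValueAtInfinity (A h) (A₀ h)) ∧
    JordanUnfolds At₀ A₀

/-- The hypothesis of the theorem: one of the two preceding kinds of confluence, no two poles of
`At` with the same imaginary part, and no real pole. -/
def ConfluenceHypothesis {n : ℕ} (h₀ : ℝ) (A : ℝ → RatMat n) (At : RatMat n) : Prop :=
  (ConfluenceFactorial h₀ A At ∨ ConfluenceUniform A At) ∧
  (∀ p ∈ poleSet At, ∀ q ∈ poleSet At, p ≠ q → p.im ≠ q.im) ∧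
  ∀ p ∈ poleSet At, p.im ≠ 0

/-! ### Cut planes, strips, and the limit differential system -/

/-- The plane without the half-lines `z_j + ℝ⁻`. -/
def cutPlus {r : ℕ} (z : Fin r → ℂ) : Set ℂ :=
  {x | ∀ j, ¬ (x.im = (z j).im ∧ x.re ≤ (z j).re)}

/-- The plane without the half-lines `z_j + ℝ⁺`. -/
def cutMinus {r : ℕ} (z : Fin r → ℂ) : Set ℂ :=
  {x | ∀ j, ¬ (x.im = (z j).im ∧ (z j).re ≤ x.re)}

/-- For points `z 0, …, z (r - 1)` with increasing imaginary parts, the components of the plane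
without the lines `z j + ℝ`, numbered upwards: `strip z 0` is the lowest one, and the lower boundary
of `strip z (j + 1)` is `z j + ℝ`. -/
def strip {r : ℕ} (z : Fin r → ℂ) (k : Fin (r + 1)) : Set ℂ :=
  {x | ∀ j : Fin r, (j.castSucc < k → (z j).im < x.im) ∧ (k ≤ j.castSucc → x.im < (z j).im)}

/-- `E` is a fundamental system of solutions of `x E'(x) = At(x) E(x)` on a set `U` that avoids
`0` and the poles of `At`. -/
def IsFundamentalSolutionOn {n : ℕ} (At : RatMat n) (U : Set ℂ) (E : ℂ → CMat n) : Prop :=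
  ∀ x ∈ U, (∀ i j, HasDerivAt (fun y => E y i j) ((evalMat At x * E x) i j / x) x) ∧
    IsUnit (E x).det

/-- On some right half-plane `E(x) = (I + ∑_{s ≥ 1} c_s x^{-s}) x^{At₀}`, with the principal
logarithm. -/
def HasFrobeniusForm {n : ℕ} (At₀ : CMat n) (E : ℂ → CMat n) : Prop :=
  ∃ (c : ℕ → CMat n) (F : ℂ → CMat n) (R : ℝ), c 0 = 1 ∧
    ∀ x : ℂ, R < x.re → HasSum (fun s => (x⁻¹) ^ s • c s) (F x) ∧
      E x = F x * NormedSpace.exp (Complex.log x • At₀)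

/-! ### Monodromy -/

/-- `f t`, for `t ∈ [0, 1]`, are the successive germs of an analytic continuation along `γ`. -/
def IsContinuationAlong {n : ℕ} (γ : ℝ → ℂ) (f : ℝ → ℂ → CMat n) : Prop :=
  ∀ t ∈ Set.Icc (0 : ℝ) 1,
    (∀ i j, AnalyticAt ℂ (fun x => f t x i j) (γ t)) ∧
    ∀ᶠ s in 𝓝[Set.Icc 0 1] t, f s =ᶠ[𝓝 (γ s)] f t

/-- Analytic continuation along the loop `γ` transforms `E` into `E M`. -/
def IsMonodromyAlong {n : ℕ} (γ : ℝ → ℂ) (E : ℂ → CMat n) (M : CMat n) : Prop :=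
  ∃ f : ℝ → ℂ → CMat n, IsContinuationAlong γ f ∧
    f 0 =ᶠ[𝓝 (γ 0)] E ∧ f 1 =ᶠ[𝓝 (γ 1)] fun x => E x * M

/-- `M` is the monodromy around `p`, in the basis `E` defined on `U`: analytic continuation along
every sufficiently small circle centred at `p`, run once in the positive direction from any of its
points in `U`, transforms `E` into `E M`. -/
def IsMonodromyAround {n : ℕ} (p : ℂ) (U : Set ℂ) (E : ℂ → CMat n) (M : CMat n) : Prop :=
  ∃ ε : ℝ, 0 < ε ∧ ∀ x ∈ U, 0 < ‖x - p‖ → ‖x - p‖ < ε →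
    IsMonodromyAlong
      (fun t : ℝ => p + (x - p) * Complex.exp (2 * Real.pi * Complex.I * t)) E M

end

noncomputable section

/-! ### Rising factorials of step `h` -/

section Rising

/-! Near +∞, the substitution Y = F e_{A(∞)} turns the system into an equation δ_{-h} F = L F + N
F(x - h) between series of h-factorials. The coefficient of index m is found from (m + L_0 + N_0)
F_m = -(terms of lower index), and L_0 + N_0 tends to the commutator X ↦ MX - XM with M the value of
the limit system at infinity. Non-resonance makes m + [M, ·] injective for m ≥ 1
(`NonResonant.eq_zero`), and in finite dimension this yields inverses of size O(1/m), uniformly in m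
and in small h. A majorant argument with the coefficients C λ^{[s]_h} of C/(x - λ) then gives all
the F^{(h)} one common type (`IsFacSolution.isTyped`). So they converge on a half-plane independent
of h, and dominated convergence lets h tend to 0 term by term; the limit is a power series in 1/x
(`tendsto_facSum`).

The matrix e_A^{(h)+} is the value at A of the entire function c ↦ h^c Γ(x/h)/Γ(x/h - c)
(`jordanSolution_eq`). It therefore depends on A and not on the Jordan reduction, and Γ(z)/Γ(z - c)
∼ z^c, uniformly for bounded c, makes it tend to x^A (`tendsto_matChar`). This settles existence,
uniqueness and convergence of the canonical solutions on a right half-plane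
(`LocalData.exists_canonical`).

Further to the left, the equation Y(x - h) = B_h(x) Y(x) continues the solution meromorphically. On
a compact subset of the cut plane B_h = 1 + O(h), and O(1/h) steps lead to the half-plane of
convergence, so for small h the solutions are holomorphic and bounded there, uniformly in h
(`ConfluentFamily.bounded`). Vitali's theorem carries the convergence leftwards along horizontal
lines, and the difference quotient becomes a derivative: the limit solves the differential system
(`ConfluentFamily.exists_limit`). It is invertible far to the right, hence everywhere, by Grönwall's
inequality.

The substitution x ↦ -x brings -∞ to an equation of the same shape, whose step matrix is an inverse.
Under hypothesis (b) the factorial coefficients are produced by Cauchy integrals, through the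
expansion of 1/(x - t) in h-factorials (`facSum_cauchyFacCoeff`), so that both hypotheses end in the
same `LocalData`.

Finally, two fundamental systems on a strip differ by a constant matrix: E⁻ = E⁺ P. Around z_j, the
system E⁺ is cut on the left and E⁻ on the right. Along a positive circle E⁺ reaches its cut from
above, where it is E⁻ P_{j+1}⁻¹; E⁻ crosses freely; below the cut E⁻ = E⁺ P_j. The continuation of
E⁺ is thus E⁺ P_j P_{j+1}⁻¹ (`isMonodromyAround_of_connection`). -/

theorem hRising_zero {K : Type*} [Field K] (h x : K) : hRising h x 0 = 1 := by
  simp [hRising]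

theorem hRising_succ {K : Type*} [Field K] (h x : K) (s : ℕ) :
    hRising h x (s + 1) = hRising h x s * (x + s * h) := by
  simp [hRising, Finset.prod_range_succ]

theorem hRising_succ_left {K : Type*} [Field K] (h x : K) (s : ℕ) :
    hRising h x (s + 1) = x * hRising h (x + h) s := by
  induction s with
  | zero => simp [hRising]
  | succ s ih =>
    rw [hRising_succ, ih, hRising_succ]
    push_cast
    ring

/-- The product of x^{-[s]_h} and (x + sh)^{-[j]_h} is x^{-[s+j]_h}. Hence, in a product of two
series of factorials, one factor has to be re-expanded at the shifted point x + sh; this is what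
governs `mulCoeff`. -/
theorem hRising_add {K : Type*} [Field K] (h x : K) (s j : ℕ) :
    hRising h x (s + j) = hRising h x s * hRising h (x + s * h) j := by
  induction j with
  | zero => simp [hRising_zero]
  | succ j ih =>
    rw [← add_assoc, hRising_succ, ih, hRising_succ]
    push_cast
    ring

theorem hRising_pos {h x : ℝ} (hh : 0 ≤ h) (hx : 0 < x) (s : ℕ) : 0 < hRising h x s :=
  Finset.prod_pos fun k _ => by positivity

theorem hRising_nonneg {h x : ℝ} (hh : 0 ≤ h) (hx : 0 ≤ x) (s : ℕ) : 0 ≤ hRising h x s :=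
  Finset.prod_nonneg fun k _ => by positivity

theorem hRising_le_hRising {h x y : ℝ} (hh : 0 ≤ h) (hx : 0 ≤ x) (hxy : x ≤ y) (s : ℕ) :
    hRising h x s ≤ hRising h y s :=
  Finset.prod_le_prod (fun k _ => by positivity) fun k _ => by linarith

theorem norm_hRising_le {h : ℝ} (hh : 0 ≤ h) (t : ℂ) (s : ℕ) :
    ‖hRising (h : ℂ) t s‖ ≤ hRising h ‖t‖ s := by
  rw [hRising, norm_prod]
  refine Finset.prod_le_prod (fun k _ => norm_nonneg _) fun k _ => ?_
  refine (norm_add_le _ _).trans ?_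
  simp [abs_of_nonneg hh]

/-- Each factor has modulus at least its real part, so series at x are dominated by those at `x.re`.
-/
theorem hRising_re_le_norm {h : ℝ} (hh : 0 ≤ h) {x : ℂ} (hx : 0 ≤ x.re) (s : ℕ) :
    hRising h x.re s ≤ ‖hRising (h : ℂ) x s‖ := by
  rw [hRising, hRising, norm_prod]
  refine Finset.prod_le_prod (fun k _ => by positivity) fun k _ => ?_
  refine le_trans (le_of_eq ?_) (Complex.re_le_norm _)
  simp

theorem hRising_ne_zero {h : ℝ} (hh : 0 ≤ h) {x : ℂ} (hx : 0 < x.re) (s : ℕ) :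
    hRising (h : ℂ) x s ≠ 0 := by
  rw [← norm_pos_iff]
  exact (hRising_pos hh hx s).trans_le (hRising_re_le_norm hh hx.le s)

/-- At X = lam + h the quotient telescopes to the right-hand side; a larger X only decreases it. -/
theorem hRising_div_le {h lam X : ℝ} (hh : 0 < h) (hl : 0 < lam) (hX : lam + h ≤ X) (N : ℕ) :
    hRising h lam N / hRising h X N ≤ lam / (lam + N * h) := by
  have h1 : hRising h lam N * (lam + N * h) = lam * hRising h (lam + h) N := by
    rw [← hRising_succ, hRising_succ_left]
  have h2 : hRising h (lam + h) N ≤ hRising h X N :=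
    hRising_le_hRising hh.le (by linarith) hX N
  have h3 := hRising_pos hh.le (by linarith : 0 < X) N
  rw [div_le_div_iff₀ h3 (by positivity), h1]
  exact mul_le_mul_of_nonneg_left h2 hl.le

theorem tendsto_hRising_div {h : ℝ} (hh : 0 < h) {t x : ℂ} (hx : ‖t‖ + h < x.re) :
    Tendsto (fun N => hRising (h : ℂ) t N / hRising (h : ℂ) x N) atTop (𝓝 0) := by
  set lam := x.re - h with hlam
  have hl : ‖t‖ < lam := by linarith
  have hl0 : 0 < lam := (norm_nonneg t).trans_lt hl
  have hlim : Tendsto (fun N : ℕ => lam / (lam + N * h)) atTop (𝓝 0) := by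
    refine Tendsto.div_atTop tendsto_const_nhds ?_
    exact tendsto_atTop_add_const_left _ _ (tendsto_natCast_atTop_atTop.atTop_mul_const hh)
  refine squeeze_zero_norm (fun N => ?_) hlim
  refine le_trans ?_ (hRising_div_le hh hl0 (X := x.re) (by linarith) N)
  rw [norm_div]
  have h3 := hRising_pos hh.le (by linarith : 0 < x.re) N
  refine div_le_div₀ (hRising_nonneg hh.le hl0.le N) ?_ h3 ?_
  · exact (norm_hRising_le hh.le t N).trans (hRising_le_hRising hh.le (norm_nonneg _) hl.le N)
  · exact hRising_re_le_norm hh.le (by linarith) N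

/-- Each term, multiplied by x - t, is the difference of two consecutive quotients t^{[j]}/x^{[j]},
so the sum telescopes. This is the finite form of the expansion of 1/(x - t), and the source of the
majorant C/(X - lam) of every typed series. -/
theorem sum_hRising_div {K : Type*} [Field K] (h t x : K) (hx : ∀ s, hRising h x s ≠ 0) (N : ℕ) :
    (x - t) * ∑ j ∈ Finset.range N, hRising h t j / hRising h x (j + 1) =
      1 - hRising h t N / hRising h x N := by
  induction N with
  | zero => simp [hRising_zero]
  | succ N ih =>
    rw [Finset.sum_range_succ, mul_add, ih, hRising_succ, hRising_succ]
    have h1 := hx N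
    have h2 : x + N * h ≠ 0 := by
      have := hx (N + 1)
      rw [hRising_succ] at this
      exact right_ne_zero_of_mul this
    field_simp
    ring

theorem sum_hRising_div_le {h lam X : ℝ} (hh : 0 ≤ h) (hl : 0 ≤ lam) (hX : lam < X) (N : ℕ) :
    ∑ j ∈ Finset.range N, hRising h lam j / hRising h X (j + 1) ≤ 1 / (X - lam) := by
  have h1 := sum_hRising_div h lam X (fun s => (hRising_pos hh (hl.trans_lt hX) s).ne') N
  rw [le_div_iff₀ (by linarith), mul_comm, h1]
  have := div_nonneg (hRising_nonneg hh hl N) (hRising_nonneg hh (hl.trans hX.le) N)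
  linarith

theorem summable_hRising_div {h lam X : ℝ} (hh : 0 ≤ h) (hl : 0 ≤ lam) (hX : lam < X) :
    Summable fun j => hRising h lam j / hRising h X (j + 1) :=
  summable_of_sum_range_le
    (fun _ => div_nonneg (hRising_nonneg hh hl _) (hRising_nonneg hh (hl.trans hX.le) _))
    (sum_hRising_div_le hh hl hX)

theorem tsum_hRising_div_le {h lam X : ℝ} (hh : 0 ≤ h) (hl : 0 ≤ lam) (hX : lam < X) :
    ∑' j, hRising h lam j / hRising h X (j + 1) ≤ 1 / (X - lam) :=
  Real.tsum_le_of_sum_range_le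
    (fun _ => div_nonneg (hRising_nonneg hh hl _) (hRising_nonneg hh (hl.trans hX.le) _))
    (sum_hRising_div_le hh hl hX)

theorem norm_hRising_div_le {h : ℝ} (hh : 0 ≤ h) {t x : ℂ} (hx : ‖t‖ < x.re) (j : ℕ) :
    ‖hRising (h : ℂ) t j / hRising (h : ℂ) x (j + 1)‖ ≤
      hRising h ‖t‖ j / hRising h x.re (j + 1) := by
  have hx0 : 0 < x.re := (norm_nonneg t).trans_lt hx
  rw [norm_div]
  exact div_le_div₀ (hRising_nonneg hh (norm_nonneg _) _) (norm_hRising_le hh t j)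
    (hRising_pos hh hx0 _) (hRising_re_le_norm hh hx0.le _)

/-- The expansion of `1 / (x - t)` as a series of `h`-factorials. -/
theorem hasSum_hRising_div {h : ℝ} (hh : 0 < h) {t x : ℂ} (hx : ‖t‖ + h < x.re) :
    HasSum (fun j => hRising (h : ℂ) t j / hRising (h : ℂ) x (j + 1)) (1 / (x - t)) := by
  have hx' : ‖t‖ < x.re := by linarith
  have hx0 : 0 < x.re := (norm_nonneg t).trans_lt hx'
  have hs : Summable fun j => hRising (h : ℂ) t j / hRising (h : ℂ) x (j + 1) :=
    Summable.of_norm_bounded (summable_hRising_div hh.le (norm_nonneg t) hx')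
      (norm_hRising_div_le hh.le hx')
  have hne : x - t ≠ 0 := by
    intro h0
    have : x = t := sub_eq_zero.mp h0
    have := Complex.re_le_norm t
    simp_all
    linarith
  have h1 : Tendsto (fun N => ∑ j ∈ Finset.range N,
      hRising (h : ℂ) t j / hRising (h : ℂ) x (j + 1)) atTop (𝓝 (1 / (x - t))) := by
    have h2 := ((tendsto_hRising_div hh hx).const_sub 1).div_const (x - t)
    rw [sub_zero] at h2
    refine h2.congr fun N => ?_
    rw [← sum_hRising_div (h : ℂ) t x (fun s => hRising_ne_zero hh.le hx0 s) N,
      mul_div_cancel_left₀ _ hne]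
  exact (hs.hasSum_iff_tendsto_nat).2 h1

/-- For h = 1 this is an equality, both sides being lam^{[s+3]}. The quotients (lam + sh)/(lam + 3 +
sh) increase with h, so h = 1 is the worst case. The gain is a decay in s⁻³, uniform in h, that
survives multiplication by s. -/
theorem hRising_mul_cubic_le {h lam : ℝ} (hh : 0 ≤ h) (h1 : h ≤ 1) (hl : 0 ≤ lam) (s : ℕ) :
    hRising h lam s * ((lam + s) * (lam + s + 1) * (lam + s + 2)) ≤
      lam * (lam + 1) * (lam + 2) * hRising h (lam + 3) s := by
  induction s with
  | zero => simp [hRising_zero]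
  | succ s ih =>
    rw [hRising_succ, hRising_succ]
    have h0 : (lam + s * h) * (lam + s + 3) ≤ (lam + 3 + s * h) * (lam + s) := by
      have : (0 : ℝ) ≤ s * (1 - h) := mul_nonneg (Nat.cast_nonneg _) (by linarith)
      nlinarith
    have hR := hRising_nonneg hh hl s
    calc hRising h lam s * (lam + s * h) *
          ((lam + (s + 1 : ℕ)) * (lam + (s + 1 : ℕ) + 1) * (lam + (s + 1 : ℕ) + 2))
        = (hRising h lam s * ((lam + s + 1) * (lam + s + 2))) *
            ((lam + s * h) * (lam + s + 3)) := by push_cast; ring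
      _ ≤ (hRising h lam s * ((lam + s + 1) * (lam + s + 2))) *
            ((lam + 3 + s * h) * (lam + s)) := by gcongr
      _ = hRising h lam s * ((lam + s) * (lam + s + 1) * (lam + s + 2)) * (lam + 3 + s * h) := by
          ring
      _ ≤ lam * (lam + 1) * (lam + 2) * hRising h (lam + 3) s * (lam + 3 + s * h) := by gcongr
      _ = _ := by ring

/-- A bound for the terms of a series of factorials that is uniform in `h ∈ ]0, 1]`. -/
theorem hRising_div_norm_le {h lam : ℝ} (hh : 0 ≤ h) (h1 : h ≤ 1) (hl : 1 ≤ lam) {x : ℂ}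
    (hx : lam + 3 ≤ x.re) (s : ℕ) :
    hRising h lam s / ‖hRising (h : ℂ) x (s + 1)‖ ≤ (lam + 2) ^ 3 / ((s : ℝ) + 1) ^ 3 := by
  have hx0 : 0 < x.re := by linarith
  have h3 := hRising_pos hh (by linarith : 0 < lam + 3) s
  have h4 : hRising h (lam + 3) s ≤ ‖hRising (h : ℂ) x (s + 1)‖ := by
    refine le_trans ?_ (hRising_re_le_norm hh hx0.le _)
    rw [hRising_succ]
    have h5 := hRising_le_hRising hh (by linarith) hx s
    have h6 : (1 : ℝ) ≤ x.re + s * h := by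
      have : (0 : ℝ) ≤ s * h := by positivity
      linarith
    nlinarith
  have h7 := hRising_mul_cubic_le hh h1 (by linarith : 0 ≤ lam) s
  have h8 : ((s : ℝ) + 1) ^ 3 ≤ (lam + s) * (lam + s + 1) * (lam + s + 2) := by
    have : (0 : ℝ) ≤ s := Nat.cast_nonneg s
    have e1 : (s : ℝ) + 1 ≤ lam + s := by linarith
    have e2 : (s : ℝ) + 1 ≤ lam + s + 1 := by linarith
    have e3 : (s : ℝ) + 1 ≤ lam + s + 2 := by linarith
    calc ((s : ℝ) + 1) ^ 3 = (s + 1) * (s + 1) * (s + 1) := by ring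
      _ ≤ (lam + s) * (lam + s + 1) * (lam + s + 2) :=
        mul_le_mul (mul_le_mul e1 e2 (by positivity) (by positivity)) e3 (by positivity)
          (by positivity)
  have h9 : lam * (lam + 1) * (lam + 2) ≤ (lam + 2) ^ 3 := by nlinarith
  have hR := hRising_nonneg hh (by linarith : 0 ≤ lam) s
  rw [div_le_div_iff₀ (h3.trans_le h4) (by positivity)]
  calc hRising h lam s * ((s : ℝ) + 1) ^ 3
      ≤ hRising h lam s * ((lam + s) * (lam + s + 1) * (lam + s + 2)) := by gcongr
    _ ≤ _ := h7
    _ ≤ (lam + 2) ^ 3 * ‖hRising (h : ℂ) x (s + 1)‖ := by gcongr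

end Rising

/-! ### Typed coefficients and the sums of their series of factorials -/

section FacSum

variable {E : Type*} [NormedAddCommGroup E] [NormedSpace ℂ E]

/-- The coefficients `a` are bounded, from the index `1` on, by those of `C / (x - lam)`. -/
def IsTyped (h C lam : ℝ) (a : ℕ → E) : Prop :=
  ∀ s, ‖a (s + 1)‖ ≤ C * hRising h lam s

/-- A term of a series of `h`-factorials. -/
def facTerm (h : ℝ) (a : ℕ → E) (x : ℂ) (s : ℕ) : E := (hRising (h : ℂ) x s)⁻¹ • a s

/-- The sum of a series of `h`-factorials. -/
def facSum (h : ℝ) (a : ℕ → E) (x : ℂ) : E := ∑' s, facTerm h a x s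

omit [NormedSpace ℂ E] in
theorem IsTyped.nonneg {h C lam : ℝ} {a : ℕ → E} (ha : IsTyped h C lam a) : 0 ≤ C := by
  have := (norm_nonneg _).trans (ha 0)
  simpa [hRising_zero] using this

omit [NormedSpace ℂ E] in
theorem IsTyped.mono {h C lam C' lam' : ℝ} {a : ℕ → E} (ha : IsTyped h C lam a) (hh : 0 ≤ h)
    (hl : 0 ≤ lam) (hC : C ≤ C') (hll : lam ≤ lam') : IsTyped h C' lam' a := fun s =>
  (ha s).trans (mul_le_mul hC (hRising_le_hRising hh hl hll s) (hRising_nonneg hh hl s)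
    (ha.nonneg.trans hC))

theorem facTerm_zero (h : ℝ) (a : ℕ → E) (x : ℂ) : facTerm h a x 0 = a 0 := by
  simp [facTerm, hRising_zero]

theorem IsTyped.norm_facTerm_le {h C lam : ℝ} {a : ℕ → E} (ha : IsTyped h C lam a) (hh : 0 ≤ h)
    (hl : 0 ≤ lam) {x : ℂ} (hx : lam < x.re) (s : ℕ) :
    ‖facTerm h a x (s + 1)‖ ≤ C * (hRising h lam s / hRising h x.re (s + 1)) := by
  have hx0 : 0 < x.re := hl.trans_lt hx
  have h3 := hRising_pos hh hx0 (s + 1)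
  rw [facTerm, norm_smul, norm_inv, ← mul_div_assoc, inv_mul_eq_div]
  exact div_le_div₀ (mul_nonneg ha.nonneg (hRising_nonneg hh hl s)) (ha s) h3
    (hRising_re_le_norm hh hx0.le _)

theorem IsTyped.norm_facTerm_le_cubic {h C lam : ℝ} {a : ℕ → E} (ha : IsTyped h C lam a)
    (hh : 0 ≤ h) (h1 : h ≤ 1) (hl : 1 ≤ lam) {x : ℂ} (hx : lam + 3 ≤ x.re) (s : ℕ) :
    ‖facTerm h a x (s + 1)‖ ≤ C * ((lam + 2) ^ 3 / ((s : ℝ) + 1) ^ 3) := by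
  refine le_trans ?_ (mul_le_mul_of_nonneg_left (hRising_div_norm_le hh h1 hl hx s) ha.nonneg)
  rw [facTerm, norm_smul, norm_inv, ← mul_div_assoc, inv_mul_eq_div]
  gcongr
  exact ha s

theorem IsTyped.summable_norm {h C lam : ℝ} {a : ℕ → E} (ha : IsTyped h C lam a) (hh : 0 ≤ h)
    (hl : 0 ≤ lam) {x : ℂ} (hx : lam < x.re) : Summable fun s => ‖facTerm h a x s‖ := by
  rw [← summable_nat_add_iff 1]
  exact Summable.of_nonneg_of_le (fun s => norm_nonneg _) (ha.norm_facTerm_le hh hl hx)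
    ((summable_hRising_div hh hl hx).mul_left C)

theorem IsTyped.hasSum [CompleteSpace E] {h C lam : ℝ} {a : ℕ → E} (ha : IsTyped h C lam a)
    (hh : 0 ≤ h) (hl : 0 ≤ lam) {x : ℂ} (hx : lam < x.re) :
    HasSum (facTerm h a x) (facSum h a x) :=
  (ha.summable_norm hh hl hx).of_norm.hasSum

theorem IsTyped.tsum_norm_le {h C lam : ℝ} {a : ℕ → E} (ha : IsTyped h C lam a) (hh : 0 ≤ h)
    (hl : 0 ≤ lam) {x : ℂ} (hx : lam < x.re) :
    ∑' s, ‖facTerm h a x (s + 1)‖ ≤ C / (x.re - lam) := by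
  have h1 := (summable_hRising_div hh hl hx).mul_left C
  calc ∑' s, ‖facTerm h a x (s + 1)‖
      ≤ ∑' s, C * (hRising h lam s / hRising h x.re (s + 1)) :=
        Summable.tsum_le_tsum (ha.norm_facTerm_le hh hl hx)
          ((summable_nat_add_iff 1).2 (ha.summable_norm hh hl hx)) h1
    _ = C * ∑' s, hRising h lam s / hRising h x.re (s + 1) := tsum_mul_left
    _ ≤ C * (1 / (x.re - lam)) :=
        mul_le_mul_of_nonneg_left (tsum_hRising_div_le hh hl hx) ha.nonneg
    _ = _ := by ring

theorem IsTyped.norm_facSum_sub_le [CompleteSpace E] {h C lam : ℝ} {a : ℕ → E}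
    (ha : IsTyped h C lam a) (hh : 0 ≤ h) (hl : 0 ≤ lam) {x : ℂ} (hx : lam < x.re) :
    ‖facSum h a x - a 0‖ ≤ C / (x.re - lam) := by
  have hs := ha.summable_norm hh hl hx
  have h0 := hs.of_norm.tsum_eq_zero_add
  have h1 : facSum h a x - a 0 = ∑' s, facTerm h a x (s + 1) := by
    rw [facTerm_zero] at h0
    rw [facSum, h0, add_sub_cancel_left]
  have h2 : Summable fun s => ‖facTerm h a x (s + 1)‖ :=
    (summable_nat_add_iff (f := fun s => ‖facTerm h a x s‖) 1).2 hs
  rw [h1]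
  exact (norm_tsum_le_tsum_norm h2).trans (ha.tsum_norm_le hh hl hx)

/-- The coefficients of a series of factorials that converges at a positive real number are
typed. -/
theorem exists_isTyped_of_summable {h : ℝ} (hh : 0 ≤ h) {a : ℕ → E} {x : ℝ} (hx : 1 ≤ x)
    (hs : Summable (facTerm h a (x : ℂ))) : ∃ C lam, 1 ≤ lam ∧ IsTyped h C lam a := by
  obtain ⟨M, hM⟩ : ∃ M, ∀ s, ‖facTerm h a (x : ℂ) s‖ ≤ M := by
    obtain ⟨M, hM⟩ := (hs.tendsto_atTop_zero.norm).bddAbove_range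
    exact ⟨M, fun s => hM ⟨s, rfl⟩⟩
  -- If the terms at x are bounded by M, then ‖a (s + 1)‖ ≤ M x^{[s+1]} = M x (x + h)^{[s]}.
  refine ⟨M * x, x + h, by linarith, fun s => ?_⟩
  have h1 := hM (s + 1)
  have hR : ‖hRising (h : ℂ) (x : ℂ) (s + 1)‖ = x * hRising h (x + h) s := by
    rw [← hRising_succ_left]
    have h2 : hRising (h : ℂ) (x : ℂ) (s + 1) = ((hRising h x (s + 1) : ℝ) : ℂ) := by
      simp [hRising]
    rw [h2, Complex.norm_real, Real.norm_of_nonneg (hRising_nonneg hh (by linarith) _)]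
  rw [facTerm, norm_smul, norm_inv, hR, inv_mul_le_iff₀ ] at h1
  · linarith
  · exact mul_pos (by linarith) (hRising_pos hh (by linarith) s)

/-- The coefficients of a series of factorials are determined by its sum. -/
theorem facTerm_coeff_unique [CompleteSpace E] {h : ℝ} (hh : 0 ≤ h) (m : ℕ) :
    ∀ a : ℕ → E, (∃ R : ℝ, ∀ x : ℂ, R < x.re → HasSum (facTerm h a x) 0) → a m = 0 := by
  -- The tail of a typed series is at most C/(X - lam), so `a 0` is the limit of the sum as X → +∞.
  have key : ∀ a : ℕ → E, (∃ R : ℝ, ∀ x : ℂ, R < x.re → HasSum (facTerm h a x) 0) → a 0 = 0 := by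
    rintro a ⟨R, hR⟩
    obtain ⟨C, lam, hl, ha⟩ := exists_isTyped_of_summable hh (x := max (R + 1) 1) (le_max_right _ _)
      (hR _ (by simp only [Complex.ofReal_re]; linarith [le_max_left (R + 1) (1 : ℝ)])).summable
    have h1 : ∀ᶠ X : ℝ in atTop, ‖a 0‖ ≤ C / (X - lam) := by
      filter_upwards [eventually_gt_atTop R, eventually_gt_atTop lam] with X h1 h2
      have h3 := ha.norm_facSum_sub_le hh (by linarith) (x := (X : ℂ)) (by simpa using h2)
      rw [facSum, (hR X (by simpa using h1)).tsum_eq] at h3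
      simpa using h3
    have h2 : Tendsto (fun X : ℝ => C / (X - lam)) atTop (𝓝 0) :=
      Tendsto.div_atTop tendsto_const_nhds (tendsto_atTop_add_const_right _ _ tendsto_id)
    have := ge_of_tendsto h2 h1
    simpa using this
  induction m with
  | zero => exact key
  | succ m ih =>
    rintro a ⟨R, hR⟩
    have h0 := key a ⟨R, hR⟩
    -- As `a 0` vanishes, multiplying the series at x - h by x - h lowers all indices by one: (x -
    -- h)^{[s+1]} = (x - h) x^{[s]}.
    refine ih (fun s => a (s + 1)) ⟨max R 0 + h, fun x hx => ?_⟩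
    have hx1 : R < (x - h).re := by
      simp only [Complex.sub_re, Complex.ofReal_re]; linarith [le_max_left R 0]
    have hx2 : 0 < (x - h).re := by
      simp only [Complex.sub_re, Complex.ofReal_re]; linarith [le_max_right R 0]
    have hne : x - h ≠ 0 := fun h => by simp [h] at hx2
    have h1 := (hasSum_nat_add_iff' 1).2 (hR _ hx1)
    simp only [Finset.sum_range_one, facTerm_zero, h0, sub_zero] at h1
    have h2 := h1.const_smul (x - (h : ℂ))
    rw [smul_zero] at h2
    convert h2 using 2 with s
    rw [facTerm, facTerm, hRising_succ_left, sub_add_cancel, smul_smul, mul_inv,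
      mul_inv_cancel_left₀ hne]

end FacSum

end

noncomputable section

/-! ### Operations on series of factorials -/

section Operations

variable {E : Type*} [NormedAddCommGroup E] [NormedSpace ℂ E]
  {F : Type*} [NormedAddCommGroup F] [NormedSpace ℂ F]

/-- The coefficients of `x ↦ f (x - h)`. -/
def shiftCoeff (h : ℝ) (a : ℕ → E) : ℕ → E
  | 0 => a 0
  | m + 1 => a (m + 1) + ((m : ℂ) * h) • shiftCoeff h a m

/-- The coefficients of `x ↦ x⁻¹ f(x)`. -/
def invCoeff (h : ℝ) (a : ℕ → E) : ℕ → E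
  | 0 => 0
  | m + 1 => a m + (((m - 1 : ℕ) : ℂ) * h) • invCoeff h a m

/-- The coefficients of a product. -/
def mulCoeff (h : ℝ) (L : ℕ → E →L[ℂ] F) (a : ℕ → E) (m : ℕ) : F :=
  ∑ p ∈ Finset.HasAntidiagonal.antidiagonal m, ((shiftCoeff h)^[p.1] L) p.2 (a p.1)

theorem shiftCoeff_zero (h : ℝ) (a : ℕ → E) : shiftCoeff h a 0 = a 0 := rfl

theorem shiftCoeff_succ (h : ℝ) (a : ℕ → E) (m : ℕ) :
    shiftCoeff h a (m + 1) = a (m + 1) + ((m : ℂ) * h) • shiftCoeff h a m := rfl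

theorem shiftCoeff_one (h : ℝ) (a : ℕ → E) : shiftCoeff h a 1 = a 1 := by
  simp [shiftCoeff_succ]

theorem shiftCoeff_iterate_zero (h : ℝ) (a : ℕ → E) (s : ℕ) :
    ((shiftCoeff h)^[s] a) 0 = a 0 := by
  induction s with
  | zero => rfl
  | succ s ih => rw [Function.iterate_succ_apply', shiftCoeff_zero, ih]

theorem norm_natCast_mul_ofReal {h : ℝ} (hh : 0 ≤ h) (m : ℕ) : ‖(m : ℂ) * h‖ = m * h := by
  simp [abs_of_nonneg hh]

/-- The recursion closes because lam + (s + 1)h is the last factor of (lam + h)^{[s+1]}: a shift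
changes lam into lam + h and keeps C. The truncation at N serves the induction of
`IsFacSolution.isTyped`, where the bounds are known only below the current index. -/
theorem norm_shiftCoeff_succ_le {h C lam : ℝ} {a : ℕ → E} (hh : 0 ≤ h) {N : ℕ}
    (ha : ∀ s < N, ‖a (s + 1)‖ ≤ C * hRising h lam s) :
    ∀ s < N, ‖shiftCoeff h a (s + 1)‖ ≤ C * hRising h (lam + h) s := by
  intro s
  induction s with
  | zero => simpa [shiftCoeff_one, hRising_zero] using ha 0
  | succ s ih =>
    intro hs
    rw [shiftCoeff_succ]
    refine (norm_add_le _ _).trans ?_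
    rw [norm_smul, norm_natCast_mul_ofReal hh]
    have h1 := ha (s + 1) hs
    have h2 := ih (by omega)
    rw [hRising_succ_left] at h1
    calc ‖a (s + 1 + 1)‖ + ((s + 1 : ℕ) : ℝ) * h * ‖shiftCoeff h a (s + 1)‖
        ≤ C * (lam * hRising h (lam + h) s) +
            ((s + 1 : ℕ) : ℝ) * h * (C * hRising h (lam + h) s) := by gcongr
      _ = C * hRising h (lam + h) (s + 1) := by rw [hRising_succ]; push_cast; ring

theorem IsTyped.shiftCoeff {h C lam : ℝ} {a : ℕ → E} (ha : IsTyped h C lam a) (hh : 0 ≤ h) :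
    IsTyped h C (lam + h) (shiftCoeff h a) := fun s =>
  norm_shiftCoeff_succ_le hh (N := s + 1) (fun k _ => ha k) s (Nat.lt_succ_self s)

theorem IsTyped.shiftCoeff_iterate {h C lam : ℝ} {a : ℕ → E} (ha : IsTyped h C lam a)
    (hh : 0 ≤ h) (s : ℕ) :
    IsTyped h C (lam + s * h) ((_root_.shiftCoeff h)^[s] a) := by
  induction s with
  | zero => simpa using ha
  | succ s ih =>
    rw [Function.iterate_succ_apply']
    have := ih.shiftCoeff hh
    convert this using 1
    push_cast
    ring

/-- The induction step needs ‖a (s + 1)‖ ≤ M lam^{[s]} lam, whence lam ≥ 1. The value `a 0`, which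
the type does not control, becomes the coefficient of index 1 and so enters the constant. -/
theorem IsTyped.invCoeff {h C lam : ℝ} {a : ℕ → E} (ha : IsTyped h C lam a) (hh : 0 ≤ h)
    (hl : 1 ≤ lam) : IsTyped h (max C ‖a 0‖) lam (invCoeff h a) := by
  have hC := ha.nonneg
  have hM : 0 ≤ max C ‖a 0‖ := hC.trans (le_max_left _ _)
  intro s
  induction s with
  | zero => simp [_root_.invCoeff, hRising_zero]
  | succ s ih =>
    have e : _root_.invCoeff h a (s + 1 + 1) =
      a (s + 1) + ((s : ℂ) * h) • _root_.invCoeff h a (s + 1) := rfl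
    rw [e]
    refine (norm_add_le _ _).trans ?_
    rw [norm_smul, norm_natCast_mul_ofReal hh]
    have hR := hRising_nonneg hh (by linarith : 0 ≤ lam) s
    calc ‖a (s + 1)‖ + (s : ℝ) * h * ‖_root_.invCoeff h a (s + 1)‖
        ≤ max C ‖a 0‖ * hRising h lam s * lam +
            (s : ℝ) * h * (max C ‖a 0‖ * hRising h lam s) := by
          gcongr
          calc ‖a (s + 1)‖ ≤ C * hRising h lam s := ha s
            _ ≤ max C ‖a 0‖ * hRising h lam s := by gcongr; exact le_max_left _ _
            _ ≤ _ := le_mul_of_one_le_right (by positivity) hl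
      _ = max C ‖a 0‖ * hRising h lam (s + 1) := by rw [hRising_succ]; ring

variable {h C lam : ℝ}

/-- The weights `s` do not destroy the convergence of series of factorials. -/
theorem IsTyped.summable_mul_norm {a : ℕ → E} (ha : IsTyped h C lam a) (hh : 0 ≤ h) (h1 : h ≤ 1)
    (hl : 1 ≤ lam) {x : ℂ} (hx : lam + 3 ≤ x.re) :
    Summable fun s : ℕ => (s : ℝ) * ‖facTerm h a x s‖ := by
  rw [← summable_nat_add_iff 1]
  have hC := ha.nonneg
  refine Summable.of_nonneg_of_le (fun s => by positivity) (fun s => ?_)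
    (((summable_nat_add_iff 1).2 (Real.summable_one_div_nat_pow (p := 2).2 (by norm_num))).mul_left
      (C * (lam + 2) ^ 3))
  have h2 := ha.norm_facTerm_le_cubic hh h1 hl hx s
  have h3 : (0 : ℝ) < (s : ℝ) + 1 := by positivity
  calc ((s + 1 : ℕ) : ℝ) * ‖facTerm h a x (s + 1)‖
      ≤ ((s : ℝ) + 1) * (C * ((lam + 2) ^ 3 / ((s : ℝ) + 1) ^ 3)) := by
        push_cast; gcongr
    _ = C * (lam + 2) ^ 3 * (1 / ((s + 1 : ℕ) : ℝ) ^ 2) := by push_cast; field_simp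

/-- The truncated difference and the complex one disagree only at m = 0, where `invCoeff` vanishes.
-/
theorem natCast_sub_one_smul_invCoeff (h : ℝ) (a : ℕ → E) (m : ℕ) :
    (((m - 1 : ℕ) : ℂ) * h) • invCoeff h a m = (((m : ℂ) - 1) * h) • invCoeff h a m := by
  rcases m with _ | m
  · simp [invCoeff]
  · simp

variable [CompleteSpace E] [CompleteSpace F]

/-- Let b be the shifted coefficients. With a_{m+1} = b_{m+1} - m h b_m and (x - h)^{[m+1]} = (x -
h) x^{[m]}, the term of index m + 1 at x - h is b_{m+1} x^{-[m+1]} plus the increment of the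
sequence m h/(x - h) · b_m x^{-[m]}. The increments sum to zero; the cubic decay of the terms makes
the series with weights m converge. -/
theorem facSum_shiftCoeff {a : ℕ → E} (ha : IsTyped h C lam a) (hh : 0 ≤ h) (h1 : h ≤ 1)
    (hl : 1 ≤ lam) {x : ℂ} (hx : lam + 4 ≤ x.re) :
    facSum h (shiftCoeff h a) x = facSum h a (x - h) := by
  set b := shiftCoeff h a with hb
  have hbt : IsTyped h C (lam + h) b := ha.shiftCoeff hh
  have hx0 : 0 < x.re := by linarith
  have hxh : 0 < (x - h).re := by simp only [Complex.sub_re, Complex.ofReal_re]; linarith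
  have hne : x - h ≠ 0 := fun h => by simp [h] at hxh
  have hb1 := hbt.hasSum hh (by linarith) (x := x) (by linarith)
  have hbm : Summable fun m : ℕ => ((m : ℂ) * (h / (x - h))) • facTerm h b x m := by
    refine Summable.of_norm ?_
    have := (hbt.summable_mul_norm hh h1 (by linarith) (x := x) (by linarith)).mul_left
      ‖(h : ℂ) / (x - h)‖
    refine this.congr fun m => ?_
    rw [norm_smul, norm_mul, Complex.norm_natCast]
    ring
  obtain ⟨S, hS⟩ := hbm
  have hS1 := (hasSum_nat_add_iff' 1).2 hS
  simp only [Finset.sum_range_one, Nat.cast_zero, zero_mul, zero_smul, sub_zero] at hS1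
  have hb2 := (hasSum_nat_add_iff' 1).2 hb1
  simp only [Finset.sum_range_one] at hb2
  have h3 := (hb2.add hS1).sub hS
  rw [add_sub_cancel_right] at h3
  have h4 := (hasSum_nat_add_iff' (f := facTerm h a (x - h)) (g := facSum h b x) 1).1
  simp only [Finset.sum_range_one] at h4
  refine (HasSum.tsum_eq (h4 ?_)).symm
  convert h3 using 1
  · funext m
    have e1 : a (m + 1) = b (m + 1) - ((m : ℂ) * h) • b m := by
      rw [hb, shiftCoeff_succ, add_sub_cancel_right]
    have hm : hRising (h : ℂ) x m ≠ 0 := hRising_ne_zero hh hx0 m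
    have hm1 : x + m * h ≠ 0 := by
      have := hRising_ne_zero hh hx0 (m + 1)
      rw [hRising_succ] at this
      exact right_ne_zero_of_mul this
    have hm2 : x + h * m ≠ 0 := by rwa [mul_comm]
    simp only [facTerm]
    rw [hRising_succ_left (h : ℂ) (x - h), sub_add_cancel, hRising_succ, e1, smul_sub, smul_smul,
      smul_smul, smul_smul, ← add_smul]
    congr 2
    · push_cast
      field_simp
      ring
    · field_simp
  · rw [facTerm_zero, facTerm_zero]
    rfl

theorem facSum_shiftCoeff_iterate {a : ℕ → E} (ha : IsTyped h C lam a) (hh : 0 ≤ h) (h1 : h ≤ 1)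
    (hl : 1 ≤ lam) {x : ℂ} (hx : lam + 4 ≤ x.re) (s : ℕ) :
    facSum h ((shiftCoeff h)^[s] a) (x + s * h) = facSum h a x := by
  induction s with
  | zero => simp
  | succ s ih =>
    have hsh : (0 : ℝ) ≤ s * h := by positivity
    rw [Function.iterate_succ_apply', facSum_shiftCoeff (ha.shiftCoeff_iterate hh s)
      hh h1 (by linarith), ← ih]
    · congr 1
      push_cast
      ring
    · simp
      linarith

/-- `δ_{-h}` multiplies `x^{-[s]}` by `-s`. -/
theorem hasSum_hDelta {a : ℕ → E} (ha : IsTyped h C lam a) (hh : 0 < h) (hl : 0 ≤ lam) {x : ℂ}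
    (hx : lam + h < x.re) :
    HasSum (fun s : ℕ => facTerm h (fun s => -(s : ℂ) • a s) x s)
      (((x - h) / h) • (facSum h a x - facSum h a (x - h))) := by
  have hxh : lam < (x - h).re := by simp only [Complex.sub_re, Complex.ofReal_re]; linarith
  have hne : x - h ≠ 0 := fun h => by simp [h] at hxh; linarith
  have h1 := ((ha.hasSum hh.le hl (x := x) (by linarith)).sub
    (ha.hasSum hh.le hl hxh)).const_smul ((x - h) / h)
  convert h1 using 2 with s
  have hx0 : 0 < x.re := by linarith
  have hhc : (h : ℂ) ≠ 0 := by exact_mod_cast hh.ne'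
  rw [facTerm, facTerm, facTerm, ← sub_smul, smul_smul, smul_smul]
  congr 1
  rcases s with _ | s
  · simp [hRising_zero]
  · have hm : hRising (h : ℂ) x s ≠ 0 := hRising_ne_zero hh.le hx0 s
    have hm1 : x + s * h ≠ 0 := by
      have := hRising_ne_zero hh.le hx0 (s + 1)
      rw [hRising_succ] at this
      exact right_ne_zero_of_mul this
    rw [hRising_succ_left (h : ℂ) (x - h), sub_add_cancel, hRising_succ]
    push_cast
    field_simp
    ring

/-- The telescoping of `facSum_shiftCoeff`, now for the sequence (m - 1) h b_m x^{-[m]}, where b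
denotes the coefficients of the quotient by x. -/
theorem facSum_invCoeff {a : ℕ → E} (ha : IsTyped h C lam a) (hh : 0 ≤ h) (h1 : h ≤ 1)
    (hl : 1 ≤ lam) {x : ℂ} (hx : lam + 3 ≤ x.re) :
    facSum h (invCoeff h a) x = x⁻¹ • facSum h a x := by
  set b := invCoeff h a with hb
  have hbt : IsTyped h (max C ‖a 0‖) lam b := ha.invCoeff hh (by linarith)
  have hx0 : 0 < x.re := by linarith
  have hne : x ≠ 0 := fun h => by simp [h] at hx0
  have hb1 := hbt.hasSum hh (by linarith) (x := x) (by linarith)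
  have hbm : Summable fun m : ℕ => (m : ℂ) • facTerm h b x m := by
    refine Summable.of_norm ?_
    refine (hbt.summable_mul_norm hh h1 hl hx).congr fun m => ?_
    rw [norm_smul, Complex.norm_natCast]
  obtain ⟨S, hS⟩ := hbm
  have hS1 := (hasSum_nat_add_iff' 1).2 hS
  simp only [Finset.sum_range_one, Nat.cast_zero, zero_smul, sub_zero] at hS1
  have hb2 := (hasSum_nat_add_iff' 1).2 hb1
  simp only [Finset.sum_range_one] at hb2
  have hb0 : facTerm h b x 0 = 0 := by rw [facTerm_zero]; rfl
  rw [hb0, sub_zero] at hb2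
  have h3 := (((hb2.const_smul x).add ((hS1.sub hb2).const_smul (h : ℂ))).sub
    ((hS.sub hb1).const_smul (h : ℂ)))
  rw [add_sub_cancel_right] at h3
  rw [eq_inv_smul_iff₀ hne, facSum, facSum]
  refine (HasSum.tsum_eq ?_).symm
  convert h3 using 1
  · funext m
    have e1 : a m = b (m + 1) - (((m : ℂ) - 1) * h) • b m := by
      rw [hb, ← natCast_sub_one_smul_invCoeff]
      exact (add_sub_cancel_right _ _).symm
    have hm : hRising (h : ℂ) x m ≠ 0 := hRising_ne_zero hh hx0 m
    have hm1 : x + m * h ≠ 0 := by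
      have := hRising_ne_zero hh hx0 (m + 1)
      rw [hRising_succ] at this
      exact right_ne_zero_of_mul this
    have hm2 : x + h * m ≠ 0 := by rwa [mul_comm]
    simp only [facTerm]
    rw [hRising_succ, e1, smul_sub, smul_smul, smul_smul, smul_smul, smul_smul, ← sub_smul,
      ← sub_smul, smul_smul, smul_smul, ← add_smul]
    congr 2
    · push_cast
      field_simp
      ring
    · field_simp
  · rfl

omit [NormedSpace ℂ F] [CompleteSpace F] in
theorem hasSum_antidiagonal {f : ℕ × ℕ → F} {g : ℕ → F} {v : F} (hf : Summable f)
    (hin : ∀ s, HasSum (fun j => f (s, j)) (g s)) (hg : HasSum g v) :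
    HasSum (fun m => ∑ p ∈ Finset.HasAntidiagonal.antidiagonal m, f p) v := by
  have htot : HasSum f v := by
    have h6 := hf.hasSum.prod_fiberwise hin
    rw [hg.unique h6]
    exact hf.hasSum
  have h7 := (Finset.HasAntidiagonal.sigmaAntidiagonalEquivProd (A := ℕ)).hasSum_iff.2 htot
  have h8 := h7.sigma (fun m => hasSum_fintype _)
  convert h8 using 1
  funext m
  exact (Finset.sum_coe_sort (Finset.HasAntidiagonal.antidiagonal m) f).symm

/-- In L(x) a_s x^{-[s]}, the operator L(x) is expanded at x + sh by s shifts of its coefficients,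
and the factorials combine by `hRising_add`. Rearranging the double series by total degree gives the
product. -/
theorem hasSum_mulCoeff {D mu : ℝ} {L : ℕ → E →L[ℂ] F} {a : ℕ → E} (hL : IsTyped h C lam L)
    (ha : IsTyped h D mu a) (hh : 0 ≤ h) (h1 : h ≤ 1) (hl : 1 ≤ lam) (hm : 0 ≤ mu) {x : ℂ}
    (hx : lam + 4 ≤ x.re) (hx' : mu < x.re) :
    HasSum (facTerm h (mulCoeff h L a) x) (facSum h L x (facSum h a x)) := by
  have hx0 : 0 < x.re := by linarith
  have hLs := fun s => hL.shiftCoeff_iterate hh s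
  have hxs : ∀ s : ℕ, lam + s * h < (x + s * h).re := fun s => by simp; linarith
  set f : ℕ × ℕ → F := fun p =>
    facTerm h ((shiftCoeff h)^[p.1] L) (x + p.1 * h) p.2 (facTerm h a x p.1) with hf
  have hin : ∀ s, HasSum (fun j => f (s, j)) (facSum h L x (facTerm h a x s)) := fun s => by
    have h2 := (hLs s).hasSum hh (by positivity) (hxs s)
    rw [facSum_shiftCoeff_iterate hL hh h1 hl hx] at h2
    have h3 := h2.mapL (ContinuousLinearMap.apply ℂ F (facTerm h a x s))
    simp only [ContinuousLinearMap.apply_apply] at h3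
    exact h3
  have hnin : ∀ s, Summable fun j => ‖facTerm h ((shiftCoeff h)^[s] L) (x + s * h) j‖ := fun s =>
    (hLs s).summable_norm hh (by positivity) (hxs s)
  -- The s-th shifted coefficients have type lam + sh and are summed at x + sh: the gap x.re - lam
  -- does not depend on s, so the inner sums are uniformly bounded.
  have hbd : ∀ s, ∑' j, ‖facTerm h ((shiftCoeff h)^[s] L) (x + s * h) j‖ ≤
      ‖L 0‖ + C / (x.re - lam) := fun s => by
    have h3 := (hLs s).tsum_norm_le hh (by positivity) (hxs s)
    have h4 : ∑' j, ‖facTerm h ((shiftCoeff h)^[s] L) (x + s * h) j‖ =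
        ‖facTerm h ((shiftCoeff h)^[s] L) (x + s * h) 0‖ +
          ∑' j, ‖facTerm h ((shiftCoeff h)^[s] L) (x + s * h) (j + 1)‖ :=
      (hnin s).tsum_eq_zero_add
    rw [facTerm_zero, shiftCoeff_iterate_zero] at h4
    rw [h4]
    have e : (x + s * h).re - (lam + s * h) = x.re - lam := by simp
    rw [e] at h3
    linarith
  have hfle : ∀ s j, ‖f (s, j)‖ ≤
      ‖facTerm h ((shiftCoeff h)^[s] L) (x + s * h) j‖ * ‖facTerm h a x s‖ :=
    fun s j => ContinuousLinearMap.le_opNorm _ _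
  have hnf : ∀ s, Summable fun j => ‖f (s, j)‖ := fun s =>
    Summable.of_nonneg_of_le (fun _ => norm_nonneg _) (hfle s) ((hnin s).mul_right _)
  have hsum : Summable f := by
    refine Summable.of_norm ?_
    rw [summable_prod_of_nonneg (fun _ => norm_nonneg _)]
    refine ⟨hnf, ?_⟩
    refine Summable.of_nonneg_of_le (fun s => tsum_nonneg fun _ => norm_nonneg _) (fun s => ?_)
      ((ha.summable_norm hh hm hx').mul_left (‖L 0‖ + C / (x.re - lam)))
    refine (Summable.tsum_le_tsum (hfle s) (hnf s) ((hnin s).mul_right _)).trans ?_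
    rw [tsum_mul_right]
    exact mul_le_mul_of_nonneg_right (hbd s) (norm_nonneg _)
  have h5 : HasSum (fun s => facSum h L x (facTerm h a x s)) (facSum h L x (facSum h a x)) :=
    (facSum h L x).hasSum (ha.hasSum hh hm hx')
  have h6 := hasSum_antidiagonal hsum hin h5
  have h7 : facTerm h (mulCoeff h L a) x =
      fun m => ∑ p ∈ Finset.HasAntidiagonal.antidiagonal m, f p := by
    funext m
    rw [facTerm, mulCoeff, Finset.smul_sum]
    refine Finset.sum_congr rfl fun p hp => ?_
    simp only [hf, facTerm, smul_apply, map_smul, smul_smul]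
    rw [← Finset.HasAntidiagonal.mem_antidiagonal.1 hp, hRising_add, mul_inv, mul_comm]
  rw [h7]
  exact h6

end Operations

end

noncomputable section

/-! ### Solutions of `δ_{-h} F = L F + N F(· - h)` in series of factorials -/

section FacSolution

variable {E : Type*} [NormedAddCommGroup E] [NormedSpace ℂ E]

/-- `F` is a solution of `δ_{-h} F = L F + N F(· - h)` in formal series of factorials. -/
def IsFacSolution (h : ℝ) (L N : ℕ → E →L[ℂ] E) (F : ℕ → E) : Prop :=
  ∀ m : ℕ, -(m : ℂ) • F m = mulCoeff h L F m + mulCoeff h N (shiftCoeff h F) m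

/-- The part of the coefficients of `L F + N F(· - h)` that only involves the previous coefficients
of `F`. -/
def lowerCoeff (h : ℝ) (L N : ℕ → E →L[ℂ] E) (F : ℕ → E) : ℕ → E
  | 0 => 0
  | m + 1 => N 0 (((m : ℂ) * h) • shiftCoeff h F m) +
      ∑ s ∈ Finset.range (m + 1), ((shiftCoeff h)^[s] L) (m + 1 - s) (F s) +
      ∑ s ∈ Finset.range (m + 1), ((shiftCoeff h)^[s] N) (m + 1 - s) (shiftCoeff h F s)

theorem mulCoeff_zero (h : ℝ) (L : ℕ → E →L[ℂ] E) (a : ℕ → E) :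
    mulCoeff h L a 0 = L 0 (a 0) := by
  simp [mulCoeff]

theorem mulCoeff_eq (h : ℝ) (L : ℕ → E →L[ℂ] E) (a : ℕ → E) (m : ℕ) :
    mulCoeff h L a m =
      ∑ s ∈ Finset.range m, ((shiftCoeff h)^[s] L) (m - s) (a s) + L 0 (a m) := by
  rw [mulCoeff, Finset.Nat.sum_antidiagonal_eq_sum_range_succ
    (fun s j => ((shiftCoeff h)^[s] L) j (a s)), Finset.sum_range_succ, Nat.sub_self,
    shiftCoeff_iterate_zero]

/-- The coefficient of index m + 1 of the shifted series is F (m + 1) plus m h times an earlier one.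
So `N 0` joins `L 0` in the leading operator and the correction goes into `lowerCoeff`. -/
theorem mulCoeff_add_mulCoeff (h : ℝ) (L N : ℕ → E →L[ℂ] E) (F : ℕ → E) (m : ℕ) :
    mulCoeff h L F m + mulCoeff h N (shiftCoeff h F) m =
      (L 0 + N 0) (F m) + lowerCoeff h L N F m := by
  rcases m with _ | m
  · simp [mulCoeff_zero, lowerCoeff, shiftCoeff_zero]
  · rw [mulCoeff_eq, mulCoeff_eq, lowerCoeff, shiftCoeff_succ, map_add, add_apply]
    abel

theorem isFacSolution_iff {h : ℝ} {L N : ℕ → E →L[ℂ] E} {F : ℕ → E} :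
    IsFacSolution h L N F ↔
      ∀ m : ℕ, (m : ℂ) • F m + (L 0 + N 0) (F m) = -lowerCoeff h L N F m := by
  refine forall_congr' fun m => ?_
  rw [mulCoeff_add_mulCoeff, neg_smul, neg_eq_iff_add_eq_zero, eq_neg_iff_add_eq_zero, add_assoc]

theorem shiftCoeff_congr (h : ℝ) {F G : ℕ → E} :
    ∀ m, (∀ k ≤ m, F k = G k) → shiftCoeff h F m = shiftCoeff h G m := by
  intro m
  induction m with
  | zero => intro hk; exact hk 0 le_rfl
  | succ m ih =>
    intro hk
    rw [shiftCoeff_succ, shiftCoeff_succ, hk _ le_rfl, ih fun k hkm => hk k (by omega)]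

theorem lowerCoeff_congr (h : ℝ) (L N : ℕ → E →L[ℂ] E) {F G : ℕ → E} (m : ℕ)
    (hk : ∀ k < m, F k = G k) : lowerCoeff h L N F m = lowerCoeff h L N G m := by
  rcases m with _ | m
  · rfl
  · have h1 : ∀ s < m + 1, shiftCoeff h F s = shiftCoeff h G s := fun s hs =>
      shiftCoeff_congr h s fun k hks => hk k (by omega)
    rw [lowerCoeff, lowerCoeff, h1 m (by omega)]
    congr 1
    · congr 1
      exact Finset.sum_congr rfl fun s hs => by rw [hk s (Finset.mem_range.1 hs)]
    · exact Finset.sum_congr rfl fun s hs => by rw [h1 s (Finset.mem_range.1 hs)]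

/-- Iterating Φ from any sequence, the n-th iterate already has its final values at all indices
below n; the diagonal of the iterates is the fixed point. -/
theorem exists_causal_fixedPoint {X : Type*} [Nonempty X] (Φ : (ℕ → X) → ℕ → X)
    (hΦ : ∀ F G m, (∀ k < m, F k = G k) → Φ F m = Φ G m) : ∃ F, ∀ m, F m = Φ F m := by
  obtain ⟨x⟩ := ‹Nonempty X›
  let G : ℕ → ℕ → X := fun n => Φ^[n] fun _ => x
  have hG : ∀ n, G (n + 1) = Φ (G n) := fun n => Function.iterate_succ_apply' Φ n _
  have key : ∀ k n n', k < n → k < n' → G n k = G n' k := by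
    intro k
    induction k using Nat.strong_induction_on with
    | _ k ih =>
      intro n n' hn hn'
      obtain ⟨n, rfl⟩ := Nat.exists_eq_succ_of_ne_zero (by omega : n ≠ 0)
      obtain ⟨n', rfl⟩ := Nat.exists_eq_succ_of_ne_zero (by omega : n' ≠ 0)
      rw [Nat.succ_eq_add_one, Nat.succ_eq_add_one, hG, hG]
      exact hΦ _ _ _ fun j hj => ih j hj _ _ (by omega) (by omega)
  refine ⟨fun m => G (m + 1) m, fun m => ?_⟩
  change G (m + 1) m = _
  rw [hG]
  exact hΦ _ _ _ fun k hk => key k _ _ hk (by omega)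

theorem exists_isFacSolution (h : ℝ) (L N : ℕ → E →L[ℂ] E) (f₀ : E) (hf₀ : (L 0 + N 0) f₀ = 0)
    (hs : ∀ m : ℕ, 1 ≤ m → ∀ w, ∃ v, (m : ℂ) • v + (L 0 + N 0) v = w) :
    ∃ F : ℕ → E, F 0 = f₀ ∧ IsFacSolution h L N F := by
  choose! V hV using hs
  obtain ⟨F, hF⟩ := exists_causal_fixedPoint
    (fun F m => if m = 0 then f₀ else V m (-lowerCoeff h L N F m))
    (fun F G m hk => by simp only [lowerCoeff_congr h L N m hk])
  refine ⟨F, by simpa using hF 0, isFacSolution_iff.2 fun m => ?_⟩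
  rcases m with _ | m
  · have h0 : F 0 = f₀ := by simpa using hF 0
    rw [h0, hf₀]
    simp [lowerCoeff]
  · have h1 := hF (m + 1)
    simp only [Nat.add_eq_zero_iff, one_ne_zero, and_false, if_false] at h1
    rw [h1]
    exact hV (m + 1) (by omega) _

theorem IsFacSolution.unique {h : ℝ} {L N : ℕ → E →L[ℂ] E} {F G : ℕ → E}
    (hF : IsFacSolution h L N F) (hG : IsFacSolution h L N G) (h0 : F 0 = G 0)
    (hi : ∀ m : ℕ, 1 ≤ m → ∀ v, (m : ℂ) • v + (L 0 + N 0) v = 0 → v = 0) : F = G := by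
  funext m
  induction m using Nat.strong_induction_on with
  | _ m ih =>
    rcases m with _ | m
    · exact h0
    · have h1 := isFacSolution_iff.1 hF (m + 1)
      rw [lowerCoeff_congr h L N (m + 1) ih, ← isFacSolution_iff.1 hG (m + 1)] at h1
      refine sub_eq_zero.1 (hi (m + 1) (by omega) _ ?_)
      rw [smul_sub, map_sub, ← sub_eq_zero.2 h1]
      abel

/-- The coefficients of the solutions have a type that only depends on those of the equation, and
on a lower bound for the operators `m + L₀ + N₀`. -/
theorem IsFacSolution.isTyped {h C lam B K mu M : ℝ} {L N : ℕ → E →L[ℂ] E} {F : ℕ → E}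
    (hF : IsFacSolution h L N F) (hL : IsTyped h C lam L) (hN : IsTyped h C lam N) (hh : 0 ≤ h)
    (h1 : h ≤ 1) (hl : 0 ≤ lam) (hB : ‖N 0‖ ≤ B) (hK0 : 0 ≤ K)
    (hK : ∀ m : ℕ, 1 ≤ m → ∀ v, m * ‖v‖ ≤ K * ‖(m : ℂ) • v + (L 0 + N 0) v‖)
    (hlm : lam ≤ mu) (hmu : 1 ≤ mu) (hmu' : 2 * K * (B + 2 * C) ≤ mu)
    (hM : 4 * K * C * ‖F 0‖ ≤ M) : IsTyped h M mu F := by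
  have hC := hL.nonneg
  have hB0 : 0 ≤ B := (norm_nonneg _).trans hB
  have hM0 : 0 ≤ M := le_trans (by positivity) hM
  have hmu0 : 0 < mu := by linarith
  intro m
  induction m using Nat.strong_induction_on with
  | _ m ih =>
    have hR : ∀ s, 0 ≤ hRising h mu s := fun s => hRising_nonneg hh hmu0.le s
    have hF1 : ∀ s < m, ‖F (s + 1)‖ ≤ M / mu * hRising h mu (s + 1) := fun s hs => by
      refine (ih s hs).trans ?_
      rw [hRising_succ, div_mul_eq_mul_div, le_div_iff₀ hmu0]
      have : (0 : ℝ) ≤ s * h := by positivity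
      have := mul_nonneg (mul_nonneg hM0 (hR s)) this
      linarith
    have hF2 : ∀ s < m, ‖shiftCoeff h F (s + 1)‖ ≤ M / mu * hRising h mu (s + 1) := fun s hs => by
      refine (norm_shiftCoeff_succ_le hh ih s hs).trans (le_of_eq ?_)
      rw [hRising_succ_left]
      field_simp
    -- A convolution bound: `hRising_add` recombines mu^{[s+1]} and (mu + (s+1)h)^{[m-s-1]} into
    -- mu^{[m]}, so the m terms of positive index share one majorant; the term of index 0 carries ‖F
    -- 0‖.
    have hprod : ∀ (P : ℕ → E →L[ℂ] E), IsTyped h C lam P → ∀ a : ℕ → E, a 0 = F 0 →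
        (∀ s < m, ‖a (s + 1)‖ ≤ M / mu * hRising h mu (s + 1)) →
        ‖∑ s ∈ Finset.range (m + 1), ((shiftCoeff h)^[s] P) (m + 1 - s) (a s)‖ ≤
          C * hRising h mu m * (m * (M / mu) + ‖F 0‖) := by
      intro P hP a ha0 ha
      have hPb : ∀ s ≤ m, ‖((shiftCoeff h)^[s] P) (m + 1 - s)‖ ≤
          C * hRising h (mu + s * h) (m - s) := fun s hs => by
        have h2 := hP.shiftCoeff_iterate hh s (m - s)
        rw [show m - s + 1 = m + 1 - s by omega] at h2
        refine h2.trans ?_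
        gcongr
        exact hRising_le_hRising hh (by positivity) (by linarith) _
      rw [Finset.sum_range_succ']
      refine (norm_add_le _ _).trans ?_
      rw [mul_add]
      refine add_le_add ?_ ?_
      · refine (norm_sum_le _ _).trans ?_
        have h3 : ∀ s ∈ Finset.range m,
            ‖((shiftCoeff h)^[s + 1] P) (m + 1 - (s + 1)) (a (s + 1))‖ ≤
              C * hRising h mu m * (M / mu) := fun s hs => by
          have hsm := Finset.mem_range.1 hs
          refine (ContinuousLinearMap.le_opNorm _ _).trans ?_
          have h4 : hRising h mu m =
              hRising h mu (s + 1) * hRising h (mu + (s + 1 : ℕ) * h) (m - (s + 1)) := by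
            rw [← hRising_add]
            congr 1
            omega
          rw [h4]
          calc _ ≤ C * hRising h (mu + (s + 1 : ℕ) * h) (m - (s + 1)) *
                (M / mu * hRising h mu (s + 1)) :=
              mul_le_mul (hPb (s + 1) hsm) (ha s hsm) (norm_nonneg _)
                (mul_nonneg hC (hRising_nonneg hh (by positivity) _))
            _ = _ := by ring
        refine (Finset.sum_le_sum h3).trans (le_of_eq ?_)
        rw [Finset.sum_const, Finset.card_range, nsmul_eq_mul]
        ring
      · refine (ContinuousLinearMap.le_opNorm _ _).trans ?_
        rw [ha0]
        refine mul_le_mul_of_nonneg_right ?_ (norm_nonneg _)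
        simpa using hPb 0 (Nat.zero_le m)
    have hN0 : ‖N 0 (((m : ℂ) * h) • shiftCoeff h F m)‖ ≤ B * hRising h mu m * (m * (M / mu)) := by
      rcases m with _ | m
      · simp
      · refine (ContinuousLinearMap.le_opNorm _ _).trans ?_
        rw [norm_smul, norm_natCast_mul_ofReal hh]
        have h5 := hF2 m (by omega)
        calc ‖N 0‖ * (((m + 1 : ℕ) : ℝ) * h * ‖shiftCoeff h F (m + 1)‖)
            ≤ B * (((m + 1 : ℕ) : ℝ) * 1 * (M / mu * hRising h mu (m + 1))) := by gcongr
          _ = _ := by ring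
    have hlow : ‖lowerCoeff h L N F (m + 1)‖ ≤
        hRising h mu m * ((B + 2 * C) * (m * (M / mu)) + 2 * C * ‖F 0‖) := by
      rw [lowerCoeff]
      refine (norm_add₃_le).trans ?_
      have h6 := hprod L hL F rfl hF1
      have h7 := hprod N hN (shiftCoeff h F) (shiftCoeff_zero h F) hF2
      calc _ ≤ B * hRising h mu m * (m * (M / mu)) + C * hRising h mu m * (m * (M / mu) + ‖F 0‖) +
            C * hRising h mu m * (m * (M / mu) + ‖F 0‖) := add_le_add (add_le_add hN0 h6) h7
        _ = _ := by ring
    have h8 := hK (m + 1) (by omega) (F (m + 1))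
    rw [isFacSolution_iff.1 hF (m + 1), norm_neg] at h8
    -- The factor m + 1 on the left, due to the lower bound for the leading operator, absorbs the m
    -- equal terms. The size of mu reduces their constant to M/2, and the choice of M leaves M/2 for
    -- the term with ‖F 0‖.
    have h9 : ((m + 1 : ℕ) : ℝ) * ‖F (m + 1)‖ ≤ ((m + 1 : ℕ) : ℝ) * (M * hRising h mu m) := by
      refine h8.trans ((mul_le_mul_of_nonneg_left hlow hK0).trans ?_)
      have hm0 : (0 : ℝ) ≤ m := Nat.cast_nonneg m
      have e1 : K * (B + 2 * C) * (M / mu) ≤ M / 2 := by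
        rw [mul_div_assoc', div_le_div_iff₀ hmu0 two_pos]
        have := mul_le_mul_of_nonneg_right hmu' hM0
        linarith
      have e2 : K * ((B + 2 * C) * (m * (M / mu)) + 2 * C * ‖F 0‖) ≤ (m + 1) * M := by
        have := mul_le_mul_of_nonneg_left e1 hm0
        have h10 : 0 ≤ (m : ℝ) * M := by positivity
        calc _ = m * (K * (B + 2 * C) * (M / mu)) + 4 * K * C * ‖F 0‖ / 2 := by ring
          _ ≤ m * (M / 2) + M / 2 := by gcongr
          _ ≤ _ := by linarith
      calc K * (hRising h mu m * ((B + 2 * C) * (m * (M / mu)) + 2 * C * ‖F 0‖))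
          = hRising h mu m * (K * ((B + 2 * C) * (m * (M / mu)) + 2 * C * ‖F 0‖)) := by ring
        _ ≤ hRising h mu m * ((m + 1) * M) := mul_le_mul_of_nonneg_left e2 (hR m)
        _ = _ := by push_cast; ring
    exact le_of_mul_le_mul_left h9 (by positivity)

end FacSolution

/-! ### Families of series of factorials, as `h → 0⁺` -/

section Families

variable {E : Type*} [NormedAddCommGroup E] [NormedSpace ℂ E]
  {F : Type*} [NormedAddCommGroup F] [NormedSpace ℂ F]

theorem tendsto_ofReal_zero : Tendsto (fun h : ℝ => (h : ℂ)) (𝓝[>] 0) (𝓝 0) := by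
  have : Tendsto (fun h : ℝ => (h : ℂ)) (𝓝 0) (𝓝 ((0 : ℝ) : ℂ)) :=
    Complex.continuous_ofReal.tendsto 0
  rw [Complex.ofReal_zero] at this
  exact this.mono_left nhdsWithin_le_nhds

theorem tendsto_shiftCoeff {a : ℝ → ℕ → E} {a₀ : ℕ → E} :
    ∀ m, (∀ k ≤ m, Tendsto (fun h => a h k) (𝓝[>] 0) (𝓝 (a₀ k))) →
      Tendsto (fun h => shiftCoeff h (a h) m) (𝓝[>] 0) (𝓝 (a₀ m)) := by
  intro m
  induction m with
  | zero => intro hk; exact hk 0 le_rfl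
  | succ m ih =>
    intro hk
    have h1 := (hk (m + 1) le_rfl).add
      ((tendsto_ofReal_zero.const_mul (m : ℂ)).smul (ih fun k hkm => hk k (by omega)))
    simpa [shiftCoeff_succ] using h1

theorem tendsto_shiftCoeff_iterate {a : ℝ → ℕ → E} {a₀ : ℕ → E}
    (ha : ∀ k, Tendsto (fun h => a h k) (𝓝[>] 0) (𝓝 (a₀ k))) (s : ℕ) :
    ∀ m, Tendsto (fun h => ((shiftCoeff h)^[s] (a h)) m) (𝓝[>] 0) (𝓝 (a₀ m)) := by
  induction s with
  | zero => exact ha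
  | succ s ih =>
    intro m
    simp only [Function.iterate_succ_apply']
    exact tendsto_shiftCoeff m fun k _ => ih k

/-- Only the existence of limits matters: these coefficients occur in `minusN` multiplied by h. -/
theorem tendsto_invCoeff {a : ℝ → ℕ → E} {a₀ : ℕ → E}
    (ha : ∀ k, Tendsto (fun h => a h k) (𝓝[>] 0) (𝓝 (a₀ k))) :
    ∀ m, ∃ v, Tendsto (fun h => invCoeff h (a h) m) (𝓝[>] 0) (𝓝 v) := by
  intro m
  induction m with
  | zero => exact ⟨0, tendsto_const_nhds⟩
  | succ m ih =>
    obtain ⟨v, hv⟩ := ih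
    exact ⟨_, (ha m).add ((tendsto_ofReal_zero.const_mul ((m - 1 : ℕ) : ℂ)).smul hv)⟩

theorem tendsto_clm_apply {ι : Type*} {l : Filter ι} {T : ι → E →L[ℂ] F} {v : ι → E}
    {T₀ : E →L[ℂ] F} {v₀ : E} (hT : Tendsto T l (𝓝 T₀)) (hv : Tendsto v l (𝓝 v₀)) :
    Tendsto (fun i => T i (v i)) l (𝓝 (T₀ v₀)) :=
  (isBoundedBilinearMap_apply.continuous.tendsto (T₀, v₀)).comp (hT.prodMk_nhds hv)

theorem tendsto_lowerCoeff {L N : ℝ → ℕ → E →L[ℂ] E} {L₀ N₀ : ℕ → E →L[ℂ] E} {a : ℝ → ℕ → E}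
    (hL : ∀ k, Tendsto (fun h => L h k) (𝓝[>] 0) (𝓝 (L₀ k)))
    (hN : ∀ k, Tendsto (fun h => N h k) (𝓝[>] 0) (𝓝 (N₀ k))) (m : ℕ)
    (ha : ∀ k < m, ∃ v, Tendsto (fun h => a h k) (𝓝[>] 0) (𝓝 v)) :
    ∃ v, Tendsto (fun h => lowerCoeff h (L h) (N h) (a h) m) (𝓝[>] 0) (𝓝 v) := by
  rcases m with _ | m
  · exact ⟨0, tendsto_const_nhds⟩
  · choose! a₀ ha₀ using ha
    have hT : ∀ s < m + 1, Tendsto (fun h => shiftCoeff h (a h) s) (𝓝[>] 0) (𝓝 (a₀ s)) :=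
      fun s hs => tendsto_shiftCoeff s fun k hk => ha₀ k (by omega)
    refine ⟨_, ((tendsto_clm_apply (hN 0) ((tendsto_ofReal_zero.const_mul (m : ℂ)).smul
      (hT m (by omega)))).add
      (tendsto_finsetSum _ fun s hs => tendsto_clm_apply (tendsto_shiftCoeff_iterate hL s _)
        (ha₀ s (Finset.mem_range.1 hs)))).add
      (tendsto_finsetSum _ fun s hs => tendsto_clm_apply (tendsto_shiftCoeff_iterate hN s _)
        (hT s (Finset.mem_range.1 hs)))⟩

/-- Uniform lower bounds for the operators `m + T`, for `m ≥ 1`. -/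
theorem exists_uniform_lower_bound [FiniteDimensional ℂ E] (T : E →L[ℂ] E)
    (hT : ∀ m : ℕ, 1 ≤ m → ∀ v, (m : ℂ) • v + T v = 0 → v = 0) :
    ∃ K : ℝ, 0 < K ∧ ∀ m : ℕ, 1 ≤ m → ∀ v, m * ‖v‖ ≤ K * ‖(m : ℂ) • v + T v‖ := by
  have h1 : ∀ m : ℕ, 1 ≤ m → ∃ k : ℝ, 0 < k ∧ ∀ v, m * ‖v‖ ≤ k * ‖(m : ℂ) • v + T v‖ := by
    intro m hm
    set P : E →ₗ[ℂ] E := (m : ℂ) • LinearMap.id + T.toLinearMap with hP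
    obtain ⟨k, hk, hk'⟩ := P.exists_antilipschitzWith (LinearMap.ker_eq_bot'.2 fun v hv => hT m hm v hv)
    refine ⟨m * k, by positivity, fun v => ?_⟩
    rw [mul_assoc]
    refine mul_le_mul_of_nonneg_left ?_ (Nat.cast_nonneg m)
    have h2 := hk'.le_mul_dist v 0
    rw [dist_zero_right, map_zero, dist_zero_right] at h2
    exact h2
  choose! k hk hk' using h1
  -- Beyond 2‖T‖ the scalar m dominates T and the constant 2 suffices; the finitely many other m
  -- have their own constants, by injectivity in finite dimension.
  set M := ⌈2 * ‖T‖⌉₊ with hM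
  refine ⟨2 + ∑ m ∈ Finset.Icc 1 M, k m, ?_, fun m hm v => ?_⟩
  · have : 0 ≤ ∑ m ∈ Finset.Icc 1 M, k m :=
      Finset.sum_nonneg fun m hm => (hk m (Finset.mem_Icc.1 hm).1).le
    linarith
  · by_cases hmM : m ≤ M
    · refine (hk' m hm v).trans (mul_le_mul_of_nonneg_right ?_ (norm_nonneg _))
      have := Finset.single_le_sum (f := k) (fun m hm => (hk m (Finset.mem_Icc.1 hm).1).le)
        (Finset.mem_Icc.2 ⟨hm, hmM⟩)
      linarith
    · have h2 : 2 * ‖T‖ ≤ m := (Nat.le_ceil _).trans (by exact_mod_cast (not_le.1 hmM).le)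
      have h3 : (m : ℝ) * ‖v‖ ≤ ‖(m : ℂ) • v + T v‖ + ‖T‖ * ‖v‖ := by
        calc (m : ℝ) * ‖v‖ = ‖(m : ℂ) • v‖ := by rw [norm_smul, Complex.norm_natCast]
          _ = ‖((m : ℂ) • v + T v) - T v‖ := by rw [add_sub_cancel_right]
          _ ≤ ‖(m : ℂ) • v + T v‖ + ‖T v‖ := norm_sub_le _ _
          _ ≤ _ := by gcongr; exact T.le_opNorm v
      have h4 : 2 * ‖T‖ * ‖v‖ ≤ m * ‖v‖ := mul_le_mul_of_nonneg_right h2 (norm_nonneg _)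
      have h5 : 0 ≤ (∑ m ∈ Finset.Icc 1 M, k m) * ‖(m : ℂ) • v + T v‖ :=
        mul_nonneg (Finset.sum_nonneg fun m hm => (hk m (Finset.mem_Icc.1 hm).1).le)
          (norm_nonneg _)
      rw [add_mul]
      linarith

/-- The perturbation costs K (2K)⁻¹ ‖v‖ = ‖v‖/2, at most half of the left-hand side because m ≥ 1.
-/
theorem uniform_lower_bound_perturbed {T S : E →L[ℂ] E} {K : ℝ} (hK : 0 < K)
    (hT : ∀ m : ℕ, 1 ≤ m → ∀ v, m * ‖v‖ ≤ K * ‖(m : ℂ) • v + T v‖)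
    (hS : ‖S - T‖ ≤ (2 * K)⁻¹) (m : ℕ) (hm : 1 ≤ m) (v : E) :
    m * ‖v‖ ≤ 2 * K * ‖(m : ℂ) • v + S v‖ := by
  have h1 : ‖(m : ℂ) • v + T v‖ ≤ ‖(m : ℂ) • v + S v‖ + (2 * K)⁻¹ * ‖v‖ := by
    calc _ = ‖((m : ℂ) • v + S v) - (S - T) v‖ := by
          rw [sub_apply]; congr 1; abel
      _ ≤ ‖(m : ℂ) • v + S v‖ + ‖(S - T) v‖ := norm_sub_le _ _
      _ ≤ _ := by gcongr; exact ContinuousLinearMap.le_of_opNorm_le _ hS v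
  have h2 := (hT m hm v).trans (mul_le_mul_of_nonneg_left h1 hK.le)
  have h3 : K * ((2 * K)⁻¹ * ‖v‖) = ‖v‖ / 2 := by field_simp
  have h4 : ‖v‖ ≤ m * ‖v‖ := le_mul_of_one_le_left (norm_nonneg _) (by exact_mod_cast hm)
  rw [mul_add, h3] at h2
  linarith

theorem surjective_of_lower_bound [FiniteDimensional ℂ E] {T : E →L[ℂ] E} {K : ℝ} {m : ℕ}
    (hm : 1 ≤ m) (hT : ∀ v, m * ‖v‖ ≤ K * ‖(m : ℂ) • v + T v‖) (w : E) :
    ∃ v, (m : ℂ) • v + T v = w := by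
  set P : E →ₗ[ℂ] E := (m : ℂ) • LinearMap.id + T.toLinearMap with hP
  have hi : Function.Injective P := by
    rw [← LinearMap.ker_eq_bot, LinearMap.ker_eq_bot']
    intro v hv
    have h1 := hT v
    rw [show (m : ℂ) • v + T v = 0 from hv, norm_zero, mul_zero] at h1
    have h2 : (0 : ℝ) < m := by exact_mod_cast hm
    have h3 := norm_nonneg v
    exact norm_eq_zero.1 (le_antisymm (nonpos_of_mul_nonpos_right h1 h2) h3)
  exact (LinearMap.injective_iff_surjective.1 hi) w

/-- The coefficients of the solutions in series of factorials converge as `h → 0⁺`. -/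
theorem IsFacSolution.tendsto_coeff [FiniteDimensional ℂ E] {L N : ℝ → ℕ → E →L[ℂ] E}
    {L₀ N₀ : ℕ → E →L[ℂ] E} {c : ℝ → ℕ → E} {f₀ : E} {K : ℝ}
    (hL : ∀ k, Tendsto (fun h => L h k) (𝓝[>] 0) (𝓝 (L₀ k)))
    (hN : ∀ k, Tendsto (fun h => N h k) (𝓝[>] 0) (𝓝 (N₀ k)))
    (hc : ∀ᶠ h in 𝓝[>] (0 : ℝ), c h 0 = f₀ ∧ IsFacSolution h (L h) (N h) (c h))
    (hK₀ : ∀ m : ℕ, 1 ≤ m → ∀ v, m * ‖v‖ ≤ K * ‖(m : ℂ) • v + (L₀ 0 + N₀ 0) v‖)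
    (hK : ∀ᶠ h in 𝓝[>] (0 : ℝ), ∀ m : ℕ, 1 ≤ m → ∀ v,
      m * ‖v‖ ≤ K * ‖(m : ℂ) • v + (L h 0 + N h 0) v‖) :
    ∃ c₀ : ℕ → E, c₀ 0 = f₀ ∧ ∀ m, Tendsto (fun h => c h m) (𝓝[>] 0) (𝓝 (c₀ m)) := by
  have h1 : ∀ m, ∃ v, Tendsto (fun h => c h m) (𝓝[>] 0) (𝓝 v) := by
    intro m
    induction m using Nat.strong_induction_on with
    | _ m ih =>
      rcases m with _ | m
      · exact ⟨f₀, tendsto_const_nhds.congr' (hc.mono fun h hh => hh.1.symm)⟩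
      · obtain ⟨w, hw⟩ := tendsto_lowerCoeff hL hN (m + 1) ih
        obtain ⟨v, hv⟩ := surjective_of_lower_bound (by omega) (hK₀ (m + 1) (by omega)) (-w)
        refine ⟨v, ?_⟩
        -- The lower bound applied to c h (m + 1) - v controls the distance to the expected limit v
        -- by the residual of v in the equation of step h, and this residual tends to zero.
        have h2 : Tendsto (fun h => K * ‖-lowerCoeff h (L h) (N h) (c h) (m + 1) -
            (((m + 1 : ℕ) : ℂ) • v + (L h 0 + N h 0) v)‖) (𝓝[>] 0) (𝓝 0) := by
          have h3 := ((hw.neg.sub ((tendsto_clm_apply ((hL 0).add (hN 0))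
            (tendsto_const_nhds (x := v))).const_add (((m + 1 : ℕ) : ℂ) • v))).norm).const_mul K
          rw [hv, sub_self, norm_zero, mul_zero] at h3
          exact h3
        rw [tendsto_iff_norm_sub_tendsto_zero]
        refine squeeze_zero' (Eventually.of_forall fun _ => norm_nonneg _) ?_ h2
        filter_upwards [hc, hK] with h hh hKh
        have h4 := hKh (m + 1) (by omega) (c h (m + 1) - v)
        have h5 := isFacSolution_iff.1 hh.2 (m + 1)
        rw [← h5]
        refine le_trans (le_mul_of_one_le_left (norm_nonneg _) (by simp)) (h4.trans (le_of_eq ?_))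
        rw [smul_sub, map_sub]
        congr 2
        abel
  choose c₀ hc₀ using h1
  refine ⟨c₀, ?_, hc₀⟩
  exact tendsto_nhds_unique (hc₀ 0) (tendsto_const_nhds.congr' (hc.mono fun h hh => hh.1.symm))

/-- Series of factorials of a common type converge to power series in `1 / x` as `h → 0⁺`. -/
theorem tendsto_facSum [CompleteSpace E] {c : ℝ → ℕ → E} {c₀ : ℕ → E} {C lam : ℝ} (hl : 1 ≤ lam)
    (hc : ∀ᶠ h in 𝓝[>] (0 : ℝ), IsTyped h C lam (c h))
    (hlim : ∀ m, Tendsto (fun h => c h m) (𝓝[>] 0) (𝓝 (c₀ m))) {x : ℂ} (hx : lam + 3 ≤ x.re) :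
    Summable (fun s => (x⁻¹) ^ s • c₀ s) ∧
      Tendsto (fun h => facSum h (c h) x) (𝓝[>] 0) (𝓝 (∑' s, (x⁻¹) ^ s • c₀ s)) := by
  have hx0 : 0 < x.re := by linarith
  have hne : x ≠ 0 := fun h => by simp [h] at hx0
  -- Division by zero makes the cubic part vanish at s = 0, where the indicator alone bounds the
  -- constant term.
  set b : ℕ → ℝ := fun s => (‖c₀ 0‖ + 1) * (if s = 0 then 1 else 0) +
    C * (lam + 2) ^ 3 / (s : ℝ) ^ 3 with hb
  have hbs : Summable b := by
    refine Summable.add ?_ ?_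
    · exact (summable_of_ne_finset_zero (s := {0}) (by intro s hs; simp at hs; simp [hs]))
    · have := (Real.summable_one_div_nat_pow (p := 3).2 (by norm_num)).mul_left (C * (lam + 2) ^ 3)
      simpa [div_eq_mul_inv] using this
  have h01 : ∀ᶠ h in 𝓝[>] (0 : ℝ), 0 < h ∧ h ≤ 1 := by
    filter_upwards [self_mem_nhdsWithin, nhdsWithin_le_nhds (Iic_mem_nhds one_pos)] with h h1 h2
    exact ⟨h1, h2⟩
  have hC : 0 ≤ C := by
    obtain ⟨h, hh⟩ := hc.exists
    exact hh.nonneg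
  have hterm : ∀ s, Tendsto (fun h => facTerm h (c h) x s) (𝓝[>] 0) (𝓝 ((x⁻¹) ^ s • c₀ s)) := by
    intro s
    refine Tendsto.smul ?_ (hlim s)
    rw [inv_pow]
    refine Tendsto.inv₀ ?_ (pow_ne_zero _ hne)
    have h1 : Tendsto (fun h : ℝ => ∏ k ∈ Finset.range s, (x + (k : ℂ) * h)) (𝓝[>] 0)
        (𝓝 (∏ k ∈ Finset.range s, (x + (k : ℂ) * 0))) :=
      tendsto_finsetProd _ fun k _ => (tendsto_ofReal_zero.const_mul _).const_add _
    simpa [hRising] using h1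
  have hbound : ∀ᶠ h in 𝓝[>] (0 : ℝ), ∀ s, ‖facTerm h (c h) x s‖ ≤ b s := by
    have h0 : ∀ᶠ h in 𝓝[>] (0 : ℝ), ‖c h 0‖ ≤ ‖c₀ 0‖ + 1 :=
      (hlim 0).norm.eventually (ge_mem_nhds (by linarith))
    filter_upwards [h01, hc, h0] with h hh hch h0 s
    rcases s with _ | s
    · rw [facTerm_zero]
      simpa [hb] using h0
    · refine (hch.norm_facTerm_le_cubic hh.1.le hh.2 hl hx s).trans (le_of_eq ?_)
      simp [hb, mul_div_assoc]
  refine ⟨?_, tendsto_tsum_of_dominated_convergence hbs hterm hbound⟩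
  exact Summable.of_norm_bounded hbs fun s =>
    le_of_tendsto (hterm s).norm (hbound.mono fun h hh => hh s)

theorem differentiableOn_facSum [CompleteSpace E] {c : ℕ → E} {h C lam : ℝ}
    (hc : IsTyped h C lam c) (hh : 0 ≤ h) (h1 : h ≤ 1) (hl : 1 ≤ lam) :
    DifferentiableOn ℂ (facSum h c) {x | lam + 3 < x.re} := by
  have hd : ∀ s, DifferentiableOn ℂ (fun x => facTerm h c x s) {x | lam + 3 < x.re} := by
    intro s
    refine DifferentiableOn.smul_const (DifferentiableOn.fun_inv ?_ ?_) _
    · unfold hRising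
      fun_prop
    · intro x hx
      exact hRising_ne_zero hh (by simp only [Set.mem_ofPred_eq] at hx; linarith) s
  refine Complex.differentiableOn_tsum_of_summable_norm (u := fun s => ‖c 0‖ * (if s = 0 then 1 else 0) +
    C * (lam + 2) ^ 3 / (s : ℝ) ^ 3) ?_ hd ?_ ?_
  · refine Summable.add ?_ ?_
    · exact (summable_of_ne_finset_zero (s := {0}) (by intro s hs; simp at hs; simp [hs]))
    · have := (Real.summable_one_div_nat_pow (p := 3).2 (by norm_num)).mul_left (C * (lam + 2) ^ 3)
      simpa [div_eq_mul_inv] using this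
  · exact isOpen_lt continuous_const Complex.continuous_re
  · intro s x hx
    rcases s with _ | s
    · rw [facTerm_zero]
      simp
    · refine (hc.norm_facTerm_le_cubic hh h1 hl (le_of_lt hx) s).trans (le_of_eq ?_)
      simp [mul_div_assoc]

end Families

end

noncomputable section

/-! ### From formal solutions to solutions -/

section Analytic

variable {E : Type*} [NormedAddCommGroup E] [NormedSpace ℂ E] [CompleteSpace E]

/-- The defect of the equation is itself a series of factorials, whose coefficients vanish exactly
for formal solutions. Together with `facTerm_coeff_unique` this gives both implications between
formal and actual solutions. -/
theorem hasSum_facEquation {h C lam M mu : ℝ} {L N : ℕ → E →L[ℂ] E} {c : ℕ → E}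
    (hL : IsTyped h C lam L) (hN : IsTyped h C lam N) (hc : IsTyped h M mu c) (hh : 0 < h)
    (h1 : h ≤ 1) (hl : 1 ≤ lam) (hm : 1 ≤ mu) {x : ℂ} (hx : lam + 4 ≤ x.re) (hx' : mu + 4 ≤ x.re) :
    HasSum (facTerm h (fun m => -(m : ℂ) • c m -
        (mulCoeff h L c m + mulCoeff h N (shiftCoeff h c) m)) x)
      (((x - h) / h) • (facSum h c x - facSum h c (x - h)) -
        (facSum h L x (facSum h c x) + facSum h N x (facSum h c (x - h)))) := by
  have e1 := hasSum_hDelta hc hh (by linarith) (x := x) (by linarith)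
  have e2 := hasSum_mulCoeff hL hc hh.le h1 hl (by linarith) hx (by linarith)
  have e3 := hasSum_mulCoeff hN (hc.shiftCoeff hh.le) hh.le h1 hl (by linarith) hx (by linarith)
  rw [facSum_shiftCoeff hc hh.le h1 hm hx'] at e3
  have e4 := e1.sub (e2.add e3)
  have e5 : facTerm h (fun m => -(m : ℂ) • c m -
        (mulCoeff h L c m + mulCoeff h N (shiftCoeff h c) m)) x =
      fun m => facTerm h (fun m => -(m : ℂ) • c m) x m -
        (facTerm h (mulCoeff h L c) x m + facTerm h (mulCoeff h N (shiftCoeff h c)) x m) := by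
    funext m
    simp only [facTerm, smul_sub, smul_add]
  rw [e5]
  exact e4

theorem IsFacSolution.hDelta_facSum {h C lam M mu : ℝ} {L N : ℕ → E →L[ℂ] E} {c : ℕ → E}
    (hF : IsFacSolution h L N c)
    (hL : IsTyped h C lam L) (hN : IsTyped h C lam N) (hc : IsTyped h M mu c) (hh : 0 < h)
    (h1 : h ≤ 1) (hl : 1 ≤ lam) (hm : 1 ≤ mu) {x : ℂ} (hx : lam + 4 ≤ x.re) (hx' : mu + 4 ≤ x.re) :
    ((x - h) / h) • (facSum h c x - facSum h c (x - h)) =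
        facSum h L x (facSum h c x) + facSum h N x (facSum h c (x - h)) := by
  have e := hasSum_facEquation hL hN hc hh h1 hl hm hx hx'
  have e0 : (fun m : ℕ => -(m : ℂ) • c m - (mulCoeff h L c m + mulCoeff h N (shiftCoeff h c) m)) =
      fun _ => (0 : E) := by
    funext m
    rw [hF m, sub_self]
  rw [e0] at e
  have e1 : facTerm h (fun _ => (0 : E)) x = fun _ => 0 := by
    funext m
    simp [facTerm]
  rw [e1] at e
  exact sub_eq_zero.1 (e.unique hasSum_zero)

theorem isFacSolution_of_hDelta_facSum {h C lam M mu : ℝ} {L N : ℕ → E →L[ℂ] E} {c : ℕ → E}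
    (hL : IsTyped h C lam L) (hN : IsTyped h C lam N) (hc : IsTyped h M mu c) (hh : 0 < h)
    (h1 : h ≤ 1) (hl : 1 ≤ lam) (hm : 1 ≤ mu)
    (heq : ∃ R : ℝ, ∀ x : ℂ, R < x.re → ((x - h) / h) • (facSum h c x - facSum h c (x - h)) =
        facSum h L x (facSum h c x) + facSum h N x (facSum h c (x - h))) :
    IsFacSolution h L N c := by
  obtain ⟨R, hR⟩ := heq
  intro m
  refine sub_eq_zero.1 (facTerm_coeff_unique hh.le m (fun m => -(m : ℂ) • c m -
    (mulCoeff h L c m + mulCoeff h N (shiftCoeff h c) m)) ⟨max R (max (lam + 4) (mu + 4)), ?_⟩)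
  intro x hx
  have h2 := max_lt_iff.1 hx
  have h3 := max_lt_iff.1 h2.2
  have e := hasSum_facEquation hL hN hc hh h1 hl hm h3.1.le h3.2.le
  rwa [hR x h2.1, sub_self] at e

omit [CompleteSpace E] in
/-- Existence, uniqueness and convergence, as `h → 0⁺`, of solutions in series of factorials. -/
theorem exists_facSolution_family [FiniteDimensional ℂ E] {L N : ℝ → ℕ → E →L[ℂ] E}
    {L₀ N₀ : ℕ → E →L[ℂ] E} {C lam : ℝ} {f₀ : E} (hl : 1 ≤ lam)
    (hL : ∀ᶠ h in 𝓝[>] (0 : ℝ), IsTyped h C lam (L h))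
    (hN : ∀ᶠ h in 𝓝[>] (0 : ℝ), IsTyped h C lam (N h))
    (hL₀ : ∀ k, Tendsto (fun h => L h k) (𝓝[>] 0) (𝓝 (L₀ k)))
    (hN₀ : ∀ k, Tendsto (fun h => N h k) (𝓝[>] 0) (𝓝 (N₀ k)))
    (hf₀ : ∀ᶠ h in 𝓝[>] (0 : ℝ), (L h 0 + N h 0) f₀ = 0)
    (hT : ∀ m : ℕ, 1 ≤ m → ∀ v, (m : ℂ) • v + (L₀ 0 + N₀ 0) v = 0 → v = 0) :
    ∃ (c : ℝ → ℕ → E) (c₀ : ℕ → E) (M mu : ℝ), lam ≤ mu ∧ c₀ 0 = f₀ ∧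
      (∀ m, Tendsto (fun h => c h m) (𝓝[>] 0) (𝓝 (c₀ m))) ∧
      ∀ᶠ h in 𝓝[>] (0 : ℝ), 0 < h ∧ h ≤ 1 ∧ c h 0 = f₀ ∧ IsFacSolution h (L h) (N h) (c h) ∧
        IsTyped h M mu (c h) ∧ ∀ c', c' 0 = f₀ → IsFacSolution h (L h) (N h) c' → c' = c h := by
  obtain ⟨K, hK, hKT⟩ := exists_uniform_lower_bound (L₀ 0 + N₀ 0) hT
  have hclose : ∀ᶠ h in 𝓝[>] (0 : ℝ), ‖(L h 0 + N h 0) - (L₀ 0 + N₀ 0)‖ ≤ (2 * K)⁻¹ := by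
    have h1 := tendsto_iff_norm_sub_tendsto_zero.1 ((hL₀ 0).add (hN₀ 0))
    exact h1.eventually (ge_mem_nhds (by positivity))
  have hKh : ∀ᶠ h in 𝓝[>] (0 : ℝ), ∀ m : ℕ, 1 ≤ m → ∀ v,
      m * ‖v‖ ≤ 2 * K * ‖(m : ℂ) • v + (L h 0 + N h 0) v‖ :=
    hclose.mono fun h hh => uniform_lower_bound_perturbed hK hKT hh
  have h01 : ∀ᶠ h in 𝓝[>] (0 : ℝ), 0 < h ∧ h ≤ 1 := by
    filter_upwards [self_mem_nhdsWithin, nhdsWithin_le_nhds (Iic_mem_nhds one_pos)] with h h1 h2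
    exact ⟨h1, h2⟩
  have hex : ∀ᶠ h in 𝓝[>] (0 : ℝ), ∃ c : ℕ → E, c 0 = f₀ ∧ IsFacSolution h (L h) (N h) c := by
    filter_upwards [hKh, hf₀] with h h1 h2
    exact exists_isFacSolution h (L h) (N h) f₀ h2
      fun m hm w => surjective_of_lower_bound hm (h1 m hm) w
  obtain ⟨c, hc⟩ := hex.choice
  obtain ⟨c₀, hc₀, hlim⟩ := IsFacSolution.tendsto_coeff (K := 2 * K) hL₀ hN₀ hc
    (fun m hm v => (hKT m hm v).trans (by
      have := norm_nonneg ((m : ℂ) • v + (L₀ 0 + N₀ 0) v)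
      have := mul_nonneg hK.le this
      linarith)) hKh
  have hB : ∀ᶠ h in 𝓝[>] (0 : ℝ), ‖N h 0‖ ≤ ‖N₀ 0‖ + 1 :=
    (hN₀ 0).norm.eventually (ge_mem_nhds (by linarith))
  -- For all small h the lower bound holds with 2K and `N h 0` is bounded by ‖N₀ 0‖ + 1; these are
  -- the constants fed to `IsFacSolution.isTyped`.
  refine ⟨c, c₀, 4 * (2 * K) * C * ‖f₀‖, max lam (2 * (2 * K) * (‖N₀ 0‖ + 1 + 2 * C)),
    le_max_left _ _, hc₀, hlim, ?_⟩
  filter_upwards [h01, hc, hKh, hB, hL, hN] with h h1 h2 h3 h4 h5 h6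
  refine ⟨h1.1, h1.2, h2.1, h2.2, ?_, fun c' hc' hs => ?_⟩
  · exact h2.2.isTyped h5 h6 h1.1.le h1.2 (by linarith) h4 (by positivity) h3 (le_max_left _ _)
      (hl.trans (le_max_left _ _)) (le_max_right _ _) (by rw [h2.1])
  · refine hs.unique h2.2 (by rw [hc', h2.1]) fun m hm v hv => ?_
    have h7 := h3 m hm v
    rw [hv, norm_zero, mul_zero] at h7
    have h8 : (0 : ℝ) < m := by exact_mod_cast hm
    exact norm_eq_zero.1 (le_antisymm (nonpos_of_mul_nonpos_right h7 h8) (norm_nonneg v))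

end Analytic

/-! ### The gauge equations at `+∞` and at `-∞` -/

section Gauge

variable {𝔸 : Type*} [NormedRing 𝔸] [NormedAlgebra ℂ 𝔸]

/-- `Y = F e_{a₀}` satisfies `Y(x - h) = (1 - h a(x) / (x - h)) Y(x)`. -/
def IsGaugePlus (h : ℝ) (a : ℕ → 𝔸) (F : ℂ → 𝔸) (x : ℂ) : Prop :=
  F (x - h) * (1 - ((h : ℂ) / (x - h)) • a 0) = (1 - ((h : ℂ) / (x - h)) • facSum h a x) * F x

/-- `Y = F e_{a₀}` satisfies `Y(x) = (1 + h a(x - h) / x) Y(x - h)`. -/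
def IsGaugeMinus (h : ℝ) (a : ℕ → 𝔸) (F : ℂ → 𝔸) (x : ℂ) : Prop :=
  F x = (1 + ((h : ℂ) / x) • facSum h a (x - h)) * F (x - h) * (1 - ((h : ℂ) / (x - h)) • a 0)

/-- Left multiplication. -/
def lmulL (a : 𝔸) : 𝔸 →L[ℂ] 𝔸 := ContinuousLinearMap.mul ℂ 𝔸 a

/-- Right multiplication. -/
def rmulL (a : 𝔸) : 𝔸 →L[ℂ] 𝔸 := (ContinuousLinearMap.mul ℂ 𝔸).flip a

@[simp] theorem lmulL_apply (a b : 𝔸) : lmulL a b = a * b := rfl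

@[simp] theorem rmulL_apply (a b : 𝔸) : rmulL a b = b * a := rfl

/-- A sequence concentrated at the index `0`. -/
def constCoeff {E : Type*} [Zero E] (v : E) : ℕ → E := fun s => if s = 0 then v else 0

theorem isTyped_constCoeff {E : Type*} [NormedAddCommGroup E] {h C lam : ℝ} (hh : 0 ≤ h)
    (hC : 0 ≤ C) (hl : 0 ≤ lam) (v : E) : IsTyped h C lam (constCoeff v) := fun s => by
  simpa [constCoeff] using mul_nonneg hC (hRising_nonneg hh hl s)

theorem facSum_constCoeff {E : Type*} [NormedAddCommGroup E] [NormedSpace ℂ E] (h : ℝ) (v : E)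
    (x : ℂ) : facSum h (constCoeff v) x = v := by
  rw [facSum, tsum_eq_single 0]
  · simp [facTerm_zero, constCoeff]
  · intro s hs
    simp [facTerm, constCoeff, hs]

theorem norm_lmulL_le (a : 𝔸) : ‖lmulL a‖ ≤ ‖a‖ := ContinuousLinearMap.opNorm_mul_apply_le ℂ 𝔸 a

theorem norm_rmulL_le (a : 𝔸) : ‖rmulL a‖ ≤ ‖a‖ :=
  ContinuousLinearMap.opNorm_le_bound _ (norm_nonneg _) fun b => by
    rw [rmulL_apply, mul_comm ‖a‖]
    exact norm_mul_le _ _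

theorem IsTyped.lmul {h C lam : ℝ} {a : ℕ → 𝔸} (ha : IsTyped h C lam a) :
    IsTyped h C lam (fun s => lmulL (a s)) := fun s => (norm_lmulL_le _).trans (ha s)

theorem facSum_lmulL [CompleteSpace 𝔸] {h C lam : ℝ} {a : ℕ → 𝔸} (ha : IsTyped h C lam a)
    (hh : 0 ≤ h) (hl : 0 ≤ lam) {x : ℂ} (hx : lam < x.re) :
    facSum h (fun s => lmulL (a s)) x = lmulL (facSum h a x) := by
  have h1 := (ha.hasSum hh hl hx).mapL (ContinuousLinearMap.mul ℂ 𝔸)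
  have h2 : facTerm h (fun s => lmulL (a s)) x =
      fun s => ContinuousLinearMap.mul ℂ 𝔸 (facTerm h a x s) := by
    funext s
    simp [facTerm, lmulL]
  rw [facSum, h2]
  exact h1.tsum_eq

/-- The coefficients of the gauge equation at `+∞`. -/
def plusN (a : ℕ → 𝔸) : ℕ → 𝔸 →L[ℂ] 𝔸 := constCoeff (-rmulL (a 0))

/-- The coefficients of the gauge equation at `-∞`. -/
def minusN (h : ℝ) (a : ℕ → 𝔸) (s : ℕ) : 𝔸 →L[ℂ] 𝔸 :=
  lmulL (shiftCoeff h a s) - (h : ℂ) • lmulL (invCoeff h (shiftCoeff h a) s) -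
    (h : ℂ) • (lmulL (invCoeff h (shiftCoeff h a) s)).comp (rmulL (a 0)) -
    constCoeff (rmulL (a 0)) s

/-- Division by h/(x - h) gives δ_{-h} F = a F - F(x - h) a_0: left multiplication acts on F(x),
right multiplication on F(x - h). -/
theorem isGaugePlus_iff [CompleteSpace 𝔸] {h C lam : ℝ} {a : ℕ → 𝔸} (ha : IsTyped h C lam a)
    (hh : 0 < h) (hl : 0 ≤ lam) {x : ℂ} (hx : lam + h < x.re) (F : ℂ → 𝔸) :
    IsGaugePlus h a F x ↔ ((x - h) / h) • (F x - F (x - h)) =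
      facSum h (fun s => lmulL (a s)) x (F x) + facSum h (plusN a) x (F (x - h)) := by
  have hne : x - h ≠ 0 := fun h0 => by
    have : (x - h).re = 0 := by rw [h0]; rfl
    simp at this
    linarith
  have hhc : (h : ℂ) ≠ 0 := by exact_mod_cast hh.ne'
  have e1 : (x - h) / h = ((h : ℂ) / (x - h))⁻¹ := (inv_div _ _).symm
  have ht : (h : ℂ) / (x - h) ≠ 0 := div_ne_zero hhc hne
  rw [facSum_lmulL ha hh.le hl (by linarith), plusN, facSum_constCoeff, e1,
    inv_smul_eq_iff₀ ht, IsGaugePlus, ← sub_eq_zero, ← sub_eq_zero (a := F x - F (x - h)),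
    ← neg_eq_zero]
  refine Eq.congr ?_ rfl
  simp only [mul_sub, sub_mul, mul_one, one_mul, smul_mul_assoc, mul_smul_comm, lmulL_apply,
    rmulL_apply, smul_add, neg_sub, neg_apply, smul_neg]
  abel

theorem hasSum_facTerm_minusN [CompleteSpace 𝔸] {h C lam : ℝ} {a : ℕ → 𝔸}
    (ha : IsTyped h C lam a) (hh : 0 < h) (h1 : h ≤ 1) (hl : 1 ≤ lam) {x : ℂ}
    (hx : lam + 4 ≤ x.re) (v : 𝔸) :
    facSum h (minusN h a) x v = (1 - (h : ℂ) / x) • (facSum h a (x - h) * v) -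
      ((h : ℂ) / x) • (facSum h a (x - h) * v * a 0) - v * a 0 := by
  have hb := ha.shiftCoeff hh.le
  have hg := hb.invCoeff hh.le (by linarith)
  have s1 := (hb.hasSum hh.le (by linarith) (x := x) (by linarith)).mapL
    (ContinuousLinearMap.mul ℂ 𝔸)
  have s2 := (hg.hasSum hh.le (by linarith) (x := x) (by linarith)).mapL
    (ContinuousLinearMap.mul ℂ 𝔸)
  have s3 := s2.mapL ((ContinuousLinearMap.compL ℂ 𝔸 𝔸 𝔸).flip (rmulL (a 0)))
  have s4 : HasSum (facTerm h (constCoeff (rmulL (a 0))) x) (rmulL (a 0)) := by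
    have := ((isTyped_constCoeff hh.le (C := 0) (lam := 0) le_rfl le_rfl (rmulL (a 0))).hasSum
      hh.le le_rfl (x := x) (by linarith))
    rwa [facSum_constCoeff] at this
  have s5 := ((s1.sub (s2.const_smul (h : ℂ))).sub (s3.const_smul (h : ℂ))).sub s4
  have e1 : facTerm h (minusN h a) x = fun s =>
      ContinuousLinearMap.mul ℂ 𝔸 (facTerm h (shiftCoeff h a) x s) -
      (h : ℂ) • ContinuousLinearMap.mul ℂ 𝔸 (facTerm h (invCoeff h (shiftCoeff h a)) x s) -
      (h : ℂ) • (ContinuousLinearMap.compL ℂ 𝔸 𝔸 𝔸).flip (rmulL (a 0))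
        (ContinuousLinearMap.mul ℂ 𝔸 (facTerm h (invCoeff h (shiftCoeff h a)) x s)) -
      facTerm h (constCoeff (rmulL (a 0))) x s := by
    funext s
    ext w
    simp only [facTerm, minusN, lmulL, smul_sub, map_smul, ContinuousLinearMap.flip_apply,
      ContinuousLinearMap.compL_apply, sub_apply, smul_apply, ContinuousLinearMap.comp_apply,
      smul_comm (h : ℂ)]
  rw [facSum, e1, s5.tsum_eq, facSum_invCoeff hb hh.le h1 (by linarith) (by linarith),
    facSum_shiftCoeff ha hh.le h1 hl hx]
  simp only [sub_apply, smul_apply, ContinuousLinearMap.mul_apply', ContinuousLinearMap.flip_apply,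
    ContinuousLinearMap.compL_apply, ContinuousLinearMap.comp_apply, rmulL_apply, map_smul,
    sub_smul, one_smul, div_eq_mul_inv, mul_smul, mul_assoc]

/-- The gauge relation is solved for F(x), so everything is expressed by G = F(x - h). Since (x -
h)/x = 1 - h/x, division by h/(x - h) yields (1 - h/x) a(x - h) G - (h/x) a(x - h) G a_0 - G a_0,
with no term in F(x). -/
theorem isGaugeMinus_iff [CompleteSpace 𝔸] {h C lam : ℝ} {a : ℕ → 𝔸} (ha : IsTyped h C lam a)
    (hh : 0 < h) (h1 : h ≤ 1) (hl : 1 ≤ lam) {x : ℂ} (hx : lam + 4 ≤ x.re) (F : ℂ → 𝔸) :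
    IsGaugeMinus h a F x ↔ ((x - h) / h) • (F x - F (x - h)) =
      facSum h (fun _ => (0 : 𝔸 →L[ℂ] 𝔸)) x (F x) + facSum h (minusN h a) x (F (x - h)) := by
  have hne : x - h ≠ 0 := fun h0 => by
    have : (x - h).re = 0 := by rw [h0]; rfl
    simp at this
    linarith
  have hx0 : x ≠ 0 := fun h0 => by
    rw [h0] at hx
    simp at hx
    linarith
  have hhc : (h : ℂ) ≠ 0 := by exact_mod_cast hh.ne'
  have e1 : (x - h) / h = ((h : ℂ) / (x - h))⁻¹ := (inv_div _ _).symm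
  have ht : (h : ℂ) / (x - h) ≠ 0 := div_ne_zero hhc hne
  have e0 : facSum h (fun _ => (0 : 𝔸 →L[ℂ] 𝔸)) x = 0 := by
    rw [facSum]
    simp [facTerm]
  have e2 : (h : ℂ) / (x - h) * (1 - (h : ℂ) / x) = (h : ℂ) / x := by field_simp
  rw [hasSum_facTerm_minusN ha hh h1 hl hx, e0, e1,
    inv_smul_eq_iff₀ ht, IsGaugeMinus, ← sub_eq_zero, ← sub_eq_zero (a := F x - F (x - h))]
  refine Eq.congr ?_ rfl
  simp only [mul_sub, add_mul, mul_one, one_mul, smul_mul_assoc, mul_smul_comm, zero_apply,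
    smul_add, smul_sub, zero_add, smul_smul, e2, mul_assoc]
  abel

theorem IsTyped.minusN {h C lam B : ℝ} {a : ℕ → 𝔸} (ha : IsTyped h C lam a) (hh : 0 ≤ h)
    (h1 : h ≤ 1) (hl : 1 ≤ lam) (hB : ‖a 0‖ ≤ B) :
    IsTyped h (C + max C B + max C B * B) (lam + 1) (minusN h a) := by
  have hC := ha.nonneg
  have hB0 := (norm_nonneg _).trans hB
  have hb := (ha.shiftCoeff hh).mono hh (by linarith) le_rfl (by linarith : lam + h ≤ lam + 1)
  have hg := (hb.invCoeff hh (by linarith)).mono hh (by linarith)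
    (max_le_max_left C hB) le_rfl
  intro s
  have h2 := hb s
  have h3 := hg s
  have hR := hRising_nonneg hh (by linarith : 0 ≤ lam + 1) s
  have hM : 0 ≤ max C B := hC.trans (le_max_left _ _)
  have e1 : _root_.minusN h a (s + 1) = lmulL (_root_.shiftCoeff h a (s + 1)) -
    (h : ℂ) • lmulL (_root_.invCoeff h (_root_.shiftCoeff h a) (s + 1)) -
    (h : ℂ) • (lmulL (_root_.invCoeff h (_root_.shiftCoeff h a) (s + 1))).comp
      (rmulL (a 0)) := by
    simp [_root_.minusN, constCoeff]
  have hhn : ‖(h : ℂ)‖ ≤ 1 := by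
    rw [Complex.norm_real, Real.norm_of_nonneg hh]
    exact h1
  have n1 : ‖lmulL (_root_.invCoeff h (_root_.shiftCoeff h a) (s + 1))‖ ≤
      max C B * hRising h (lam + 1) s := (norm_lmulL_le _).trans h3
  rw [e1]
  refine (norm_sub_le _ _).trans ?_
  rw [add_mul, add_mul]
  refine add_le_add ((norm_sub_le _ _).trans (add_le_add ((norm_lmulL_le _).trans h2) ?_)) ?_
  · rw [norm_smul]
    exact (mul_le_of_le_one_left (norm_nonneg _) hhn).trans n1
  · rw [norm_smul]
    refine (mul_le_of_le_one_left (norm_nonneg _) hhn).trans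
      ((ContinuousLinearMap.opNorm_comp_le _ _).trans ?_)
    calc _ ≤ (max C B * hRising h (lam + 1) s) * B :=
          mul_le_mul n1 ((norm_rmulL_le _).trans hB) (norm_nonneg _) (by positivity)
      _ = _ := by ring

theorem tendsto_lmulL {ι : Type*} {l : Filter ι} {f : ι → 𝔸} {v : 𝔸} (hf : Tendsto f l (𝓝 v)) :
    Tendsto (fun i => lmulL (f i)) l (𝓝 (lmulL v)) :=
  ((ContinuousLinearMap.mul ℂ 𝔸).continuous.tendsto v).comp hf

theorem tendsto_rmulL {ι : Type*} {l : Filter ι} {f : ι → 𝔸} {v : 𝔸} (hf : Tendsto f l (𝓝 v)) :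
    Tendsto (fun i => rmulL (f i)) l (𝓝 (rmulL v)) :=
  ((ContinuousLinearMap.mul ℂ 𝔸).flip.continuous.tendsto v).comp hf

/-- A gauge equation, at `+∞` or at `-∞`. -/
def IsGauge (plus : Bool) (h : ℝ) (a : ℕ → 𝔸) (F : ℂ → 𝔸) (x : ℂ) : Prop :=
  if plus then IsGaugePlus h a F x else IsGaugeMinus h a F x

/-- Existence, uniqueness and convergence, as `h → 0⁺`, of the gauge transformations in series of
factorials. -/
theorem exists_gauge_family [FiniteDimensional ℂ 𝔸] (plus : Bool) {a : ℝ → ℕ → 𝔸} {a₀ : ℕ → 𝔸}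
    {C lam : ℝ} (hl : 1 ≤ lam) (ha : ∀ᶠ h in 𝓝[>] (0 : ℝ), IsTyped h C lam (a h))
    (hlim : ∀ k, Tendsto (fun h => a h k) (𝓝[>] 0) (𝓝 (a₀ k)))
    (hnr : ∀ m : ℕ, 1 ≤ m → ∀ X : 𝔸, (m : ℂ) • X + (a₀ 0 * X - X * a₀ 0) = 0 → X = 0) :
    ∃ (c : ℝ → ℕ → 𝔸) (c₀ : ℕ → 𝔸) (M mu : ℝ), lam ≤ mu ∧ c₀ 0 = 1 ∧
      (∀ m, Tendsto (fun h => c h m) (𝓝[>] 0) (𝓝 (c₀ m))) ∧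
      ∀ᶠ h in 𝓝[>] (0 : ℝ), 0 < h ∧ h ≤ 1 ∧ c h 0 = 1 ∧ IsTyped h M mu (c h) ∧
        (∀ x : ℂ, mu + 4 ≤ x.re → IsGauge plus h (a h) (facSum h (c h)) x) ∧
        ∀ c' : ℕ → 𝔸, c' 0 = 1 → (∃ C' lam', 1 ≤ lam' ∧ IsTyped h C' lam' c') →
          (∃ R : ℝ, ∀ x : ℂ, R < x.re → IsGauge plus h (a h) (facSum h c') x) → c' = c h := by
  have : CompleteSpace 𝔸 := FiniteDimensional.complete ℂ 𝔸
  have h01 : ∀ᶠ h in 𝓝[>] (0 : ℝ), 0 < h ∧ h ≤ 1 := by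
    filter_upwards [self_mem_nhdsWithin, nhdsWithin_le_nhds (Iic_mem_nhds one_pos)] with h h1 h2
    exact ⟨h1, h2⟩
  have hC : 0 ≤ C := by
    obtain ⟨h, hh⟩ := ha.exists
    exact hh.nonneg
  cases plus with
  | true =>
    have hLt : ∀ᶠ h in 𝓝[>] (0 : ℝ), IsTyped h C lam (fun s => lmulL (a h s)) :=
      ha.mono fun h hh => hh.lmul
    have hNt : ∀ᶠ h in 𝓝[>] (0 : ℝ), IsTyped h C lam (plusN (a h)) :=
      h01.mono fun h hh => isTyped_constCoeff hh.1.le hC (by linarith) _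
    obtain ⟨c, c₀, M, mu, hlm, hc₀, hcl, hev⟩ := exists_facSolution_family (f₀ := (1 : 𝔸))
      (L₀ := fun s => lmulL (a₀ s)) (N₀ := plusN a₀) hl hLt hNt
      (fun k => tendsto_lmulL (hlim k)) (fun k => by
        rcases k with _ | k
        · simpa [plusN, constCoeff] using (tendsto_rmulL (hlim 0)).neg
        · simp [plusN, constCoeff])
      (Eventually.of_forall fun h => by simp [plusN, constCoeff])
      (fun m hm v hv => hnr m hm v (by
        rw [← hv]; simp [plusN, constCoeff, sub_eq_add_neg]))
    refine ⟨c, c₀, M, mu, hlm, hc₀, hcl, ?_⟩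
    filter_upwards [hev, ha, hLt, hNt] with h ⟨h1, h2, h3, h4, h5, h6⟩ h7 h8 h9
    refine ⟨h1, h2, h3, h5, fun x hx => ?_, fun c' hc' ⟨C', lam', hl', ht⟩ ⟨R, hR⟩ => h6 c' hc' ?_⟩
    · exact (isGaugePlus_iff h7 h1 (by linarith) (by linarith) _).2
        (h4.hDelta_facSum h8 h9 h5 h1 h2 hl (by linarith) (by linarith) hx)
    · refine isFacSolution_of_hDelta_facSum h8 h9 ht h1 h2 hl hl'
        ⟨max R (lam + 1), fun x hx => ?_⟩
      have h10 := max_lt_iff.1 hx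
      exact (isGaugePlus_iff h7 h1 (by linarith) (by linarith) _).1 (hR x h10.1)
  | false =>
    have hB : ∀ᶠ h in 𝓝[>] (0 : ℝ), ‖a h 0‖ ≤ ‖a₀ 0‖ + 1 :=
      (hlim 0).norm.eventually (ge_mem_nhds (by linarith))
    set B := ‖a₀ 0‖ + 1
    have hNt : ∀ᶠ h in 𝓝[>] (0 : ℝ),
        IsTyped h (C + max C B + max C B * B) (lam + 1) (minusN h (a h)) := by
      filter_upwards [h01, ha, hB] with h h1 h2 h3
      exact h2.minusN h1.1.le h1.2 hl h3
    have hLt : ∀ᶠ h in 𝓝[>] (0 : ℝ), IsTyped h (C + max C B + max C B * B) (lam + 1)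
        (fun _ => (0 : 𝔸 →L[ℂ] 𝔸)) := by
      filter_upwards [h01, hNt] with h h1 h2 s
      rw [norm_zero]
      exact mul_nonneg h2.nonneg (hRising_nonneg h1.1.le (by linarith) s)
    choose g hg using tendsto_invCoeff (a := fun h => shiftCoeff h (a h))
      (fun k => tendsto_shiftCoeff k fun j _ => hlim j)
    -- The parts coming from 1/x carry a factor h and disappear, so the limiting leading operator is
    -- the commutator with `a₀ 0`, as at +∞.
    have hNlim : ∀ k, Tendsto (fun h => minusN h (a h) k) (𝓝[>] 0)
        (𝓝 (lmulL (a₀ k) - constCoeff (rmulL (a₀ 0)) k)) := by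
      intro k
      have e1 := tendsto_lmulL (tendsto_shiftCoeff k fun j _ => hlim j)
      have e2 := tendsto_lmulL (hg k)
      have e3 := tendsto_rmulL (hlim 0)
      have e4 : Tendsto (fun h => constCoeff (rmulL (a h 0)) k) (𝓝[>] 0)
          (𝓝 (constCoeff (rmulL (a₀ 0)) k)) := by
        rcases k with _ | k
        · simpa [constCoeff] using e3
        · simp [constCoeff]
      have e5 := ((ContinuousLinearMap.compL ℂ 𝔸 𝔸 𝔸).isBoundedBilinearMap.continuous.tendsto
        (lmulL (g k), rmulL (a₀ 0))).comp (e2.prodMk_nhds e3)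
      have e6 := ((e1.sub (tendsto_ofReal_zero.smul e2)).sub
        (tendsto_ofReal_zero.smul e5)).sub e4
      have e7 : lmulL (a₀ k) - constCoeff (rmulL (a₀ 0)) k = lmulL (a₀ k) -
          (0 : ℂ) • lmulL (g k) - (0 : ℂ) • (ContinuousLinearMap.compL ℂ 𝔸 𝔸 𝔸) (lmulL (g k))
            (rmulL (a₀ 0)) - constCoeff (rmulL (a₀ 0)) k := by
        ext v
        simp
      rw [e7]
      exact e6
    obtain ⟨c, c₀, M, mu, hlm, hc₀, hcl, hev⟩ := exists_facSolution_family (f₀ := (1 : 𝔸))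
      (L₀ := fun _ => 0) (by linarith) hLt hNt
      (fun k => tendsto_const_nhds) hNlim
      (Eventually.of_forall fun h => by
        simp [minusN, constCoeff, invCoeff, shiftCoeff_zero, lmulL])
      (fun m hm v hv => hnr m hm v (by
        rw [← hv]; simp [constCoeff]))
    refine ⟨c, c₀, M, mu, by linarith, hc₀, hcl, ?_⟩
    filter_upwards [hev, ha, hLt, hNt] with h ⟨h1, h2, h3, h4, h5, h6⟩ h7 h8 h9
    refine ⟨h1, h2, h3, h5, fun x hx => ?_, fun c' hc' ⟨C', lam', hl', ht⟩ ⟨R, hR⟩ => h6 c' hc' ?_⟩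
    · exact (isGaugeMinus_iff h7 h1 h2 hl (by linarith) _).2
        (h4.hDelta_facSum h8 h9 h5 h1 h2 (by linarith) (by linarith) (by linarith) hx)
    · refine isFacSolution_of_hDelta_facSum h8 h9 ht h1 h2 (by linarith) hl'
        ⟨max R (lam + 4), fun x hx => ?_⟩
      have h10 := max_lt_iff.1 hx
      exact (isGaugeMinus_iff h7 h1 h2 hl h10.2.le _).1 (hR x h10.1)

end Gauge

end

noncomputable section

/-! ### Asymptotics of the characters -/

section Gamma

/-- `Γ(z) / Γ(z - c)`, divided by `z ^ c`. -/
def gammaRatio (c z : ℂ) : ℂ :=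
  Complex.Gamma z / Complex.Gamma (z - c) * Complex.exp (-(c * Complex.log z))

theorem Gamma_add_natCast {z : ℂ} (hz : 0 < z.re) (n : ℕ) :
    Complex.Gamma (z + n) = Complex.Gamma z * ∏ j ∈ Finset.range n, (z + j) := by
  induction n with
  | zero => simp
  | succ n ih =>
    have h1 : z + n ≠ 0 := fun h => by
      have h2 : (z + n).re = 0 := by rw [h]; rfl
      simp at h2
      have : (0 : ℝ) ≤ n := Nat.cast_nonneg n
      linarith
    rw [Finset.prod_range_succ, ← mul_assoc, ← ih, Nat.cast_succ, ← add_assoc,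
      Complex.Gamma_add_one _ h1, mul_comm]

/-- Introduces Euler's products, whose limits are known; in the quotient of the cases z and z - c,
only n^c survives from the last factor. -/
theorem Gamma_add_succ_eq_div_GammaSeq {z : ℂ} (hz : 0 < z.re) {n : ℕ} (hn : n ≠ 0) :
    Complex.Gamma (z + (n + 1 : ℕ)) =
      Complex.Gamma z / Complex.GammaSeq z n * ((n : ℂ) ^ z * n.factorial) := by
  have h1 : (n : ℂ) ^ z ≠ 0 := by
    rw [Complex.cpow_ne_zero_iff]
    left
    exact_mod_cast hn
  have h2 : (n.factorial : ℂ) ≠ 0 := by exact_mod_cast n.factorial_ne_zero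
  have h3 : ∏ j ∈ Finset.range (n + 1), (z + j) ≠ 0 := by
    refine Finset.prod_ne_zero_iff.2 fun j _ h => ?_
    have h2 : (z + j).re = 0 := by rw [h]; rfl
    simp at h2
    have : (0 : ℝ) ≤ j := Nat.cast_nonneg j
    linarith
  rw [Gamma_add_natCast hz, Complex.GammaSeq]
  field_simp

theorem tendsto_log_add_sub_log (z : ℂ) :
    Tendsto (fun n : ℕ => Complex.log (n : ℂ) - Complex.log (z + (n + 1 : ℕ))) atTop (𝓝 0) := by
  have h1 : Tendsto (fun n : ℕ => 1 + (z + 1) / (n : ℂ)) atTop (𝓝 1) := by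
    have := (tendsto_const_div_atTop_nhds_zero_nat (𝕜 := ℂ) (z + 1)).const_add 1
    simpa using this
  have h2 : Tendsto (fun n : ℕ => -Complex.log (1 + (z + 1) / (n : ℂ))) atTop (𝓝 0) := by
    have := (continuousAt_clog (x := 1) (by simp)).tendsto.comp h1
    rw [Complex.log_one] at this
    simpa using this.neg
  refine h2.congr' ?_
  filter_upwards [eventually_gt_atTop 0, h1.eventually_ne one_ne_zero] with n hn hne
  have hn' : (n : ℂ) ≠ 0 := by exact_mod_cast hn.ne'
  have e1 : z + (n + 1 : ℕ) = ((n : ℝ) : ℂ) * (1 + (z + 1) / (n : ℂ)) := by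
    push_cast
    field_simp
    ring
  rw [e1, Complex.log_ofReal_mul (by exact_mod_cast hn) hne, ← Complex.natCast_log]
  push_cast
  ring

/-- Euler's limit formula. It gives the limit along z + ℕ only, without a rate; it serves as the
value at the far end of the telescoping in `norm_gammaRatio_sub_one_le`. -/
theorem tendsto_gammaRatio_add {c z : ℂ} (hz : 0 < z.re) (hzc : 0 < (z - c).re) :
    Tendsto (fun n : ℕ => gammaRatio c (z + (n + 1 : ℕ))) atTop (𝓝 1) := by
  have h1 := Complex.GammaSeq_tendsto_Gamma z
  have h2 := Complex.GammaSeq_tendsto_Gamma (z - c)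
  have n1 := Complex.Gamma_ne_zero_of_re_pos hz
  have n2 := Complex.Gamma_ne_zero_of_re_pos hzc
  have h3 := ((tendsto_const_nhds (x := Complex.Gamma z)).div h1 n1).div
    ((tendsto_const_nhds (x := Complex.Gamma (z - c))).div h2 n2)
    (by rw [div_self n2]; exact one_ne_zero)
  have h4 := (Complex.continuous_exp.tendsto _).comp ((tendsto_log_add_sub_log z).const_mul c)
  have h5 := h3.mul h4
  rw [div_self n1, div_self n2, mul_zero, Complex.exp_zero, mul_one, div_one] at h5
  refine h5.congr' ?_
  filter_upwards [eventually_gt_atTop 0] with n hn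
  have hn' : (n : ℂ) ≠ 0 := by exact_mod_cast hn.ne'
  have h6 : (n.factorial : ℂ) ≠ 0 := by exact_mod_cast n.factorial_ne_zero
  have e1 : z + (n + 1 : ℕ) - c = (z - c) + (n + 1 : ℕ) := by ring
  rw [gammaRatio, e1, Gamma_add_succ_eq_div_GammaSeq hz hn.ne',
    Gamma_add_succ_eq_div_GammaSeq hzc hn.ne']
  simp only [Function.comp_apply]
  rw [mul_sub, Complex.exp_sub, Complex.exp_neg, Complex.cpow_sub _ _ hn', mul_comm c (Complex.log n),
    ← Complex.cpow_def_of_ne_zero hn']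
  have h7 : (n : ℂ) ^ z ≠ 0 := by
    rw [Complex.cpow_ne_zero_iff]
    exact Or.inl hn'
  have h8 : (n : ℂ) ^ c ≠ 0 := by
    rw [Complex.cpow_ne_zero_iff]
    exact Or.inl hn'
  simp only [Pi.div_apply]
  field_simp

/-- The logarithm of the quotient `gammaRatio c w / gammaRatio c (w + 1)`. -/
def gammaDefect (c w : ℂ) : ℂ := Complex.log (1 + -c / w) + c * Complex.log (1 + 1 / w)

/-- Both w and 1 + 1/w have positive real part, so their arguments add up inside ]-π, π[. -/
theorem log_add_one_sub_log {w : ℂ} (hw : 0 < w.re) :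
    Complex.log (1 + 1 / w) = Complex.log (w + 1) - Complex.log w := by
  have hw0 : w ≠ 0 := fun h => by simp [h] at hw
  have e : w + 1 = w * (1 + 1 / w) := by field_simp
  have h1 : 0 < (1 + 1 / w).re := by
    rw [one_div, Complex.add_re, Complex.one_re, Complex.inv_re]
    have := div_pos hw (Complex.normSq_pos.2 hw0)
    linarith
  have h2 : (1 + 1 / w) ≠ 0 := fun h => by
    rw [h] at h1
    exact lt_irrefl _ h1
  have a1 := abs_lt.1 (Complex.abs_arg_lt_pi_div_two_iff.2 (Or.inl hw))
  have a2 := abs_lt.1 (Complex.abs_arg_lt_pi_div_two_iff.2 (Or.inl h1))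
  rw [e, Complex.log_mul hw0 h2 ⟨by linarith, by linarith⟩]
  ring

theorem gammaRatio_eq_exp_mul {c w : ℂ} (hw : 0 < w.re) (hwc : 0 < (w - c).re) :
    gammaRatio c w = Complex.exp (gammaDefect c w) * gammaRatio c (w + 1) := by
  have hw0 : w ≠ 0 := fun h => by simp [h] at hw
  have hwc0 : w - c ≠ 0 := fun h => by simp [h] at hwc
  have h1 : (1 + -c / w) ≠ 0 := by
    have : 1 + -c / w = (w - c) / w := by field_simp; ring
    rw [this]
    exact div_ne_zero hwc0 hw0
  rw [gammaDefect, Complex.exp_add, Complex.exp_log h1, log_add_one_sub_log hw, gammaRatio,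
    gammaRatio, Complex.Gamma_add_one w hw0, show w + 1 - c = (w - c) + 1 by ring,
    Complex.Gamma_add_one _ hwc0, mul_sub, Complex.exp_sub, Complex.exp_neg, Complex.exp_neg]
  have n2 := Complex.Gamma_ne_zero_of_re_pos hwc
  have n3 := Complex.exp_ne_zero (c * Complex.log (w + 1))
  have n4 := Complex.exp_ne_zero (c * Complex.log w)
  field_simp
  ring

/-- The first-order terms -c/w and c · (1/w) cancel; each logarithm leaves a quadratic remainder. -/
theorem norm_gammaDefect_le {c w : ℂ} {ρ : ℝ} (hc : ‖c‖ ≤ ρ) (hw : 2 * ρ + 2 ≤ ‖w‖) :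
    ‖gammaDefect c w‖ ≤ (ρ ^ 2 + ρ) / ‖w‖ ^ 2 := by
  have hρ : 0 ≤ ρ := (norm_nonneg c).trans hc
  have hw0 : 0 < ‖w‖ := by linarith
  have key : ∀ u : ℂ, ‖u‖ ≤ 1 / 2 → ‖Complex.log (1 + u) - u‖ ≤ ‖u‖ ^ 2 := fun u hu => by
    refine (Complex.norm_log_one_add_sub_self_le (by linarith)).trans ?_
    have h1 : (1 - ‖u‖)⁻¹ ≤ 2 := by
      rw [inv_le_comm₀ (by linarith) two_pos]
      linarith
    have := mul_le_mul_of_nonneg_left h1 (sq_nonneg ‖u‖)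
    linarith
  have n1 : ‖-c / w‖ = ‖c‖ / ‖w‖ := by rw [norm_div, norm_neg]
  have n2 : ‖1 / w‖ = 1 / ‖w‖ := by rw [norm_div, norm_one]
  have k1 := key (-c / w) (by
    rw [n1, div_le_div_iff₀ hw0 two_pos]
    linarith)
  have k2 := key (1 / w) (by
    rw [n2, div_le_div_iff₀ hw0 two_pos]
    linarith)
  have e : gammaDefect c w = (Complex.log (1 + -c / w) - -c / w) +
      c * (Complex.log (1 + 1 / w) - 1 / w) := by
    rw [gammaDefect]
    ring
  rw [e]
  refine (norm_add_le _ _).trans ?_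
  rw [norm_mul, add_div]
  rw [n1, div_pow] at k1
  rw [n2, div_pow, one_pow] at k2
  refine add_le_add (k1.trans (by gcongr)) ?_
  calc ‖c‖ * ‖Complex.log (1 + 1 / w) - 1 / w‖ ≤ ρ * (1 / ‖w‖ ^ 2) := by gcongr
    _ = _ := by ring

/-- Comparison with the telescoping sum of 1/((a - 1 + k)(a + k)). -/
theorem sum_inv_sq_le {a : ℝ} (ha : 2 ≤ a) (N : ℕ) :
    ∑ k ∈ Finset.range N, 1 / (a + k) ^ 2 ≤ 2 / a := by
  have h : ∀ N : ℕ, ∑ k ∈ Finset.range N, 1 / (a + k) ^ 2 ≤ 1 / (a - 1) - 1 / (a - 1 + N) := by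
    intro N
    induction N with
    | zero => simp
    | succ N ih =>
      have hN : (0 : ℝ) ≤ N := Nat.cast_nonneg N
      rw [Finset.sum_range_succ]
      have h1 : 1 / (a + N) ^ 2 ≤ 1 / (a - 1 + N) - 1 / (a - 1 + (N + 1 : ℕ)) := by
        have p1 : 0 < a - 1 + N := by linarith
        have p2 : 0 < a + N := by linarith
        have e : 1 / (a - 1 + N) - 1 / (a - 1 + (N + 1 : ℕ)) = 1 / ((a - 1 + N) * (a + N)) := by
          push_cast
          rw [show a - 1 + ((N : ℝ) + 1) = a + N by ring]
          field_simp
          ring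
        rw [e]
        refine one_div_le_one_div_of_le (by positivity) ?_
        nlinarith
      linarith
  refine (h N).trans ?_
  have p1 : 0 < a - 1 := by linarith
  have p2 : 0 ≤ 1 / (a - 1 + N) := by positivity
  have p3 : 1 / (a - 1) ≤ 2 / a := by
    rw [div_le_div_iff₀ p1 (by linarith)]
    linarith
  linarith

/-- `Γ(z) / Γ(z - c) ∼ z ^ c` in right half-planes, uniformly for bounded `c`. -/
theorem norm_gammaRatio_sub_one_le {c z : ℂ} {ρ : ℝ} (hc : ‖c‖ ≤ ρ)
    (hz : 2 * ρ ^ 2 + 4 * ρ + 2 ≤ z.re) :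
    ‖gammaRatio c z - 1‖ ≤ 4 * (ρ ^ 2 + ρ) / z.re := by
  have hρ : 0 ≤ ρ := (norm_nonneg c).trans hc
  have hz0 : 0 < z.re := by nlinarith
  have hre : ∀ k : ℕ, z.re + k ≤ ‖z + k‖ := fun k => by
    refine le_trans (le_of_eq ?_) (Complex.re_le_norm _)
    simp
  have hcre : c.re ≤ ρ := (Complex.re_le_norm c).trans hc
  -- The ratio at z is the ratio at z + N times exp(S N). The sums S N are O(1/Re z) uniformly in N,
  -- and at the far end the ratio tends to 1.
  set S : ℕ → ℂ := fun N => ∑ k ∈ Finset.range N, gammaDefect c (z + k) with hS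
  have hSle : ∀ N, ‖S N‖ ≤ 2 * (ρ ^ 2 + ρ) / z.re := by
    intro N
    refine (norm_sum_le _ _).trans ?_
    have h1 : ∀ k ∈ Finset.range N, ‖gammaDefect c (z + k)‖ ≤
        (ρ ^ 2 + ρ) * (1 / (z.re + k) ^ 2) := fun k _ => by
      have hk : (0 : ℝ) ≤ k := Nat.cast_nonneg k
      refine (norm_gammaDefect_le hc (by nlinarith [hre k])).trans ?_
      rw [mul_one_div]
      have := hre k
      gcongr
    refine (Finset.sum_le_sum h1).trans ?_
    rw [← Finset.mul_sum]
    refine (mul_le_mul_of_nonneg_left (sum_inv_sq_le (by nlinarith) N) (by positivity)).trans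
      (le_of_eq (by ring))
  have hprod : ∀ N : ℕ, gammaRatio c z = Complex.exp (S N) * gammaRatio c (z + N) := by
    intro N
    induction N with
    | zero => simp [hS]
    | succ N ih =>
      have hN : (0 : ℝ) ≤ N := Nat.cast_nonneg N
      rw [ih, gammaRatio_eq_exp_mul (by simp; linarith) (by simp; nlinarith), ← mul_assoc,
        ← Complex.exp_add]
      simp only [hS]
      rw [Finset.sum_range_succ]
      push_cast
      rw [add_assoc z]
  have hlim := tendsto_gammaRatio_add hz0 (c := c) (by simp; nlinarith)
  have h1 : ∀ N : ℕ, ‖gammaRatio c z - gammaRatio c (z + (N + 1 : ℕ))‖ ≤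
      4 * (ρ ^ 2 + ρ) / z.re * ‖gammaRatio c (z + (N + 1 : ℕ))‖ := fun N => by
    have h2 := hSle (N + 1)
    have h3 : ‖S (N + 1)‖ ≤ 1 := h2.trans (by rw [div_le_one hz0]; nlinarith)
    have h4 := Complex.norm_exp_sub_one_le h3
    rw [hprod (N + 1)]
    calc _ = ‖(Complex.exp (S (N + 1)) - 1) * gammaRatio c (z + (N + 1 : ℕ))‖ := by
          congr 1; ring
      _ = ‖Complex.exp (S (N + 1)) - 1‖ * ‖gammaRatio c (z + (N + 1 : ℕ))‖ := norm_mul _ _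
      _ ≤ _ := by
        gcongr
        refine h4.trans ((mul_le_mul_of_nonneg_left h2 two_pos.le).trans (le_of_eq (by ring)))
  have h2 := le_of_tendsto_of_tendsto (hlim.const_sub (gammaRatio c z)).norm
    (hlim.norm.const_mul (4 * (ρ ^ 2 + ρ) / z.re)) (Eventually.of_forall h1)
  simpa using h2

theorem hChar_eq_gammaRatio {h : ℝ} (hh : 0 < h) (c : ℂ) {x : ℂ} (hx : 0 < x.re) :
    hChar h c x = gammaRatio c (x / h) * Complex.exp (c * Complex.log x) := by
  have hhc : (h : ℂ) ≠ 0 := by exact_mod_cast hh.ne'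
  have hx0 : x ≠ 0 := fun h => by simp [h] at hx
  have h1 : x / h ≠ 0 := div_ne_zero hx0 hhc
  have e1 : Complex.log x = Real.log h + Complex.log (x / h) := by
    rw [← Complex.log_ofReal_mul hh h1, mul_div_cancel₀ _ hhc]
  rw [hChar, gammaRatio, e1, mul_add, Complex.exp_add, Complex.exp_neg,
    Complex.cpow_def_of_ne_zero hhc, Complex.ofReal_log hh.le, mul_comm (Complex.log h) c]
  have n4 := Complex.exp_ne_zero (c * Complex.log (x / h))
  field_simp

/-- The characters converge to the powers of `x`. -/
theorem norm_hChar_sub_le {h ρ : ℝ} (hh : 0 < h) {c x : ℂ} (hc : ‖c‖ ≤ ρ)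
    (hx : (2 * ρ ^ 2 + 4 * ρ + 2) * h ≤ x.re) :
    ‖hChar h c x - Complex.exp (c * Complex.log x)‖ ≤
      4 * (ρ ^ 2 + ρ) * h / x.re * Real.exp (ρ * ‖Complex.log x‖) := by
  have hρ : 0 ≤ ρ := (norm_nonneg c).trans hc
  have hx0 : 0 < x.re := lt_of_lt_of_le (by positivity) hx
  have hre : (x / h).re = x.re / h := Complex.div_ofReal_re x h
  have h1 := norm_gammaRatio_sub_one_le (z := x / h) hc (by rwa [hre, le_div_iff₀ hh])
  rw [hChar_eq_gammaRatio hh c hx0]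
  calc _ = ‖(gammaRatio c (x / h) - 1) * Complex.exp (c * Complex.log x)‖ := by congr 1; ring
    _ = ‖gammaRatio c (x / h) - 1‖ * ‖Complex.exp (c * Complex.log x)‖ := norm_mul _ _
    _ ≤ 4 * (ρ ^ 2 + ρ) / (x / h).re * Real.exp (ρ * ‖Complex.log x‖) := by
      have h2 : ‖Complex.exp (c * Complex.log x)‖ ≤ Real.exp (ρ * ‖Complex.log x‖) := by
        refine (Complex.norm_exp_le_exp_norm _).trans (Real.exp_le_exp.2 ?_)
        rw [norm_mul]
        gcongr
      exact mul_le_mul h1 h2 (norm_nonneg _) ((norm_nonneg _).trans h1)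
    _ = _ := by rw [hre]; field_simp

end Gamma

end

noncomputable section

/-! ### Entire functions of matrices -/

section Calculus

variable {𝔸 : Type*} [NormedRing 𝔸] [NormedAlgebra ℂ 𝔸]

theorem HasSum.of_eq {ι M : Type*} [AddCommMonoid M] [TopologicalSpace M] {f g : ι → M} {a : M}
    (h : HasSum f a) (e : ∀ k, g k = f k) : HasSum g a := by
  rw [funext e]
  exact h

/-- The value `f(A)` of an entire function. -/
def entireCalc (f : ℂ → ℂ) (A : 𝔸) : 𝔸 :=
  ∑' k : ℕ, ((k.factorial : ℂ)⁻¹ * iteratedDeriv k f 0) • A ^ k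

omit [NormedAlgebra ℂ 𝔸] in
theorem norm_pow_le_norm_one_mul (A : 𝔸) (k : ℕ) : ‖A ^ k‖ ≤ ‖(1 : 𝔸)‖ * ‖A‖ ^ k := by
  induction k with
  | zero => simp
  | succ k ih =>
    rw [pow_succ, pow_succ, ← mul_assoc]
    exact (norm_mul_le _ _).trans (mul_le_mul_of_nonneg_right ih (norm_nonneg _))

/-- Cauchy's estimates on the disc of radius ρ against powers of an element of norm at most ρ/2: the
ratio 1/2 gives geometric decay. -/
theorem norm_entireCalc_term_le {f : ℂ → ℂ} (hf : Differentiable ℂ f) {M ρ : ℝ} (hρ : 0 < ρ)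
    (hM : ∀ c : ℂ, ‖c‖ ≤ ρ → ‖f c‖ ≤ M) {A : 𝔸} (hA : ‖A‖ ≤ ρ / 2) (k : ℕ) :
    ‖((k.factorial : ℂ)⁻¹ * iteratedDeriv k f 0) • A ^ k‖ ≤
      M * ‖(1 : 𝔸)‖ * (1 / 2) ^ k := by
  have h1 := Complex.norm_iteratedDeriv_le_of_forall_mem_sphere_norm_le (F := ℂ) (f := f) (c := 0) k hρ
    hf.diffContOnCl (C := M) (fun z hz => hM z (by simpa using (mem_sphere_zero_iff_norm.1 hz).le))
  have hM0 : 0 ≤ M := (norm_nonneg _).trans (hM 0 (by simpa using hρ.le))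
  rw [norm_smul, norm_mul, norm_inv, Complex.norm_natCast]
  have hk : (0 : ℝ) < k.factorial := by exact_mod_cast k.factorial_pos
  calc _ ≤ (k.factorial : ℝ)⁻¹ * (k.factorial * M / ρ ^ k) * (‖(1 : 𝔸)‖ * (ρ / 2) ^ k) := by
        gcongr
        exact (norm_pow_le_norm_one_mul A k).trans (by gcongr)
    _ = _ := by
      rw [div_pow, div_pow, one_pow]
      field_simp

theorem hasSum_entireCalc [CompleteSpace 𝔸] {f : ℂ → ℂ} (hf : Differentiable ℂ f) (A : 𝔸) :
    HasSum (fun k : ℕ => ((k.factorial : ℂ)⁻¹ * iteratedDeriv k f 0) • A ^ k)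
      (entireCalc f A) := by
  have hρ : 0 < 2 * ‖A‖ + 1 := by positivity
  obtain ⟨M, hM⟩ := (isCompact_closedBall (0 : ℂ) (2 * ‖A‖ + 1)).exists_bound_of_continuousOn
    hf.continuous.continuousOn
  refine Summable.hasSum (Summable.of_norm_bounded
    ((summable_geometric_of_lt_one (by norm_num) (by norm_num : (1 / 2 : ℝ) < 1)).mul_left
      (M * ‖(1 : 𝔸)‖)) fun k => ?_)
  exact norm_entireCalc_term_le hf hρ (fun c hc => hM c (by simpa using hc))
    (by linarith [norm_nonneg A]) k

/-- Scalar estimates that are uniform on a disc of exponents pass to matrices, with no control of a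
Jordan reduction. -/
theorem norm_entireCalc_le [CompleteSpace 𝔸] {f : ℂ → ℂ} (hf : Differentiable ℂ f) {M ρ : ℝ}
    (hρ : 0 < ρ) (hM : ∀ c : ℂ, ‖c‖ ≤ ρ → ‖f c‖ ≤ M) {A : 𝔸} (hA : ‖A‖ ≤ ρ / 2) :
    ‖entireCalc f A‖ ≤ M * ‖(1 : 𝔸)‖ * 2 := by
  have h1 := (hasSum_geometric_of_lt_one (r := (1 / 2 : ℝ)) (by norm_num) (by norm_num)).mul_left
    (M * ‖(1 : 𝔸)‖)
  refine (tsum_of_norm_bounded h1 (norm_entireCalc_term_le hf hρ hM hA)).trans (le_of_eq ?_)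
  norm_num

theorem entireCalc_sub [CompleteSpace 𝔸] {f g : ℂ → ℂ} (hf : Differentiable ℂ f)
    (hg : Differentiable ℂ g) (A : 𝔸) :
    entireCalc (fun c => f c - g c) A = entireCalc f A - entireCalc g A := by
  refine HasSum.tsum_eq ?_
  refine HasSum.of_eq ((hasSum_entireCalc hf A).sub (hasSum_entireCalc hg A)) fun k => ?_
  rw [iteratedDeriv_fun_sub hf.contDiff.contDiffAt hg.contDiff.contDiffAt, mul_sub, sub_smul]

theorem iteratedDeriv_succ_id_mul {f : ℂ → ℂ} (hf : Differentiable ℂ f) (k : ℕ) :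
    iteratedDeriv (k + 1) (fun c => c * f c) 0 = (k + 1) * iteratedDeriv k f 0 := by
  have h1 : ∀ k : ℕ, iteratedDeriv (k + 1) (fun c => c * f c) =
      fun c => c * iteratedDeriv (k + 1) f c + (k + 1) * iteratedDeriv k f c := by
    intro k
    have hd : ∀ k : ℕ, Differentiable ℂ (iteratedDeriv k f) := fun k =>
      (hf.contDiff (n := ⊤)).differentiable_iteratedDeriv k (by exact_mod_cast WithTop.coe_lt_top _)
    induction k with
    | zero =>
      funext c
      rw [iteratedDeriv_one, deriv_fun_mul differentiableAt_fun_id (hf c), iteratedDeriv_one]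
      simp
      ring
    | succ k ih =>
      funext c
      rw [iteratedDeriv_succ, ih, deriv_fun_add, deriv_fun_mul differentiableAt_fun_id (hd _ c),
        deriv_const_mul _ (hd _ c), ← iteratedDeriv_succ, ← iteratedDeriv_succ]
      · simp
        ring
      · exact differentiableAt_id.mul (hd _ c)
      · exact (hd _ c).const_mul _
  rw [h1]
  simp

theorem entireCalc_id_mul [CompleteSpace 𝔸] {f : ℂ → ℂ} (hf : Differentiable ℂ f) (A : 𝔸) :
    entireCalc (fun c => c * f c) A = A * entireCalc f A := by
  have h1 := (hasSum_entireCalc hf A).mul_left A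
  refine HasSum.tsum_eq ((hasSum_nat_add_iff' 1).1 ?_)
  simp only [Finset.sum_range_one, iteratedDeriv_zero, zero_mul, mul_zero, zero_smul, sub_zero]
  refine HasSum.of_eq h1 fun k => ?_
  rw [iteratedDeriv_succ_id_mul hf, mul_smul_comm, pow_succ', Nat.factorial_succ]
  congr 1
  have : (k.factorial : ℂ) ≠ 0 := by exact_mod_cast k.factorial_ne_zero
  have : (k : ℂ) + 1 ≠ 0 := by exact_mod_cast k.succ_ne_zero
  push_cast
  field_simp

theorem entireCalc_const_mul [CompleteSpace 𝔸] {f : ℂ → ℂ} (hf : Differentiable ℂ f) (t : ℂ)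
    (A : 𝔸) : entireCalc (fun c => t * f c) A = t • entireCalc f A := by
  refine HasSum.tsum_eq ?_
  refine HasSum.of_eq ((hasSum_entireCalc hf A).const_smul t) fun k => ?_
  rw [iteratedDeriv_const_mul_field, smul_smul]
  congr 1
  ring

theorem entireCalc_exp (w : ℂ) (A : 𝔸) :
    entireCalc (fun c => Complex.exp (c * w)) A = NormedSpace.exp (w • A) := by
  rw [NormedSpace.exp_eq_tsum ℂ, entireCalc]
  refine tsum_congr fun k => ?_
  have h1 : (fun c => Complex.exp (c * w)) = fun c => Complex.exp (w * c) := by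
    funext c
    rw [mul_comm]
  rw [h1, iteratedDeriv_cexp_const_mul]
  simp [smul_pow, smul_smul]

end Calculus

/-! ### Entire functions of Jordan matrices -/

section Jordan

variable {n : ℕ}

/-- The places `(i, j)` of the upper triangles of the Jordan blocks. -/
def InJordanBlock (J : CMat n) (i j : Fin n) : Prop :=
  i ≤ j ∧ ∀ k l : Fin n, i ≤ k → l ≤ j → l.val = k.val + 1 → J k l = 1

theorem InJordanBlock.diag_eq {J : CMat n} (hJ : IsJordanMatrix J) {i : Fin n} :
    ∀ (d : ℕ) (j : Fin n), j.val = i.val + d → InJordanBlock J i j → J j j = J i i := by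
  intro d
  induction d with
  | zero =>
    intro j hj _
    rw [Fin.ext (by omega : j.val = i.val)]
  | succ d ih =>
    intro j hj hb
    set j' : Fin n := ⟨i.val + d, by omega⟩ with hj'
    have h1 : J j' j = 1 := hb.2 j' j (Fin.le_def.2 (by simp [hj'])) le_rfl (by simp [hj', hj]; omega)
    have h2 : InJordanBlock J i j' := ⟨Fin.le_def.2 (by simp [hj']), fun k l hk hl =>
      hb.2 k l hk (hl.trans (Fin.le_def.2 (by simp [hj', hj])))⟩
    rw [← ih j' (by simp [hj']) h2]
    rcases (hJ j' j).2 (by simp [hj', hj]; omega) with h3 | h3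
    · rw [h1] at h3
      exact absurd h3 one_ne_zero
    · exact h3.2.symm

-- On a block, (cI + N)^k is the sum of binom(k, d) c^{k-d} N^d, and N^d occupies the d-th
-- superdiagonal; the induction is Pascal's rule. Where truncation spoils the exponent, the binomial
-- coefficient vanishes.
open Classical in
theorem IsJordanMatrix.pow_apply {J : CMat n} (hJ : IsJordanMatrix J) (k : ℕ) :
    ∀ i j, (J ^ k) i j = if InJordanBlock J i j then
      (k.choose (j.val - i.val) : ℂ) * J i i ^ (k - (j.val - i.val)) else 0 := by
  induction k with
  | zero =>
    intro i j
    rw [pow_zero, Matrix.one_apply]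
    by_cases hij : i = j
    · subst hij
      have : InJordanBlock J i i := ⟨le_rfl, fun k l hk hl h => by
        have := Fin.le_def.1 hk
        have := Fin.le_def.1 hl
        omega⟩
      simp [this]
    · rw [if_neg hij]
      split_ifs with hb
      · have h1 : j.val - i.val ≠ 0 := by
          have := Fin.le_def.1 hb.1
          have : i.val ≠ j.val := fun h => hij (Fin.ext h)
          omega
        rw [Nat.choose_eq_zero_of_lt (by omega)]
        simp
      · rfl
  | succ k ih =>
    intro i j
    rw [pow_succ, Matrix.mul_apply]
    have hblock_self : ∀ i, InJordanBlock J i i := fun i => ⟨le_rfl, fun k l hk hl h => by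
        have := Fin.le_def.1 hk
        have := Fin.le_def.1 hl
        omega⟩
    by_cases hj0 : j.val = 0
    · rw [Finset.sum_eq_single j]
      · rw [ih]
        split_ifs with hb
        · have hij : i = j := Fin.ext (by have := Fin.le_def.1 hb.1; omega)
          subst hij
          simp [pow_succ]
        · simp
      · intro l _ hl
        rw [(hJ l j).1 hl (by omega), mul_zero]
      · simp
    · set j' : Fin n := ⟨j.val - 1, by omega⟩ with hj'
      have hjj' : j.val = j'.val + 1 := by simp [hj']; omega
      have hne : j' ≠ j := fun h => by
        have := congrArg Fin.val h
        omega
      -- A column j > 0 of a Jordan matrix has at most two nonzero entries, in rows j - 1 and j.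
      rw [Finset.sum_eq_add j' j hne]
      · rw [ih, ih]
        by_cases hb : InJordanBlock J i j
        · rw [if_pos hb, if_pos hb]
          rcases eq_or_lt_of_le hb.1 with hij | hij
          · subst hij
            have : ¬ InJordanBlock J i j' := fun h => by
              have := Fin.le_def.1 h.1
              omega
            rw [if_neg this]
            simp [pow_succ]
          · have hij' : i.val < j.val := hij
            have hb' : InJordanBlock J i j' := ⟨Fin.le_def.2 (by omega), fun k l hk hl =>
              hb.2 k l hk (hl.trans (Fin.le_def.2 (by omega)))⟩
            have h1 : J j' j = 1 := hb.2 j' j (Fin.le_def.2 (by omega)) le_rfl hjj'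
            rw [if_pos hb', h1, hb.diag_eq hJ (j.val - i.val) j (by omega)]
            obtain ⟨d, hd⟩ : ∃ d, j.val - i.val = d + 1 := ⟨j.val - i.val - 1, by omega⟩
            have hd' : j'.val - i.val = d := by omega
            rw [hd, hd', Nat.choose_succ_succ, Nat.add_sub_add_right]
            rcases Nat.lt_or_ge k (d + 1) with hk | hk
            · rw [Nat.choose_eq_zero_of_lt hk]
              simp
            · rw [show k - d = (k - (d + 1)) + 1 by omega]
              push_cast
              ring
        · rw [if_neg hb, if_neg hb]
          rcases (hJ j' j).2 hjj' with h1 | h1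
          · simp [h1]
          · have : ¬ InJordanBlock J i j' := fun h => hb ⟨h.1.trans (Fin.le_def.2 (by omega)),
              fun k l hk hl hkl => by
                rcases eq_or_lt_of_le hl with hl | hl
                · subst hl
                  have : k = j' := Fin.ext (by omega)
                  rw [this]
                  exact h1.1
                · exact h.2 k l hk (Fin.le_def.2 (by have := Fin.lt_def.1 hl; omega)) hkl⟩
            simp [this]
      · intro l _ hl
        rw [(hJ l j).1 hl.2 (fun h => hl.1 (Fin.ext (by omega))), mul_zero]
      · simp
      · simp

/-- The Taylor series at 0 of the d-th derivative, reindexed by k = m + d. The binomial factors are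
the entries, on the d-th superdiagonal, of the powers of a Jordan block. -/
theorem hasSum_choose_taylor {f : ℂ → ℂ} (hf : Differentiable ℂ f) (d : ℕ) (c : ℂ) :
    HasSum (fun k : ℕ => ((k.factorial : ℂ)⁻¹ * iteratedDeriv k f 0) *
      ((k.choose d : ℂ) * c ^ (k - d))) (iteratedDeriv d f c / d.factorial) := by
  have hd : Differentiable ℂ (iteratedDeriv d f) :=
    (hf.contDiff (n := ⊤)).differentiable_iteratedDeriv d (by exact_mod_cast WithTop.coe_lt_top _)
  have h1 := (Complex.hasSum_taylorSeries_of_entire hd 0 c).div_const (d.factorial : ℂ)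
  rw [← hasSum_nat_add_iff' d, Finset.sum_eq_zero, sub_zero]
  · refine HasSum.of_eq h1 fun m => ?_
    have e1 : iteratedDeriv m (iteratedDeriv d f) = iteratedDeriv (m + d) f := by
      rw [iteratedDeriv_eq_iterate, iteratedDeriv_eq_iterate, iteratedDeriv_eq_iterate,
        Function.iterate_add_apply]
    rw [e1, Nat.add_sub_cancel, sub_zero, smul_eq_mul, smul_eq_mul, Nat.cast_choose ℂ (by omega),
      Nat.add_sub_cancel]
    have h2 : ((m + d).factorial : ℂ) ≠ 0 := by exact_mod_cast (m + d).factorial_ne_zero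
    have h3 : (m.factorial : ℂ) ≠ 0 := by exact_mod_cast m.factorial_ne_zero
    have h4 : (d.factorial : ℂ) ≠ 0 := by exact_mod_cast d.factorial_ne_zero
    field_simp
  · intro i hi
    rw [Nat.choose_eq_zero_of_lt (Finset.mem_range.1 hi)]
    simp

end Jordan

/-! ### Characters as entire functions of the exponent -/

section Character

variable {n : ℕ}

/-- `h^{-u} / Γ(u)`. -/
def gammaKernel (h : ℝ) (u : ℂ) : ℂ := Complex.exp (-(Real.log h * u)) * (Complex.Gamma u)⁻¹

theorem differentiable_gammaKernel (h : ℝ) : Differentiable ℂ (gammaKernel h) := by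
  unfold gammaKernel
  have := Complex.differentiable_one_div_Gamma
  fun_prop

/-- Here c occurs only through an exponential and the entire function 1/Γ, so the character is
entire in c, even where x/h - c is a pole of Γ. -/
theorem hChar_eq_gammaKernel {h : ℝ} (hh : 0 < h) (c x : ℂ) :
    hChar h c x = (Complex.Gamma (x / h) * Complex.exp (Real.log h * (x / h))) *
      gammaKernel h (x / h - c) := by
  have hhc : (h : ℂ) ≠ 0 := by exact_mod_cast hh.ne'
  rw [hChar, gammaKernel, Complex.cpow_def_of_ne_zero hhc, Complex.ofReal_log hh.le, mul_sub,
    neg_sub, Complex.exp_sub, div_eq_mul_inv (Complex.Gamma _)]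
  have := Complex.exp_ne_zero (Complex.log h * (x / h))
  field_simp

theorem differentiable_hChar {h : ℝ} (hh : 0 < h) (x : ℂ) :
    Differentiable ℂ fun c => hChar h c x := by
  simp_rw [hChar_eq_gammaKernel hh]
  have := differentiable_gammaKernel h
  fun_prop

/-- Derivatives in c become, up to sign, derivatives of one entire function at x/h - c. This makes
the logarithms holomorphic in x away from the poles of Γ(x/h). -/
theorem hLog_eq {h : ℝ} (hh : 0 < h) (k : ℕ) (c x : ℂ) :
    hLog h k c x = (Complex.Gamma (x / h) * Complex.exp (Real.log h * (x / h))) *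
      ((-1) ^ k * iteratedDeriv k (gammaKernel h) (x / h - c)) / k.factorial := by
  rw [hLog]
  simp_rw [hChar_eq_gammaKernel hh]
  rw [iteratedDeriv_const_mul_field, iteratedDeriv_comp_const_sub]
  simp [smul_eq_mul]

theorem differentiableAt_hLog {h : ℝ} (hh : 0 < h) (k : ℕ) (c : ℂ) {x : ℂ} (hx : 0 < x.re) :
    DifferentiableAt ℂ (hLog h k c) x := by
  have e : hLog h k c = fun x => (Complex.Gamma (x / h) * Complex.exp (Real.log h * (x / h))) *
      ((-1) ^ k * iteratedDeriv k (gammaKernel h) (x / h - c)) / k.factorial := by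
    funext x
    exact hLog_eq hh k c x
  rw [e]
  have hd : Differentiable ℂ (iteratedDeriv k (gammaKernel h)) :=
    ((differentiable_gammaKernel h).contDiff (n := ⊤)).differentiable_iteratedDeriv k
      (by exact_mod_cast WithTop.coe_lt_top _)
  have hG : DifferentiableAt ℂ (fun x : ℂ => Complex.Gamma (x / h)) x := by
    refine DifferentiableAt.fun_comp' (g := Complex.Gamma) x ?_ (by fun_prop)
    refine Complex.differentiableAt_Gamma _ fun m hm => ?_
    have h1 : 0 < (x / h).re := by
      rw [Complex.div_ofReal_re]
      positivity
    rw [hm] at h1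
    simp at h1
    have : (0 : ℝ) ≤ m := Nat.cast_nonneg m
    linarith
  fun_prop

/-- The functional equation of 1/Γ holds everywhere, so no exponent c has to be excluded. -/
theorem hChar_sub {h : ℝ} (hh : 0 < h) (c : ℂ) {x : ℂ} (hx : h < x.re) :
    hChar h c (x - h) = (1 - (h : ℂ) / (x - h) * c) * hChar h c x := by
  have hhc : (h : ℂ) ≠ 0 := by exact_mod_cast hh.ne'
  have hne : x - h ≠ 0 := fun h0 => by
    have : (x - h).re = 0 := by rw [h0]; rfl
    simp at this
    linarith
  have e1 : (x - h) / h = x / h - 1 := by field_simp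
  have e2 : x / h - 1 ≠ 0 := by
    rw [← e1]
    exact div_ne_zero hne hhc
  have e3 := Complex.Gamma_add_one _ e2
  have e4 := Complex.one_div_Gamma_eq_self_mul_one_div_Gamma_add_one (x / h - 1 - c)
  rw [sub_add_cancel] at e3
  rw [show x / h - 1 - c + 1 = x / h - c by ring] at e4
  have e5 : (h : ℂ) / (x - h) = (x / h - 1)⁻¹ := by rw [← e1, inv_div]
  rw [hChar, hChar, e1, e3, e5, div_eq_mul_inv (Complex.Gamma (x / h - 1)), e4,
    div_eq_mul_inv ((x / h - 1) * _)]
  field_simp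

end Character

/-! ### Matrix characters: equation, invertibility, limit -/

section MatrixCharacter

variable {n : ℕ}

attribute [local instance] Matrix.linftyOpNormedRing Matrix.linftyOpNormedAlgebra

/-- The matrix `e_A^{(h)+}`, as a function of the matrix `A`. -/
def matChar (h : ℝ) (A : CMat n) (x : ℂ) : CMat n := entireCalc (fun c => hChar h c x) A

/-- Entry by entry, the Taylor series of the character summed over the powers of a Jordan block is
the series of `hasSum_choose_taylor`. -/
theorem jordanSolution_eq {h : ℝ} (hh : 0 < h) {J : CMat n} (hJ : IsJordanMatrix J) (x : ℂ) :
    jordanSolution h J x = matChar h J x := by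
  have h1 := hasSum_entireCalc (differentiable_hChar hh x) J
  ext i j
  have h2 : HasSum (fun k : ℕ => (((k.factorial : ℂ)⁻¹ *
      iteratedDeriv k (fun c => hChar h c x) 0) • J ^ k) i j) (matChar h J x i j) :=
    Pi.hasSum.1 (Pi.hasSum.1 h1 i) j
  refine HasSum.unique ?_ h2
  rw [jordanSolution, Matrix.of_apply]
  simp only [Matrix.smul_apply, hJ.pow_apply, smul_eq_mul]
  by_cases hb : InJordanBlock J i j
  · rw [if_pos (show i ≤ j ∧ ∀ k l : Fin n, i ≤ k → l ≤ j → l.val = k.val + 1 → J k l = 1 from hb)]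
    simp only [if_pos hb]
    exact hasSum_choose_taylor (differentiable_hChar hh x) _ _
  · rw [if_neg (show ¬ (i ≤ j ∧ ∀ k l : Fin n, i ≤ k → l ≤ j → l.val = k.val + 1 → J k l = 1)
      from hb)]
    simp only [if_neg hb, mul_zero]
    exact hasSum_zero

theorem entireCalc_conj {f : ℂ → ℂ} (hf : Differentiable ℂ f) {S : CMat n} (hS : IsUnit S.det)
    (J : CMat n) : entireCalc f (S * J * S⁻¹) = S * entireCalc f J * S⁻¹ := by
  have h1 := ((hasSum_entireCalc hf J).mul_left S).mul_right S⁻¹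
  refine HasSum.tsum_eq ?_
  refine HasSum.of_eq h1 fun k => ?_
  have : (S * J * S⁻¹) ^ k = S * J ^ k * S⁻¹ := by
    induction k with
    | zero => simp [Matrix.mul_nonsing_inv S hS]
    | succ k ih =>
      rw [pow_succ, ih, pow_succ]
      calc S * J ^ k * S⁻¹ * (S * J * S⁻¹) = S * J ^ k * (S⁻¹ * S) * J * S⁻¹ := by
            simp only [mul_assoc]
        _ = _ := by rw [Matrix.nonsing_inv_mul S hS]; simp only [mul_assoc, one_mul]
  rw [this, mul_smul_comm, smul_mul_assoc]

/-- The right-hand side does not involve S and J: the canonical form does not depend on the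
reduction chosen, which uniqueness requires. -/
theorem IsJordanReduction.conj_jordanSolution {h : ℝ} (hh : 0 < h) {A S J : CMat n}
    (hA : IsJordanReduction A S J) (x : ℂ) :
    S * jordanSolution h J x * S⁻¹ = matChar h A x := by
  rw [jordanSolution_eq hh hA.1, hA.2.2, matChar, matChar,
    entireCalc_conj (differentiable_hChar hh x) hA.2.1]

/-- In the scalar relation the factor 1 - hc/(x - h) is affine in c, and the calculus replaces c by
A. -/
theorem matChar_sub {h : ℝ} (hh : 0 < h) (A : CMat n) {x : ℂ} (hx : h < x.re) :
    matChar h A (x - h) = (1 - ((h : ℂ) / (x - h)) • A) * matChar h A x := by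
  have hd := differentiable_hChar hh x
  have e1 : (fun c => hChar h c (x - h)) = fun c => hChar h c x -
      (h : ℂ) / (x - h) * (c * hChar h c x) := by
    funext c
    rw [hChar_sub hh c hx]
    ring
  have hd2 : Differentiable ℂ fun c => c * hChar h c x := by fun_prop
  have hd3 : Differentiable ℂ fun c => (h : ℂ) / (x - h) * (c * hChar h c x) := by fun_prop
  rw [matChar, e1, entireCalc_sub hd hd3, entireCalc_const_mul hd2, entireCalc_id_mul hd, sub_mul,
    one_mul, smul_mul_assoc]
  rfl

/-- The calculus is defined for each x separately; on a Jordan reduction its entries are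
combinations of the functions `hLog`, holomorphic in x. -/
theorem IsJordanReduction.differentiableAt_matChar {h : ℝ} (hh : 0 < h) {A S J : CMat n}
    (hA : IsJordanReduction A S J) {x : ℂ} (hx : 0 < x.re) (i j : Fin n) :
    DifferentiableAt ℂ (fun x => matChar h A x i j) x := by
  have e : (fun x => matChar h A x i j) = fun x => (S * jordanSolution h J x * S⁻¹) i j := by
    funext x
    rw [hA.conj_jordanSolution hh]
  have h1 : ∀ i j, DifferentiableAt ℂ (fun x => jordanSolution h J x i j) x := by
    intro i j
    simp only [jordanSolution, Matrix.of_apply]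
    split_ifs
    · exact differentiableAt_hLog hh _ _ hx
    · exact differentiableAt_const _
  rw [e]
  simp only [Matrix.mul_apply]
  fun_prop

/-- The matrix is conjugate to a triangular one with diagonal h^c Γ(x/h)/Γ(x/h - c), and both
arguments lie in the right half-plane, where Γ has neither zeros nor poles. -/
theorem IsJordanReduction.isUnit_det_matChar {h : ℝ} (hh : 0 < h) {A S J : CMat n}
    (hA : IsJordanReduction A S J) {x : ℂ} (hx : 0 < x.re) (hx' : ∀ i, h * (J i i).re < x.re) :
    IsUnit (matChar h A x).det := by
  have hhc : (h : ℂ) ≠ 0 := by exact_mod_cast hh.ne'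
  rw [← hA.conj_jordanSolution hh, Matrix.det_mul, Matrix.det_mul]
  refine (hA.2.1.mul ?_).mul ((Matrix.isUnit_nonsing_inv_det_iff).2 hA.2.1)
  rw [Matrix.det_of_isUpperTriangular, isUnit_iff_ne_zero, Finset.prod_ne_zero_iff]
  · intro i _
    have hb : i ≤ i ∧ ∀ k l : Fin n, i ≤ k → l ≤ i → l.val = k.val + 1 → J k l = 1 :=
      ⟨le_rfl, fun k l hk hl h => by
        have := Fin.le_def.1 hk
        have := Fin.le_def.1 hl
        omega⟩
    rw [jordanSolution, Matrix.of_apply, if_pos hb, Nat.sub_self, hLog, iteratedDeriv_zero]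
    simp only [Nat.factorial_zero, Nat.cast_one, div_one]
    have h1 : 0 < (x / h).re := by
      rw [Complex.div_ofReal_re]
      positivity
    have h2 : 0 < (x / h - J i i).re := by
      rw [Complex.sub_re, Complex.div_ofReal_re, sub_pos, lt_div_iff₀ hh, mul_comm]
      exact hx' i
    refine mul_ne_zero ((Complex.cpow_ne_zero_iff).2 (Or.inl hhc)) (div_ne_zero
      (Complex.Gamma_ne_zero_of_re_pos h1) (Complex.Gamma_ne_zero_of_re_pos h2))
  · intro i j hij
    rw [jordanSolution, Matrix.of_apply, if_neg]
    exact fun h => absurd hij (not_lt.2 h.1)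

theorem norm_matChar_sub_le {h ρ : ℝ} (hh : 0 < h) (hρ : 0 < ρ) {A : CMat n} (hA : ‖A‖ ≤ ρ / 2)
    {x : ℂ} (hx : (2 * ρ ^ 2 + 4 * ρ + 2) * h ≤ x.re) :
    ‖matChar h A x - NormedSpace.exp (Complex.log x • A)‖ ≤
      4 * (ρ ^ 2 + ρ) * h / x.re * Real.exp (ρ * ‖Complex.log x‖) * ‖(1 : CMat n)‖ * 2 := by
  have hd := differentiable_hChar hh x
  have hd2 : Differentiable ℂ fun c => Complex.exp (c * Complex.log x) := by fun_prop
  have e : NormedSpace.exp (Complex.log x • A) =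
      entireCalc (fun c => Complex.exp (c * Complex.log x)) A := (entireCalc_exp _ A).symm
  rw [e, matChar, ← entireCalc_sub hd hd2]
  exact norm_entireCalc_le (hd.sub hd2) hρ (fun c hc => norm_hChar_sub_le hh hc hx) hA

theorem tendsto_matChar {A : ℝ → CMat n} {A₀ : CMat n} (hA : Tendsto A (𝓝[>] 0) (𝓝 A₀)) {x : ℂ}
    (hx : 0 < x.re) :
    Tendsto (fun h => matChar h (A h) x) (𝓝[>] 0) (𝓝 (NormedSpace.exp (Complex.log x • A₀))) := by
  -- The calculus requires a disc of exponents of twice the norm of the matrix; for small h the norm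
  -- of `A h` is at most ‖A₀‖ + 1.
  set ρ := 2 * (‖A₀‖ + 1) with hρ
  have hρ0 : 0 < ρ := by positivity
  have h1 : Tendsto (fun h => NormedSpace.exp (Complex.log x • A h)) (𝓝[>] 0)
      (𝓝 (NormedSpace.exp (Complex.log x • A₀))) :=
    (NormedSpace.exp_continuous.tendsto _).comp (hA.const_smul _)
  have hid : Tendsto (fun h : ℝ => h) (𝓝[>] 0) (𝓝 0) := nhdsWithin_le_nhds
  have h2 : Tendsto (fun h => matChar h (A h) x - NormedSpace.exp (Complex.log x • A h)) (𝓝[>] 0)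
      (𝓝 0) := by
    have h3 : Tendsto (fun h : ℝ => 4 * (ρ ^ 2 + ρ) * h / x.re * Real.exp (ρ * ‖Complex.log x‖) *
        ‖(1 : CMat n)‖ * 2) (𝓝[>] 0) (𝓝 0) := by
      have := ((((hid.const_mul (4 * (ρ ^ 2 + ρ))).div_const x.re).mul_const
        (Real.exp (ρ * ‖Complex.log x‖))).mul_const ‖(1 : CMat n)‖).mul_const 2
      simpa using this
    refine squeeze_zero_norm' ?_ h3
    have h4 : ∀ᶠ h in 𝓝[>] (0 : ℝ), ‖A h‖ ≤ ρ / 2 :=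
      hA.norm.eventually (ge_mem_nhds (by rw [hρ]; linarith))
    have h5 : ∀ᶠ h in 𝓝[>] (0 : ℝ), (2 * ρ ^ 2 + 4 * ρ + 2) * h ≤ x.re :=
      (hid.const_mul (2 * ρ ^ 2 + 4 * ρ + 2)).eventually (ge_mem_nhds (by simpa using hx))
    filter_upwards [h4, h5, self_mem_nhdsWithin] with h h6 h7 h8
    exact norm_matChar_sub_le h8 hρ0 h6 h7
  simpa using h2.add h1

/-- The functions `e_A^{(h)+}` are bounded on the compact sets of the right half-plane, uniformly
for small `h` and bounded `A`. -/
theorem eventually_norm_matChar_le {A : ℝ → CMat n} {A₀ : CMat n}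
    (hA : Tendsto A (𝓝[>] 0) (𝓝 A₀)) {K : Set ℂ} (hK : IsCompact K) (hKre : ∀ x ∈ K, 1 ≤ x.re) :
    ∃ M : ℝ, ∀ᶠ h in 𝓝[>] (0 : ℝ), ∀ x ∈ K, ‖matChar h (A h) x‖ ≤ M := by
  set ρ := 2 * (‖A₀‖ + 1) with hρ
  have hρ0 : 0 < ρ := by positivity
  have hlog : ContinuousOn Complex.log K := fun x hx =>
    (continuousAt_clog (Or.inl (by linarith [hKre x hx]))).continuousWithinAt
  obtain ⟨B, hB⟩ := hK.exists_bound_of_continuousOn hlog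
  have hc : ContinuousOn (fun p : ℂ × CMat n => NormedSpace.exp (p.1 • p.2))
      (Metric.closedBall 0 (max B 0) ×ˢ Metric.closedBall 0 (ρ / 2)) := by
    refine Continuous.continuousOn ?_
    exact NormedSpace.exp_continuous.comp (continuous_fst.smul continuous_snd)
  have : ProperSpace (CMat n) := FiniteDimensional.proper ℂ (CMat n)
  obtain ⟨M, hM⟩ := ((isCompact_closedBall (0 : ℂ) (max B 0)).prod
    (isCompact_closedBall (0 : CMat n) (ρ / 2))).exists_bound_of_continuousOn hc
  refine ⟨4 * (ρ ^ 2 + ρ) * Real.exp (ρ * max B 0) * ‖(1 : CMat n)‖ * 2 + M, ?_⟩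
  have hid : Tendsto (fun h : ℝ => h) (𝓝[>] 0) (𝓝 0) := nhdsWithin_le_nhds
  have h4 : ∀ᶠ h in 𝓝[>] (0 : ℝ), ‖A h‖ ≤ ρ / 2 :=
    hA.norm.eventually (ge_mem_nhds (by rw [hρ]; linarith))
  have h5 : ∀ᶠ h in 𝓝[>] (0 : ℝ), (2 * ρ ^ 2 + 4 * ρ + 2) * h ≤ 1 :=
    (hid.const_mul (2 * ρ ^ 2 + 4 * ρ + 2)).eventually (ge_mem_nhds (by simp))
  have h6 : ∀ᶠ h in 𝓝[>] (0 : ℝ), h ≤ 1 := hid.eventually (ge_mem_nhds one_pos)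
  filter_upwards [h4, h5, h6, self_mem_nhdsWithin] with h h7 h8 h9 h10 x hx
  have h11 : 0 < h := h10
  have hre := hKre x hx
  have k1 := norm_matChar_sub_le h10 hρ0 h7 (h8.trans hre)
  have hlx : ‖Complex.log x‖ ≤ max B 0 := (hB x hx).trans (le_max_left _ _)
  have k2 := hM (Complex.log x, A h) ⟨by simpa using hlx, by simpa using h7⟩
  have k3 : h / x.re ≤ 1 := by
    rw [div_le_one (by linarith)]
    linarith
  have k4 : 4 * (ρ ^ 2 + ρ) * h / x.re * Real.exp (ρ * ‖Complex.log x‖) * ‖(1 : CMat n)‖ * 2 ≤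
      4 * (ρ ^ 2 + ρ) * Real.exp (ρ * max B 0) * ‖(1 : CMat n)‖ * 2 := by
    calc _ = 4 * (ρ ^ 2 + ρ) * (h / x.re) * Real.exp (ρ * ‖Complex.log x‖) *
          ‖(1 : CMat n)‖ * 2 := by ring
      _ ≤ 4 * (ρ ^ 2 + ρ) * 1 * Real.exp (ρ * max B 0) * ‖(1 : CMat n)‖ * 2 := by gcongr
      _ = _ := by ring
  calc ‖matChar h (A h) x‖ = ‖(matChar h (A h) x - NormedSpace.exp (Complex.log x • A h)) +
        NormedSpace.exp (Complex.log x • A h)‖ := by rw [sub_add_cancel]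
    _ ≤ _ := (norm_add_le _ _).trans (add_le_add (k1.trans k4) k2)

end MatrixCharacter

end

noncomputable section

/-! ### Meromorphic functions on the plane -/

section Meromorphic

theorem eventually_codiscrete_iff {p : ℂ → Prop} :
    (∀ᶠ x in codiscrete ℂ, p x) ↔ ∀ x, ∀ᶠ y in 𝓝[≠] x, p y := by
  rw [Filter.Eventually, codiscrete, mem_codiscreteWithin_iff_forall_mem_nhdsNE]
  simp [Filter.Eventually]

theorem eventually_codiscrete_comp {p : ℂ → Prop} (hp : ∀ᶠ x in codiscrete ℂ, p x) {g : ℂ → ℂ}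
    (hg : Continuous g) (hinj : Function.Injective g) : ∀ᶠ x in codiscrete ℂ, p (g x) := by
  rw [eventually_codiscrete_iff] at hp ⊢
  intro x
  have h1 : Tendsto g (𝓝[≠] x) (𝓝[≠] (g x)) :=
    tendsto_nhdsWithin_of_tendsto_nhds_of_eventually_within _
      ((hg.tendsto x).mono_left nhdsWithin_le_nhds)
      (eventually_mem_nhdsWithin.mono fun y hy h => hy (hinj h))
  exact h1.eventually (hp (g x))

theorem Meromorphic.eventually_codiscrete_ne_zero {f : ℂ → ℂ} (hf : Meromorphic f) {x₀ : ℂ}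
    (h0 : ∃ᶠ x in 𝓝[≠] x₀, f x ≠ 0) : ∀ᶠ x in codiscrete ℂ, f x ≠ 0 := by
  refine MeromorphicAt.MeromorphicOn.codiscreteWithin_setOfPred_ne_zero (fun x _ => hf x) fun u _ =>
    MeromorphicOn.meromorphicOrderAt_ne_top_of_isPreconnected (U := Set.univ) (x := x₀)
      (fun x _ => hf x) isPreconnected_univ trivial trivial ?_
  rw [Ne, meromorphicOrderAt_eq_top_iff]
  exact fun h => h0 (h.mono fun x hx => by simpa using hx)

theorem MeromorphicOn.eventuallyEq_of_isPreconnected {f g : ℂ → ℂ} {U : Set ℂ}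
    (hf : MeromorphicOn f U) (hg : MeromorphicOn g U) (hU : IsPreconnected U) {x₀ x : ℂ}
    (hx₀ : x₀ ∈ U) (hx : x ∈ U) (h0 : f =ᶠ[𝓝[≠] x₀] g) : f =ᶠ[𝓝[≠] x] g := by
  by_contra hne
  have h1 : meromorphicOrderAt (f - g) x ≠ ⊤ := by
    rw [Ne, meromorphicOrderAt_eq_top_iff]
    exact fun h => hne (h.mono fun y hy => sub_eq_zero.1 hy)
  refine MeromorphicOn.meromorphicOrderAt_ne_top_of_isPreconnected (hf.sub hg) hU hx hx₀ h1 ?_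
  rw [meromorphicOrderAt_eq_top_iff]
  exact h0.mono fun y hy => sub_eq_zero.2 hy

/-- The identity theorem gives equality on punctured neighbourhoods, and the normal form fixes the
remaining values. Uniqueness of the canonical solutions as plain functions rests on this. -/
theorem MeromorphicNFOn.eq_of_eventuallyEq {f g : ℂ → ℂ} (hf : MeromorphicNFOn f Set.univ)
    (hg : MeromorphicNFOn g Set.univ) {x₀ : ℂ} (h0 : f =ᶠ[𝓝[≠] x₀] g) : f = g := by
  funext x
  exact (((hf (Set.mem_univ x)).eventuallyEq_nhdsNE_iff_eventuallyEq_nhds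
    (hg (Set.mem_univ x))).1 (hf.meromorphicOn.eventuallyEq_of_isPreconnected hg.meromorphicOn
      isPreconnected_univ trivial trivial h0)).eq_of_nhds

theorem eventually_nhds_lt_re {R : ℝ} {x : ℂ} (hx : R < x.re) : ∀ᶠ y in 𝓝 x, R < y.re :=
  Complex.continuous_re.continuousAt.eventually (lt_mem_nhds hx)

end Meromorphic

/-! ### Matrices of meromorphic functions and their continuation to the left -/

section Extension

variable {n : ℕ}

/-- The entries of `Y` are holomorphic near `x`. -/
def MatAnalyticAt (Y : ℂ → CMat n) (x : ℂ) : Prop := ∀ i j, AnalyticAt ℂ (fun y => Y y i j) x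

/-- The entries of `Y` are meromorphic near `x`. -/
def MatMeromorphicAt (Y : ℂ → CMat n) (x : ℂ) : Prop :=
  ∀ i j, MeromorphicAt (fun y => Y y i j) x

theorem MatAnalyticAt.mul {Y Z : ℂ → CMat n} {x : ℂ} (hY : MatAnalyticAt Y x)
    (hZ : MatAnalyticAt Z x) : MatAnalyticAt (fun y => Y y * Z y) x := by
  intro i j
  simp only [Matrix.mul_apply]
  exact Finset.analyticAt_fun_sum _ fun k _ => (hY i k).mul (hZ k j)

theorem MatMeromorphicAt.mul {Y Z : ℂ → CMat n} {x : ℂ} (hY : MatMeromorphicAt Y x)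
    (hZ : MatMeromorphicAt Z x) : MatMeromorphicAt (fun y => Y y * Z y) x := by
  intro i j
  simp only [Matrix.mul_apply]
  exact MeromorphicAt.fun_sum fun k _ => (hY i k).mul (hZ k j)

theorem MatAnalyticAt.meromorphicAt {Y : ℂ → CMat n} {x : ℂ} (hY : MatAnalyticAt Y x) :
    MatMeromorphicAt Y x := fun i j => (hY i j).meromorphicAt

theorem MatMeromorphicAt.comp {Y : ℂ → CMat n} {x : ℂ} {g : ℂ → ℂ}
    (hY : MatMeromorphicAt Y (g x)) (hg : AnalyticAt ℂ g x) :
    MatMeromorphicAt (fun y => Y (g y)) x :=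
  fun i j => (hY i j).comp_analyticAt hg

theorem MatAnalyticAt.comp {Y : ℂ → CMat n} {x : ℂ} {g : ℂ → ℂ}
    (hY : MatAnalyticAt Y (g x)) (hg : AnalyticAt ℂ g x) :
    MatAnalyticAt (fun y => Y (g y)) x :=
  fun i j => (hY i j).comp (f := g) hg

theorem MatMeromorphicAt.det {Y : ℂ → CMat n} {x : ℂ} (hY : MatMeromorphicAt Y x) :
    MeromorphicAt (fun y => (Y y).det) x := by
  simp only [Matrix.det_apply']
  exact MeromorphicAt.fun_sum fun k _ => (MeromorphicAt.const _ _).mul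
    (MeromorphicAt.fun_prod fun l _ => hY _ _)

theorem MatAnalyticAt.det {Y : ℂ → CMat n} {x : ℂ} (hY : MatAnalyticAt Y x) :
    AnalyticAt ℂ (fun y => (Y y).det) x := by
  simp only [Matrix.det_apply']
  exact Finset.analyticAt_fun_sum _ fun k _ => analyticAt_const.mul
    (Finset.analyticAt_fun_prod _ fun l _ => hY _ _)

/-- Cramer's formula, by which inverses inherit holomorphy and meromorphy from determinants. -/
theorem inv_apply_eq (M : CMat n) (i j : Fin n) :
    M⁻¹ i j = (M.det)⁻¹ * (M.updateRow j (Pi.single i 1)).det := by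
  rw [Matrix.inv_def, Matrix.smul_apply, Matrix.adjugate_apply, Ring.inverse_eq_inv', smul_eq_mul]

theorem MatMeromorphicAt.inv {Y : ℂ → CMat n} {x : ℂ} (hY : MatMeromorphicAt Y x) :
    MatMeromorphicAt (fun y => (Y y)⁻¹) x := by
  intro i j
  simp only [inv_apply_eq]
  refine hY.det.inv.mul (MatMeromorphicAt.det fun k l => ?_)
  by_cases hk : k = j
  · subst hk
    simp only [Matrix.updateRow_self]
    exact MeromorphicAt.const _ _
  · simp only [Matrix.updateRow_ne hk]
    exact hY k l

theorem MatAnalyticAt.inv {Y : ℂ → CMat n} {x : ℂ} (hY : MatAnalyticAt Y x)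
    (hx : (Y x).det ≠ 0) : MatAnalyticAt (fun y => (Y y)⁻¹) x := by
  intro i j
  simp only [inv_apply_eq]
  refine (hY.det.inv hx).mul (MatAnalyticAt.det fun k l => ?_)
  by_cases hk : k = j
  · subst hk
    simp only [Matrix.updateRow_self]
    exact analyticAt_const
  · simp only [Matrix.updateRow_ne hk]
    exact hY k l

theorem MatAnalyticAt.congr {Y Z : ℂ → CMat n} {x : ℂ} (hY : MatAnalyticAt Y x)
    (h : Y =ᶠ[𝓝 x] Z) : MatAnalyticAt Z x :=
  fun i j => (hY i j).congr (h.mono fun _ hy => congrArg (fun M : CMat n => M i j) hy)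

theorem MatMeromorphicAt.congr {Y Z : ℂ → CMat n} {x : ℂ} (hY : MatMeromorphicAt Y x)
    (h : Y =ᶠ[𝓝 x] Z) : MatMeromorphicAt Z x :=
  fun i j => (hY i j).congr ((h.mono fun _ hy => congrArg (fun M : CMat n => M i j) hy).filter_mono nhdsWithin_le_nhds)

/-- The entries of `Y` are meromorphic in normal form on the plane. -/
def MatNF (Y : ℂ → CMat n) : Prop := ∀ i j, MeromorphicNFOn (fun x => Y x i j) Set.univ

theorem MatNF.eq_of_eventuallyEq {Y Z : ℂ → CMat n} (hY : MatNF Y) (hZ : MatNF Z) {x₀ : ℂ}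
    (h : Y =ᶠ[𝓝[≠] x₀] Z) : Y = Z := by
  funext x
  ext i j
  exact congrFun ((hY i j).eq_of_eventuallyEq (hZ i j) (h.mono fun y hy => congrArg (fun M : CMat n => M i j) hy)) x

theorem MatNF.comp_neg {Y : ℂ → CMat n} (hY : MatNF Y) : MatNF fun x => Y (-x) :=
  fun i j _ _ => (hY i j (Set.mem_univ _)).comp_analyticAt (g := fun x : ℂ => -x)
    analyticAt_id.neg

/-- A solution of `Y(x - h) = B(x) Y(x)` that is holomorphic at `x` is so at `x - h` if `B` is
holomorphic at `x`. -/
theorem MatNF.step {Y B : ℂ → CMat n} (hY : MatNF Y) {h : ℝ}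
    (heq : ∀ᶠ x in codiscrete ℂ, Y (x - h) = B x * Y x) {x : ℂ} (hB : MatAnalyticAt B x)
    (hx : MatAnalyticAt Y x) : MatAnalyticAt Y (x - h) ∧ Y (x - h) = B x * Y x := by
  have hsub : AnalyticAt ℂ (fun y : ℂ => y - h) x := by fun_prop
  have h1 := (eventually_codiscrete_iff.1 heq) x
  -- Both sides are in normal form at x, so their agreement on a punctured neighbourhood extends to
  -- x.
  have h2 : ∀ i j, (fun y => Y (y - h) i j) =ᶠ[𝓝 x] fun y => (B y * Y y) i j := by
    intro i j
    have hl : MeromorphicNFAt (fun y => Y (y - h) i j) x :=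
      (hY i j (Set.mem_univ _)).comp_analyticAt (g := fun y : ℂ => y - h) hsub
    exact (hl.eventuallyEq_nhdsNE_iff_eventuallyEq_nhds ((hB.mul hx) i j).meromorphicNFAt).1
      (h1.mono fun y hy => congrArg (fun M : CMat n => M i j) hy)
  constructor
  · intro i j
    have h3 : AnalyticAt ℂ (fun y => Y (y - h) i j) x := ((hB.mul hx) i j).congr (h2 i j).symm
    have h4 : AnalyticAt ℂ (fun y : ℂ => y + h) (x - h) := by fun_prop
    have h5 : AnalyticAt ℂ ((fun y => Y (y - h) i j) ∘ fun y : ℂ => y + h) (x - h) :=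
      AnalyticAt.comp (by simpa using h3) h4
    have h6 : ((fun y => Y (y - h) i j) ∘ fun y : ℂ => y + h) = fun y => Y y i j := by
      funext y
      simp
    rwa [h6] at h5
  · ext i j
    exact (h2 i j).eq_of_nhds

/-- The translates `B(x + h) ⋯ B(x + N h) Y₀(x + N h)` of a solution of `Y(x - h) = B(x) Y(x)`. -/
def leftExtension (h : ℝ) (B Y₀ : ℂ → CMat n) : ℕ → ℂ → CMat n
  | 0 => Y₀
  | N + 1 => fun x => B (x + h) * leftExtension h B Y₀ N (x + h)

/-- A solution of `Y(x - h) = B(x) Y(x)` on a right half-plane extends to a meromorphic solution on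
the plane. -/
theorem exists_matNF_extension {h : ℝ} (hh : 0 < h) {B Y₀ : ℂ → CMat n} {R : ℝ}
    (hB : ∀ x, MatMeromorphicAt B x) (hY₀ : ∀ x : ℂ, R < x.re → MatAnalyticAt Y₀ x)
    (heq : ∀ x : ℂ, R + h < x.re → Y₀ (x - h) = B x * Y₀ x) :
    ∃ Y : ℂ → CMat n, MatNF Y ∧ (∀ᶠ x in codiscrete ℂ, Y (x - h) = B x * Y x) ∧
      ∀ x : ℂ, R < x.re → Y x = Y₀ x := by
  set W := leftExtension h B Y₀ with hW
  have hre : ∀ x : ℂ, (x + h).re = x.re + h := fun x => by simp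
  have hmer : ∀ N : ℕ, ∀ x : ℂ, R - N * h < x.re → MatMeromorphicAt (W N) x := by
    intro N
    induction N with
    | zero => exact fun x hx => (hY₀ x (by simpa using hx)).meromorphicAt
    | succ N ih =>
      intro x hx
      have hadd : AnalyticAt ℂ (fun y : ℂ => y + h) x := by fun_prop
      exact ((hB _).comp (g := fun y : ℂ => y + h) hadd).mul
        ((ih (x + h) (by rw [hre]; push_cast at hx; linarith)).comp (g := fun y : ℂ => y + h) hadd)
  have hst : ∀ N : ℕ, ∀ x : ℂ, R - N * h < x.re → W (N + 1) x = W N x := by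
    intro N
    induction N with
    | zero =>
      intro x hx
      have := heq (x + h) (by rw [hre]; simp at hx; linarith)
      rw [add_sub_cancel_right] at this
      exact this.symm
    | succ N ih =>
      intro x hx
      change B (x + h) * W (N + 1) (x + h) = B (x + h) * W N (x + h)
      rw [ih (x + h) (by rw [hre]; push_cast at hx; linarith)]
  have hst2 : ∀ N K : ℕ, ∀ x : ℂ, R - N * h < x.re → W (N + K) x = W N x := by
    intro N K x hx
    induction K with
    | zero => rfl
    | succ K ih =>
      rw [← add_assoc, hst (N + K) x ?_, ih]
      push_cast
      have : (0 : ℝ) ≤ K * h := by positivity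
      linarith
  -- A number of steps that brings x beyond R. The extra step makes the inequality strict, so that
  -- the same number serves near x.
  set Nx : ℂ → ℕ := fun x => ⌈(R - x.re) / h⌉₊ + 1 with hNx
  have hNx' : ∀ x, R - Nx x * h < x.re := by
    intro x
    have h1 := Nat.le_ceil ((R - x.re) / h)
    rw [div_le_iff₀ hh] at h1
    simp only [hNx]
    push_cast
    linarith
  have key : ∀ N : ℕ, ∀ x : ℂ, R - N * h < x.re → W (Nx x) x = W N x := by
    intro N x hx
    rcases le_total N (Nx x) with hle | hle
    · obtain ⟨K, hK⟩ := Nat.exists_eq_add_of_le hle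
      rw [hK, hst2 N K x hx]
    · obtain ⟨K, hK⟩ := Nat.exists_eq_add_of_le hle
      rw [hK, hst2 _ K x (hNx' x)]
  set Y₁ : ℂ → CMat n := fun x => W (Nx x) x with hY₁
  have hloc : ∀ x, Y₁ =ᶠ[𝓝 x] W (Nx x) := fun x =>
    (eventually_nhds_lt_re (hNx' x)).mono fun y hy => key _ y hy
  have hmer₁ : ∀ x, MatMeromorphicAt Y₁ x := fun x => (hmer _ x (hNx' x)).congr (hloc x).symm
  have heq₁ : ∀ x, Y₁ (x - h) = B x * Y₁ x := by
    intro x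
    have h1 : R - ((Nx x + 1 : ℕ) : ℝ) * h < (x - h).re := by
      have := hNx' x
      simp only [Complex.sub_re, Complex.ofReal_re]
      push_cast
      linarith
    have h2 := key (Nx x + 1) (x - h) h1
    change W (Nx (x - h)) (x - h) = _
    rw [h2]
    change B (x - h + h) * W (Nx x) (x - h + h) = _
    rw [sub_add_cancel]
  have hright : ∀ x : ℂ, R < x.re → Y₁ x = Y₀ x := fun x hx => key 0 x (by simpa using hx)
  -- Passing to the normal form changes Y₁ on a discrete set only, and not at all on the half-plane,
  -- where Y₁ is holomorphic.
  set Y : ℂ → CMat n := fun x => Matrix.of fun i j =>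
    toMeromorphicNFOn (fun y => Y₁ y i j) Set.univ x with hY
  have hcod : ∀ᶠ x in codiscrete ℂ, Y x = Y₁ x := by
    have h1 : ∀ i j, ∀ᶠ x in codiscrete ℂ, Y x i j = Y₁ x i j := fun i j =>
      (toMeromorphicNFOn_eqOn_codiscrete (U := Set.univ) fun x _ => hmer₁ x i j).symm
    filter_upwards [eventually_all.2 fun i => eventually_all.2 (h1 i)] with x hx
    ext i j
    exact hx i j
  refine ⟨Y, fun i j => meromorphicNFOn_toMeromorphicNFOn _ _, ?_, ?_⟩
  · filter_upwards [hcod, eventually_codiscrete_comp hcod (g := fun x : ℂ => x - h) (by fun_prop)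
      (sub_left_injective)] with x h1 h2
    rw [h1, h2, heq₁]
  · intro x hx
    have hev : Y₁ =ᶠ[𝓝 x] Y₀ := (eventually_nhds_lt_re hx).mono hright
    have han : MatAnalyticAt Y₁ x := (hY₀ x hx).congr hev.symm
    ext i j
    rw [← hright x hx]
    have h1 : MeromorphicOn (fun y => Y₁ y i j) Set.univ := fun x _ => hmer₁ x i j
    change toMeromorphicNFOn (fun y => Y₁ y i j) Set.univ x = _
    rw [toMeromorphicNFOn_eq_toMeromorphicNFAt h1 (Set.mem_univ x),
      toMeromorphicNFAt_eq_self.2 (han i j).meromorphicNFAt]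

end Extension

end

noncomputable section

/-! ### Vitali's theorem on discs -/

section Vitali

variable {E : Type*} [NormedAddCommGroup E] [NormedSpace ℂ E] [CompleteSpace E]

omit [CompleteSpace E] in
theorem norm_cauchyPowerSeries_coeff_le {f : ℂ → E} {c : ℂ} {r : NNReal} {M : ℝ}
    (hM : ∀ z ∈ Metric.closedBall c r, ‖f z‖ ≤ M) (k : ℕ) :
    ‖(cauchyPowerSeries f c r).coeff k‖ ≤ M * (r : ℝ)⁻¹ ^ k := by
  have hM0 : 0 ≤ M := (norm_nonneg _).trans (hM c (by simp))
  refine ((cauchyPowerSeries f c r).norm_apply_eq_norm_coef.symm.le.trans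
    (norm_cauchyPowerSeries_le f c r k)).trans ?_
  rw [NNReal.abs_eq]
  gcongr
  have h1 : ‖∫ θ : ℝ in 0..2 * Real.pi, ‖f (circleMap c r θ)‖‖ ≤ M * |2 * Real.pi - 0| := by
    refine intervalIntegral.norm_integral_le_of_norm_le_const fun θ _ => ?_
    rw [norm_norm]
    exact hM _ (Metric.sphere_subset_closedBall (circleMap_mem_sphere c r.2 θ))
  rw [sub_zero, abs_of_pos Real.two_pi_pos] at h1
  have h2 := (le_abs_self _).trans h1
  rw [inv_mul_le_iff₀ Real.two_pi_pos]
  linarith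

/-- Taylor coefficients do not depend on the circle. Their limits are computed on the small one,
where the functions converge, and their bounds on the large one. -/
theorem cauchyPowerSeries_coeff_eq {f : ℂ → E} {c : ℂ} {ε r : NNReal} (hε : 0 < ε) (hεr : ε ≤ r)
    (hf : DifferentiableOn ℂ f (Metric.closedBall c r)) (k : ℕ) :
    (cauchyPowerSeries f c ε).coeff k = (cauchyPowerSeries f c r).coeff k := by
  have h1 := hf.hasFPowerSeriesOnBall (hε.trans_le hεr)
  have h2 := (hf.mono (Metric.closedBall_subset_closedBall hεr)).hasFPowerSeriesOnBall hε
  rw [h1.hasFPowerSeriesAt.eq_formalMultilinearSeries h2.hasFPowerSeriesAt]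

theorem hasSum_cauchyPowerSeries_coeff {f : ℂ → E} {c z : ℂ} {r : NNReal}
    (hf : DifferentiableOn ℂ f (Metric.closedBall c r)) (hz : z ∈ Metric.ball c r) :
    HasSum (fun k => (z - c) ^ k • (cauchyPowerSeries f c r).coeff k) (f z) := by
  have hr : 0 < r := by
    have : dist z c < r := hz
    exact_mod_cast dist_nonneg.trans_lt this
  have h1 := (hf.hasFPowerSeriesOnBall hr).hasSum (y := z - c) (by
    rw [Metric.eball_coe, mem_ball_zero_iff, ← dist_eq_norm]
    exact hz)
  rw [add_sub_cancel] at h1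
  refine HasSum.of_eq h1 fun k => ?_
  rw [FormalMultilinearSeries.apply_eq_pow_smul_coeff]

-- Cauchy's integrals for the coefficients converge by dominated convergence on the circle.
omit [CompleteSpace E] in
theorem exists_tendsto_cauchyPowerSeries_coeff {ι : Type*} {l : Filter ι} [l.IsCountablyGenerated]
    {f : ι → ℂ → E} {c : ℂ} {ε : NNReal} (hε : 0 < ε) {M : ℝ}
    (hd : ∀ᶠ h in l, DifferentiableOn ℂ (f h) (Metric.closedBall c ε))
    (hM : ∀ᶠ h in l, ∀ z ∈ Metric.closedBall c ε, ‖f h z‖ ≤ M)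
    (hlim : ∀ z ∈ Metric.closedBall c ε, ∃ w, Tendsto (fun h => f h z) l (𝓝 w)) (k : ℕ) :
    ∃ a, Tendsto (fun h => (cauchyPowerSeries (f h) c ε).coeff k) l (𝓝 a) := by
  choose! g hg using hlim
  have hmem : ∀ θ : ℝ, circleMap c ε θ ∈ Metric.closedBall c ε := fun θ =>
    Metric.sphere_subset_closedBall (circleMap_mem_sphere c ε.2 θ)
  set Φ : (ℂ → E) → ℝ → E := fun F θ => deriv (circleMap c ε) θ •
    ((1 / (circleMap c ε θ - c)) ^ k • (circleMap c ε θ - c)⁻¹ • F (circleMap c ε θ)) with hΦ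
  have hcoeff : ∀ h, (cauchyPowerSeries (f h) c ε).coeff k =
      (2 * Real.pi * Complex.I : ℂ)⁻¹ • ∫ θ in 0..2 * Real.pi, Φ (f h) θ := fun h =>
    cauchyPowerSeries_apply (f h) c ε k 1
  have h1 : Tendsto (fun h => ∫ θ in 0..2 * Real.pi, Φ (f h) θ) l
      (𝓝 (∫ θ in 0..2 * Real.pi, Φ g θ)) := by
    refine intervalIntegral.tendsto_integral_filter_of_dominated_convergence
      (fun _ => ε * ((1 / ε) ^ k * ((ε : ℝ)⁻¹ * M))) ?_ ?_ (by simp) ?_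
    · filter_upwards [hd] with h hh
      refine Continuous.aestronglyMeasurable ?_
      have hc : Continuous fun θ => f h (circleMap c ε θ) :=
        hh.continuousOn.comp_continuous (continuous_circleMap c ε) hmem
      have hne : ∀ θ, circleMap c ε θ - c ≠ 0 := fun θ =>
        sub_ne_zero.2 (circleMap_ne_center (by exact_mod_cast hε.ne'))
      simp only [hΦ, deriv_circleMap]
      have hcm := continuous_circleMap c ε
      have hcm0 := continuous_circleMap 0 ε
      have hinv : Continuous fun θ => (circleMap c ε θ - c)⁻¹ :=
        (hcm.sub continuous_const).inv₀ hne
      simp only [one_div]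
      exact (hcm0.mul continuous_const).smul ((hinv.pow k).smul (hinv.smul hc))
    · filter_upwards [hM] with h hh
      refine Eventually.of_forall fun θ _ => ?_
      have : ‖circleMap c ε θ - c‖ = ε := by
        rw [circleMap_sub_center, norm_circleMap_zero, NNReal.abs_eq]
      simp only [hΦ, norm_smul, norm_pow, norm_div, norm_inv, this, norm_one, deriv_circleMap,
        norm_mul, norm_circleMap_zero, Complex.norm_I, mul_one, NNReal.abs_eq]
      gcongr
      exact hh _ (hmem θ)
    · refine Eventually.of_forall fun θ _ => ?_
      exact (((hg _ (hmem θ)).const_smul _).const_smul _).const_smul _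
  refine ⟨_, (h1.const_smul (2 * Real.pi * Complex.I : ℂ)⁻¹).congr fun h => (hcoeff h).symm⟩

/-- **Vitali's theorem** on a disc. -/
theorem exists_tendstoUniformlyOn_closedBall {ι : Type*} {l : Filter ι} [l.IsCountablyGenerated]
    [l.NeBot] {f : ι → ℂ → E} {c : ℂ} {ε r : NNReal} (hε : 0 < ε) (hεr : ε ≤ r) {M s : ℝ}
    (hd : ∀ᶠ h in l, DifferentiableOn ℂ (f h) (Metric.closedBall c r))
    (hM : ∀ᶠ h in l, ∀ z ∈ Metric.closedBall c r, ‖f h z‖ ≤ M)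
    (hlim : ∀ z ∈ Metric.closedBall c ε, ∃ w, Tendsto (fun h => f h z) l (𝓝 w)) (hs : s < r) :
    ∃ g : ℂ → E, TendstoUniformlyOn f g l (Metric.closedBall c s) := by
  have hr : 0 < (r : ℝ) := by exact_mod_cast hε.trans_le hεr
  have hsub := Metric.closedBall_subset_closedBall (x := c) (show (ε : ℝ) ≤ r by exact_mod_cast hεr)
  choose a ha using exists_tendsto_cauchyPowerSeries_coeff hε (hd.mono fun h hh => hh.mono hsub)
    (hM.mono fun h hh z hz => hh z (hsub hz)) hlim
  set b : ι → ℕ → E := fun h k => (cauchyPowerSeries (f h) c ε).coeff k with hb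
  have hbM : ∀ᶠ h in l, ∀ k, ‖b h k‖ ≤ M * (r : ℝ)⁻¹ ^ k := by
    filter_upwards [hd, hM] with h h1 h2 k
    rw [hb]
    simp only
    rw [cauchyPowerSeries_coeff_eq hε hεr h1]
    exact norm_cauchyPowerSeries_coeff_le h2 k
  have haM : ∀ k, ‖a k‖ ≤ M * (r : ℝ)⁻¹ ^ k := fun k =>
    le_of_tendsto (ha k).norm (hbM.mono fun h hh => hh k)
  rcases lt_or_ge s 0 with hs0 | hs0
  · refine ⟨0, ?_⟩
    rw [Metric.closedBall_eq_empty.2 hs0]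
    exact tendstoUniformlyOn_empty
  have hM0 : 0 ≤ M := by
    obtain ⟨h, hh⟩ := hM.exists
    exact (norm_nonneg _).trans (hh c (by simp))
  have hgeom : Summable fun k : ℕ => M * (s / r) ^ k :=
    (summable_geometric_of_lt_one (by positivity) ((div_lt_one hr).2 hs)).mul_left M
  have hterm : ∀ {z : ℂ} {v : E} {k : ℕ}, z ∈ Metric.closedBall c s → ‖v‖ ≤ M * (r : ℝ)⁻¹ ^ k →
      ‖(z - c) ^ k • v‖ ≤ M * (s / r) ^ k := by
    intro z v k hz hv
    rw [mem_closedBall_iff_norm] at hz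
    rw [norm_smul, norm_pow]
    calc _ ≤ s ^ k * (M * (r : ℝ)⁻¹ ^ k) := by gcongr
      _ = _ := by rw [div_eq_mul_inv, mul_pow]; ring
  have hsa : ∀ z ∈ Metric.closedBall c s, Summable fun k => (z - c) ^ k • a k := fun z hz =>
    Summable.of_norm_bounded hgeom fun k => hterm hz (haM k)
  -- D dominates the distance to the limit uniformly on the disc of radius s. It tends to zero by
  -- dominated convergence, the majorant being geometric of ratio s/r < 1.
  set D : ι → ℝ := fun h => ∑' k, s ^ k * ‖b h k - a k‖ with hD
  have hbound : ∀ {v w : E} {k : ℕ}, ‖v‖ ≤ M * (r : ℝ)⁻¹ ^ k → ‖w‖ ≤ M * (r : ℝ)⁻¹ ^ k →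
      s ^ k * ‖v - w‖ ≤ 2 * (M * (s / r) ^ k) := by
    intro v w k hv hw
    calc _ ≤ s ^ k * (M * (r : ℝ)⁻¹ ^ k + M * (r : ℝ)⁻¹ ^ k) := by
          gcongr
          exact (norm_sub_le _ _).trans (add_le_add hv hw)
      _ = _ := by rw [div_eq_mul_inv, mul_pow]; ring
  have hDlim : Tendsto D l (𝓝 0) := by
    have h1 : Tendsto D l (𝓝 (∑' k : ℕ, (0 : ℝ))) := by
      refine tendsto_tsum_of_dominated_convergence (hgeom.mul_left 2) (fun k => ?_) ?_
      · have := ((ha k).sub_const (a k)).norm.const_mul (s ^ k)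
        simpa using this
      · filter_upwards [hbM] with h hh k
        rw [Real.norm_of_nonneg (by positivity)]
        exact hbound (hh k) (haM k)
    simpa using h1
  refine ⟨fun z => ∑' k, (z - c) ^ k • a k, ?_⟩
  rw [Metric.tendstoUniformlyOn_iff]
  intro δ hδ
  filter_upwards [hd, hbM, hDlim.eventually (gt_mem_nhds hδ)] with h h1 h2 h3 z hz
  rw [dist_comm, dist_eq_norm]
  have h4 : HasSum (fun k => (z - c) ^ k • b h k) (f h z) := by
    refine HasSum.of_eq (hasSum_cauchyPowerSeries_coeff h1
      (Metric.closedBall_subset_ball hs hz)) fun k => ?_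
    rw [← cauchyPowerSeries_coeff_eq hε hεr h1]
  have h5 : HasSum (fun k => (z - c) ^ k • (b h k - a k)) (f h z - ∑' k, (z - c) ^ k • a k) := by
    refine HasSum.of_eq (h4.sub (hsa z hz).hasSum) fun k => smul_sub _ _ _
  have h6 : Summable fun k => s ^ k * ‖b h k - a k‖ :=
    Summable.of_nonneg_of_le (fun k => by positivity) (fun k => hbound (h2 k) (haM k))
      (hgeom.mul_left 2)
  refine lt_of_le_of_lt ?_ h3
  rw [← h5.tsum_eq]
  refine tsum_of_norm_bounded h6.hasSum fun k => ?_
  rw [norm_smul, norm_pow]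
  rw [mem_closedBall_iff_norm] at hz
  gcongr

end Vitali

end

noncomputable section

/-! ### Confluence of difference equations -/

section Confluence

variable {𝔸 : Type*} [NormedRing 𝔸] [NormedAlgebra ℂ 𝔸] [CompleteSpace 𝔸]

/-- The solutions `Y h` of `Y(x - h) = B_h(x) Y(x)` on a domain `W` that is stable under
translations to the right; `(1 - B_h) / h` converges to `Q`, and the `Y h` converge on a right
half-plane. -/
structure ConfluentFamily (W : Set ℂ) (Q : ℂ → 𝔸) (B Y : ℝ → ℂ → 𝔸) (R : ℝ) : Prop where
  isOpen : IsOpen W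
  add_mem : ∀ x ∈ W, ∀ t : ℝ, 0 ≤ t → x + t ∈ W
  halfPlane_subset : ∀ x : ℂ, R < x.re → x ∈ W
  step : ∀ K ⊆ W, IsCompact K → ∀ᶠ h in 𝓝[>] (0 : ℝ), ∀ x ∈ K, AnalyticAt ℂ (Y h) x →
    AnalyticAt ℂ (Y h) (x - h) ∧ Y h (x - h) = B h x * Y h x
  tendsto_coeff : ∀ K ⊆ W, IsCompact K →
    TendstoUniformlyOn (fun (h : ℝ) x => (h : ℂ)⁻¹ • (1 - B h x)) Q (𝓝[>] 0) K
  continuousOn : ContinuousOn Q W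
  analyticAt_right : ∀ᶠ h in 𝓝[>] (0 : ℝ), ∀ x : ℂ, R < x.re → AnalyticAt ℂ (Y h) x
  bounded_right : ∀ K : Set ℂ, IsCompact K → (∀ x ∈ K, R < x.re) →
    ∃ M : ℝ, ∀ᶠ h in 𝓝[>] (0 : ℝ), ∀ x ∈ K, ‖Y h x‖ ≤ M
  tendsto_right : ∀ x : ℂ, R < x.re → ∃ v, Tendsto (fun h => Y h x) (𝓝[>] 0) (𝓝 v)

variable {W : Set ℂ} {Q : ℂ → 𝔸} {B Y : ℝ → ℂ → 𝔸} {R : ℝ}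

theorem tendsto_id_nhdsGT : Tendsto (fun h : ℝ => h) (𝓝[>] 0) (𝓝 0) := nhdsWithin_le_nhds

/-- The right translates of a compact set. -/
theorem isCompact_translates {K : Set ℂ} (hK : IsCompact K) (a b : ℝ) :
    IsCompact ((fun p : ℂ × ℝ => p.1 + p.2) '' (K ×ˢ Set.Icc a b)) :=
  (hK.prod isCompact_Icc).image (by fun_prop)

omit [CompleteSpace 𝔸] in
theorem norm_le_one_add_of_norm_smul_le {h q : ℝ} (hh : 0 < h) {b : 𝔸}
    (hb : ‖(h : ℂ)⁻¹ • (1 - b)‖ ≤ q) (v : 𝔸) : ‖b * v‖ ≤ (1 + h * q) * ‖v‖ := by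
  have h1 : b * v = v - (h : ℂ) • (((h : ℂ)⁻¹ • (1 - b)) * v) := by
    have : (h : ℂ) ≠ 0 := by exact_mod_cast hh.ne'
    rw [smul_mul_assoc, smul_smul, mul_inv_cancel₀ this, one_smul, sub_mul, one_mul,
      sub_sub_cancel]
  rw [h1]
  refine (norm_sub_le _ _).trans ?_
  rw [norm_smul, Complex.norm_of_nonneg hh.le]
  have := (norm_mul_le ((h : ℂ)⁻¹ • (1 - b)) v).trans
    (mul_le_mul_of_nonneg_right hb (norm_nonneg v))
  nlinarith

-- A discrete Grönwall inequality. About T/h steps of length h lead from x into the compact K' of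
-- the right half-plane, where a bound is known. Each step back multiplies the norm by at most 1 +
-- hq, and (1 + hq)^N ≤ e^{q(T+1)}. Holomorphy comes back along with the bound, since `step` applies
-- on all translates of K.
omit [CompleteSpace 𝔸] in
theorem ConfluentFamily.bounded (H : ConfluentFamily W Q B Y R) {K : Set ℂ} (hKW : K ⊆ W)
    (hK : IsCompact K) : ∃ M : ℝ, ∀ᶠ h in 𝓝[>] (0 : ℝ), ∀ x ∈ K,
      AnalyticAt ℂ (Y h) x ∧ ‖Y h x‖ ≤ M := by
  obtain ⟨ρ, hρ⟩ := hK.isBounded.exists_norm_le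
  set T : ℝ := max (R + 1 + ρ) 0 with hT
  have hT0 : 0 ≤ T := le_max_right _ _
  set L := (fun p : ℂ × ℝ => p.1 + p.2) '' (K ×ˢ Set.Icc 0 (T + 1)) with hL
  set K' := (fun p : ℂ × ℝ => p.1 + p.2) '' (K ×ˢ Set.Icc T (T + 1)) with hK'
  have hLc : IsCompact L := isCompact_translates hK _ _
  have hLW : L ⊆ W := by
    rintro _ ⟨⟨x, t⟩, ⟨hx, ht⟩, rfl⟩
    exact H.add_mem x (hKW hx) t ht.1
  have hK'R : ∀ x ∈ K', R < x.re := by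
    rintro _ ⟨⟨x, t⟩, ⟨hx, ht⟩, rfl⟩
    have h1 := (abs_le.1 ((Complex.abs_re_le_norm x).trans (hρ x hx))).1
    have h2 := (le_max_left (R + 1 + ρ) 0).trans ht.1
    simp only [Complex.add_re, Complex.ofReal_re]
    linarith
  obtain ⟨M, hM⟩ := H.bounded_right K' (isCompact_translates hK _ _) hK'R
  obtain ⟨q₀, hq₀⟩ := hLc.exists_bound_of_continuousOn (H.continuousOn.mono hLW)
  -- A bound on L for (1 - B h)/h: the one for Q plus the tolerance 1 of the uniform convergence.
  set q : ℝ := max q₀ 0 + 1 with hq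
  have hq0 : 0 ≤ q := by positivity
  refine ⟨Real.exp (q * (T + 1)) * max M 0, ?_⟩
  have hBq := Metric.tendstoUniformlyOn_iff.1 (H.tendsto_coeff L hLW hLc) 1 one_pos
  filter_upwards [hM, hBq, H.step L hLW hLc, H.analyticAt_right, self_mem_nhdsWithin,
    tendsto_id_nhdsGT.eventually (ge_mem_nhds one_pos)] with h h1 h2 h3 h4 h5 h6 x hx
  have hh : 0 < h := h5
  set N := ⌈T / h⌉₊ with hN
  have hN1 : T ≤ N * h := by
    have := Nat.le_ceil (T / h)
    rwa [div_le_iff₀ hh] at this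
  have hN2 : N * h ≤ T + 1 := by
    have := (Nat.ceil_lt_add_one (show 0 ≤ T / h by positivity)).le
    calc N * h ≤ (T / h + 1) * h := by gcongr
      _ = T + h := by field_simp
      _ ≤ _ := by linarith
  have hmem : ∀ k : ℕ, k ≤ N → x + (k * h : ℝ) ∈ L := fun k hk =>
    ⟨(x, k * h), ⟨hx, by positivity, (mul_le_mul_of_nonneg_right (by exact_mod_cast hk) hh.le).trans hN2⟩, rfl⟩
  have hmem' : x + (N * h : ℝ) ∈ K' := ⟨(x, N * h), ⟨hx, hN1, hN2⟩, rfl⟩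
  have key : ∀ j : ℕ, j ≤ N → AnalyticAt ℂ (Y h) (x + ((N - j : ℕ) * h : ℝ)) ∧
      ‖Y h (x + ((N - j : ℕ) * h : ℝ))‖ ≤ (1 + h * q) ^ j * max M 0 := by
    intro j
    induction j with
    | zero =>
      intro _
      rw [Nat.sub_zero, pow_zero, one_mul]
      exact ⟨h4 _ (hK'R _ hmem'), (h1 _ hmem').trans (le_max_left _ _)⟩
    | succ j ih =>
      intro hj
      obtain ⟨h7, h8⟩ := ih (by omega)
      set y := x + ((N - j : ℕ) * h : ℝ) with hy
      have hyL : y ∈ L := hmem _ (Nat.sub_le _ _)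
      have e : x + ((N - (j + 1) : ℕ) * h : ℝ) = y - h := by
        rw [hy, show N - j = (N - (j + 1)) + 1 by omega]
        push_cast
        ring
      obtain ⟨h9, h10⟩ := h3 y hyL h7
      rw [e]
      refine ⟨h9, ?_⟩
      rw [h10, pow_succ', mul_assoc]
      have h11 : ‖(h : ℂ)⁻¹ • (1 - B h y)‖ ≤ q := by
        have k1 := h2 y hyL
        rw [dist_comm, dist_eq_norm] at k1
        have k2 := (hq₀ y hyL).trans (le_max_left q₀ 0)
        have k3 := norm_le_insert' ((h : ℂ)⁻¹ • (1 - B h y)) (Q y)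
        linarith
      refine (norm_le_one_add_of_norm_smul_le hh h11 _).trans ?_
      gcongr
  have h12 := key N le_rfl
  rw [Nat.sub_self, Nat.cast_zero, zero_mul, Complex.ofReal_zero, add_zero] at h12
  refine ⟨h12.1, h12.2.trans ?_⟩
  gcongr
  calc (1 + h * q) ^ N ≤ Real.exp (h * q) ^ N := by
        gcongr
        linarith [Real.add_one_le_exp (h * q)]
    _ = Real.exp (q * (N * h)) := by rw [← Real.exp_nat_mul]; ring_nf
    _ ≤ _ := by gcongr

theorem ConfluentFamily.exists_disc (H : ConfluentFamily W Q B Y R) {c : ℂ} {r : NNReal}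
    (hr : Metric.closedBall c r ⊆ W) {ε : NNReal} (hε : 0 < ε) (hεr : ε ≤ r)
    (hlim : ∀ z ∈ Metric.closedBall c ε, ∃ w, Tendsto (fun h => Y h z) (𝓝[>] 0) (𝓝 w)) {s : ℝ}
    (hs : s < r) : ∃ g : ℂ → 𝔸, TendstoUniformlyOn Y g (𝓝[>] 0) (Metric.closedBall c s) := by
  obtain ⟨M, hM⟩ := H.bounded hr (isCompact_closedBall c r)
  exact exists_tendstoUniformlyOn_closedBall hε hεr
    (hM.mono fun h hh z hz => (hh z hz).1.differentiableAt.differentiableWithinAt)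
    (hM.mono fun h hh z hz => (hh z hz).2) hlim hs

/-- The points around which the family converges form an open set that contains the far end of the
half-line x + ℝ⁺. By Vitali's theorem it is closed relative to the half-line, so connectedness
brings it back to x. -/
theorem ConfluentFamily.exists_local (H : ConfluentFamily W Q B Y R) {x : ℂ} (hx : x ∈ W) :
    ∃ s : ℝ, 0 < s ∧ ∃ g : ℂ → 𝔸, TendstoUniformlyOn Y g (𝓝[>] 0) (Metric.closedBall x s) := by
  set G : Set ℂ := {y | ∃ s : ℝ, 0 < s ∧ ∀ z ∈ Metric.closedBall y s,
    ∃ w, Tendsto (fun h => Y h z) (𝓝[>] 0) (𝓝 w)} with hG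
  have hGo : IsOpen G := by
    rw [Metric.isOpen_iff]
    rintro y ⟨s, hs, hy⟩
    refine ⟨s / 2, by positivity, fun y' hy' => ⟨s / 2, by positivity, fun z hz => hy z ?_⟩⟩
    rw [Metric.mem_ball] at hy'
    rw [Metric.mem_closedBall] at hz ⊢
    linarith [dist_triangle z y' y]
  have hball : ∀ y ∈ W, y ∈ closure G → ∃ s : ℝ, 0 < s ∧ ∃ g : ℂ → 𝔸,
      TendstoUniformlyOn Y g (𝓝[>] 0) (Metric.closedBall y s) := by
    intro y hyW hy
    obtain ⟨ρ, hρ, hρW⟩ := Metric.isOpen_iff.1 H.isOpen y hyW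
    -- The disc of radius ρ/2 about c stays in W; convergence near c extends to radius ρ/4, and that
    -- disc contains the one of radius ρ/8 about y.
    obtain ⟨c, hcG, hc⟩ := Metric.mem_closure_iff.1 hy (ρ / 8) (by positivity)
    obtain ⟨ε, hε, hcε⟩ := hcG
    have hsub : Metric.closedBall c (ρ / 2) ⊆ W := by
      refine fun z hz => hρW ?_
      rw [Metric.mem_closedBall] at hz
      rw [Metric.mem_ball]
      linarith [dist_triangle z c y, dist_comm y c]
    obtain ⟨g, hg⟩ := H.exists_disc (r := ⟨ρ / 2, by positivity⟩)
      (ε := ⟨min ε (ρ / 2), by positivity⟩) (s := ρ / 4) hsub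
      (show (0 : ℝ) < min ε (ρ / 2) from lt_min hε (by positivity))
      (show min ε (ρ / 2) ≤ ρ / 2 from min_le_right _ _)
      (fun z hz => hcε z (Metric.closedBall_subset_closedBall (min_le_left _ _) hz))
      (show ρ / 4 < ρ / 2 by linarith)
    refine ⟨ρ / 8, by positivity, g, hg.mono fun z hz => ?_⟩
    rw [Metric.mem_closedBall] at hz ⊢
    linarith [dist_triangle z y c]
  have hseg : (fun t : ℝ => x + t) '' Set.Ici 0 ⊆ G := by
    refine ((isPreconnected_Ici).image _ (by fun_prop)).subset_of_closure_inter_subset hGo ?_ ?_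
    · refine ⟨x + (max (R + 2 - x.re) 0 : ℝ),
        ⟨_, Set.mem_Ici.2 (le_max_right _ _), rfl⟩, 1, one_pos,
        fun z hz => H.tendsto_right z ?_⟩
      rw [mem_closedBall_iff_norm] at hz
      have h1 := (abs_le.1 ((Complex.abs_re_le_norm _).trans hz)).1
      have h2 := le_max_left (R + 2 - x.re) 0
      simp only [Complex.sub_re, Complex.add_re, Complex.ofReal_re] at h1
      linarith
    · rintro _ ⟨hy, t, ht, rfl⟩
      obtain ⟨s, hs, g, hg⟩ := hball _ (H.add_mem x hx t ht) hy
      exact ⟨s, hs, fun z hz => ⟨g z, hg.tendsto_at hz⟩⟩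
  exact hball x hx (subset_closure (hseg ⟨0, Set.self_mem_Ici, by simp⟩))

/-- The solutions of the difference equations converge to a solution of the differential
equation. -/
theorem ConfluentFamily.exists_limit (H : ConfluentFamily W Q B Y R) :
    ∃ E : ℂ → 𝔸, (∀ x ∈ W, Tendsto (fun h => Y h x) (𝓝[>] 0) (𝓝 (E x))) ∧
      ∀ x ∈ W, HasDerivAt E (Q x * E x) x := by
  have hloc := fun x (hx : x ∈ W) => H.exists_local hx
  choose! s hs g hg using hloc
  have hlim : ∀ x ∈ W, Tendsto (fun h => Y h x) (𝓝[>] 0) (𝓝 (g x x)) := fun x hx =>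
    (hg x hx).tendsto_at (Metric.mem_closedBall_self (hs x hx).le)
  set E : ℂ → 𝔸 := fun x => g x x with hE
  have hunif : TendstoLocallyUniformlyOn Y E (𝓝[>] 0) W := by
    intro u hu x hx
    refine ⟨Metric.ball x (s x) ∩ W, ?_, ?_⟩
    · exact inter_mem (mem_nhdsWithin_of_mem_nhds (Metric.ball_mem_nhds x (hs x hx)))
        self_mem_nhdsWithin
    · filter_upwards [hg x hx u hu] with h hh y hy
      have e : E y = g x y := tendsto_nhds_unique (hlim y hy.2)
        ((hg x hx).tendsto_at (Metric.ball_subset_closedBall hy.1))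
      rw [e]
      exact hh y (Metric.ball_subset_closedBall hy.1)
  refine ⟨E, hlim, fun x hx => ?_⟩
  obtain ⟨ρ, hρ, hρW⟩ := Metric.isOpen_iff.1 H.isOpen x hx
  set U := Metric.ball x (ρ / 2) with hU
  have hUW : Metric.closedBall x (ρ / 2) ⊆ W :=
    (Metric.closedBall_subset_ball (by linarith)).trans hρW
  have hUo : IsOpen U := Metric.isOpen_ball
  have hu := hunif.mono (Metric.ball_subset_closedBall.trans hUW)
  obtain ⟨M, hM⟩ := H.bounded hUW (isCompact_closedBall x _)
  have hdiff : ∀ᶠ h in 𝓝[>] (0 : ℝ), DifferentiableOn ℂ (Y h) U := hM.mono fun h hh z hz =>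
    (hh z (Metric.ball_subset_closedBall hz)).1.differentiableAt.differentiableWithinAt
  have hEd := hu.differentiableOn hdiff hUo
  have hxU : x ∈ U := Metric.mem_ball_self (by positivity)
  have hderiv := hu.deriv hdiff hUo
  -- The quotient (Y h x - Y h (x - h))/h tends to the derivative of E, and by the difference
  -- equation it equals (1 - B h x)/h times Y h x, which tends to Q x * E x.
  suffices hsuff : deriv E x = Q x * E x by
    rw [← hsuff]
    exact (hEd.differentiableAt (hUo.mem_nhds hxU)).hasDerivAt
  have hcont : ContinuousAt (deriv E) x :=
    ((hEd.deriv hUo).differentiableAt (hUo.mem_nhds hxU)).continuousAt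
  have hquot : Tendsto (fun h : ℝ => (h : ℂ)⁻¹ • (Y h x - Y h (x - h))) (𝓝[>] 0)
      (𝓝 (deriv E x)) := by
    rw [Metric.tendsto_nhds]
    intro δ hδ
    obtain ⟨η, hη, hηc⟩ := Metric.continuousAt_iff.1 hcont (δ / 4) (by positivity)
    set κ := min (η / 2) (ρ / 4) with hκ
    have hκ0 : 0 < κ := by positivity
    have hκU : Metric.closedBall x κ ⊆ U := by
      refine Metric.closedBall_subset_ball ?_
      exact lt_of_le_of_lt (min_le_right _ _) (by linarith)
    have hdu := Metric.tendstoUniformlyOn_iff.1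
      ((tendstoLocallyUniformlyOn_iff_forall_isCompact hUo).1 hderiv _ hκU
        (isCompact_closedBall x κ)) (δ / 4) (by positivity)
    filter_upwards [hdu, hdiff, self_mem_nhdsWithin,
      tendsto_id_nhdsGT.eventually (ge_mem_nhds hκ0)] with h h1 h2 h3 h4
    have hh : 0 < h := h3
    have h5 : ∀ z ∈ Metric.closedBall x κ, HasDerivWithinAt
        (fun z => Y h z - z • deriv E x) (deriv (Y h) z - deriv E x) (Metric.closedBall x κ) z := by
      intro z hz
      have k1 := (h2.differentiableAt (hUo.mem_nhds (hκU hz))).hasDerivAt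
      have k2 := (hasDerivAt_id z).smul_const (deriv E x)
      rw [one_smul] at k2
      exact (k1.sub k2).hasDerivWithinAt
    have h6 : ∀ z ∈ Metric.closedBall x κ, ‖deriv (Y h) z - deriv E x‖ ≤ δ / 2 := by
      intro z hz
      have k1 := h1 z hz
      rw [Metric.mem_closedBall] at hz
      have k2 := hηc (lt_of_le_of_lt (hz.trans (min_le_left _ _)) (by linarith))
      rw [← dist_eq_norm]
      have k3 := dist_triangle (deriv (Y h) z) (deriv E z) (deriv E x)
      rw [dist_comm] at k1
      simp only [Function.comp_apply] at k1
      linarith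
    -- Mean value inequality for Y h z - z E'(x): its derivative is small near x because the
    -- derivatives of the Y h converge locally uniformly.
    have h7 := (convex_closedBall x κ).norm_image_sub_le_of_norm_hasDerivWithin_le h5 h6
      (x := x - h) (y := x) (by
        rw [mem_closedBall_iff_norm, sub_sub_cancel_left, norm_neg, Complex.norm_of_nonneg hh.le]
        exact h4) (Metric.mem_closedBall_self hκ0.le)
    have hhc : (h : ℂ) ≠ 0 := by exact_mod_cast hh.ne'
    have h8 : Y h x - x • deriv E x - (Y h (x - h) - (x - h) • deriv E x) =
        (h : ℂ) • ((h : ℂ)⁻¹ • (Y h x - Y h (x - h)) - deriv E x) := by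
      rw [smul_sub, smul_smul, mul_inv_cancel₀ hhc, one_smul, sub_smul]
      abel
    rw [h8, sub_sub_cancel, norm_smul, Complex.norm_of_nonneg hh.le, mul_comm] at h7
    rw [dist_eq_norm]
    have := le_of_mul_le_mul_right h7 hh
    linarith
  have hprod : Tendsto (fun h : ℝ => ((h : ℂ)⁻¹ • (1 - B h x)) * Y h x) (𝓝[>] 0)
      (𝓝 (Q x * E x)) :=
    ((H.tendsto_coeff {x} (by simpa using hx) isCompact_singleton).tendsto_at rfl).mul (hlim x hx)
  refine tendsto_nhds_unique hquot (hprod.congr' ?_)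
  filter_upwards [hM, H.step {x} (by simpa using hx) isCompact_singleton] with h h1 h2
  rw [(h2 x rfl (h1 x (Metric.mem_closedBall_self (by positivity))).1).2, smul_mul_assoc, sub_mul,
    one_mul]

end Confluence

end

noncomputable section

/-! ### Step matrices and canonical solutions -/

section Step

variable {n : ℕ}

theorem matMeromorphicAt_evalMat (A : RatMat n) (x : ℂ) : MatMeromorphicAt (evalMat A) x := by
  intro i j
  simp only [evalMat, Matrix.map_apply, RatFunc.eval, Polynomial.eval₂_id]
  exact ((Polynomial.differentiable _).analyticAt x).meromorphicAt.div
    ((Polynomial.differentiable _).analyticAt x).meromorphicAt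

theorem MatAnalyticAt.one_add_smul {Y : ℂ → CMat n} {u : ℂ → ℂ} {x : ℂ} (hY : MatAnalyticAt Y x)
    (hu : AnalyticAt ℂ u x) : MatAnalyticAt (fun y => 1 + u y • Y y) x := by
  intro i j
  simp only [Matrix.add_apply, Matrix.smul_apply, smul_eq_mul]
  exact analyticAt_const.add (hu.mul (hY i j))

theorem MatMeromorphicAt.one_add_smul {Y : ℂ → CMat n} {u : ℂ → ℂ} {x : ℂ}
    (hY : MatMeromorphicAt Y x) (hu : MeromorphicAt u x) :
    MatMeromorphicAt (fun y => 1 + u y • Y y) x := by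
  intro i j
  simp only [Matrix.add_apply, Matrix.smul_apply, smul_eq_mul]
  exact (MeromorphicAt.const _ _).add (hu.mul (hY i j))

/-- The matrix `C` such that `Z(x) = C(x) Z(x - h)`, for `Z(x) = Y(-x)` and `δ_{-h} Y = A Y`. -/
def minusMat (h : ℝ) (A : RatMat n) (x : ℂ) : CMat n := 1 + ((h : ℂ) / x) • evalMat A (h - x)

/-- The matrix `B` such that `Y(x - h) = B(x) Y(x)`, for the solutions of `δ_{-h} Y = A Y`, or for
their images by `x ↦ -x`. -/
def stepMat (plus : Bool) (h : ℝ) (A : RatMat n) (x : ℂ) : CMat n :=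
  if plus then 1 + (-((h : ℂ) / (x - h))) • evalMat A x else (minusMat h A x)⁻¹

theorem matMeromorphicAt_minusMat (h : ℝ) (A : RatMat n) (x : ℂ) :
    MatMeromorphicAt (minusMat h A) x := by
  refine MatMeromorphicAt.one_add_smul ?_ ?_
  · exact (matMeromorphicAt_evalMat A _).comp (g := fun y : ℂ => h - y) (by fun_prop)
  · exact (MeromorphicAt.const _ _).div (MeromorphicAt.id x)

theorem matMeromorphicAt_stepMat (plus : Bool) (h : ℝ) (A : RatMat n) (x : ℂ) :
    MatMeromorphicAt (stepMat plus h A) x := by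
  cases plus with
  | true =>
    refine MatMeromorphicAt.one_add_smul (matMeromorphicAt_evalMat A x) ?_
    exact ((MeromorphicAt.const _ _).div ((MeromorphicAt.id x).sub (MeromorphicAt.const _ _))).neg
  | false => exact (matMeromorphicAt_minusMat h A x).inv

theorem HasValueAtInfinity.unique {A : RatMat n} {A₀ A₁ : CMat n} (h₀ : HasValueAtInfinity A A₀)
    (h₁ : HasValueAtInfinity A A₁) : A₀ = A₁ := tendsto_nhds_unique h₀ h₁

/-- The determinant tends to 1 at infinity, so it does not vanish identically: off a discrete set,
the inverse used in `stepMat` is a true inverse. -/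
theorem eventually_det_minusMat_ne_zero (h : ℝ) {A : RatMat n} {A₀ : CMat n}
    (hA : HasValueAtInfinity A A₀) : ∀ᶠ x in codiscrete ℂ, (minusMat h A x).det ≠ 0 := by
  have h1 : Tendsto (minusMat h A) (Bornology.cobounded ℂ) (𝓝 (1 + (0 : ℂ) • A₀)) := by
    have k1 : Tendsto (fun x : ℂ => (h : ℂ) / x) (Bornology.cobounded ℂ) (𝓝 0) := by
      have := (tendsto_inv₀_cobounded (α := ℂ)).const_mul (h : ℂ)
      simpa [div_eq_mul_inv] using this
    have k2 : Tendsto (fun x : ℂ => (h : ℂ) - x) (Bornology.cobounded ℂ)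
        (Bornology.cobounded ℂ) := by
      rw [← tendsto_norm_atTop_iff_cobounded]
      refine tendsto_atTop_mono (f := fun x : ℂ => ‖x‖ - ‖(h : ℂ)‖) (fun x => ?_)
        (tendsto_atTop_add_const_right _ _ tendsto_norm_cobounded_atTop)
      rw [norm_sub_rev]
      exact norm_sub_norm_le _ _
    exact tendsto_const_nhds.add (k1.smul (hA.comp k2))
  rw [zero_smul, add_zero] at h1
  have h2 : Tendsto (fun x => (minusMat h A x).det) (Bornology.cobounded ℂ) (𝓝 1) := by
    have := ((Continuous.matrix_det continuous_id).tendsto (1 : CMat n)).comp h1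
    simpa [Function.comp_def] using this
  have h3 := h2.eventually_ne one_ne_zero
  rw [Filter.Eventually, Filter.HasBasis.mem_iff (Metric.hasBasis_cobounded_compl_closedBall 0)]
    at h3
  obtain ⟨r, -, hr⟩ := h3
  have h4 : ((|r| + 1 : ℝ) : ℂ) ∈ (Metric.closedBall (0 : ℂ) r)ᶜ := by
    rw [Set.mem_compl_iff, mem_closedBall_zero_iff, Complex.norm_of_nonneg (by positivity)]
    linarith [le_abs_self r]
  have h5 : ∀ᶠ x in 𝓝[≠] ((|r| + 1 : ℝ) : ℂ), (minusMat h A x).det ≠ 0 :=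
    nhdsWithin_le_nhds ((Metric.isClosed_closedBall.isOpen_compl.mem_nhds h4 |>
      Filter.mem_of_superset) hr)
  exact Meromorphic.eventually_codiscrete_ne_zero
    (fun x => (matMeromorphicAt_minusMat h A x).det) h5.frequently

/-- `Y` is the canonical solution at `+∞`, or the image by `x ↦ -x` of the canonical solution at
`-∞`. -/
def IsCanonical (plus : Bool) (h : ℝ) (A : RatMat n) (Y : ℂ → CMat n) : Prop :=
  MatNF Y ∧ (∀ᶠ x in codiscrete ℂ, Y (x - h) = stepMat plus h A x * Y x) ∧
    ∃ A₀, HasValueAtInfinity A A₀ ∧ HasCanonicalForm h A₀ Y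

theorem hDelta_eq_iff {h : ℝ} (hh : h ≠ 0) {x : ℂ} (hx : x ≠ h) (M : CMat n) (Y : ℂ → CMat n) :
    hDelta h Y x = M * Y x ↔ Y (x - h) = (1 + (-((h : ℂ) / (x - h))) • M) * Y x := by
  have h1 : (h : ℂ) ≠ 0 := by exact_mod_cast hh
  have h2 : x - h ≠ 0 := sub_ne_zero.2 hx
  have h3 : ((h : ℂ) / (x - h)) * ((x - h) / h) = 1 := by field_simp
  have h4 : ((x - h) / h) * ((h : ℂ) / (x - h)) = 1 := by field_simp
  rw [hDelta, add_mul, one_mul, smul_mul_assoc, neg_smul, ← sub_eq_add_neg]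
  constructor
  · intro he
    rw [← he, smul_smul, h3, one_smul, sub_sub_cancel]
  · intro he
    rw [he, sub_sub_cancel, smul_smul, h4, one_smul]

theorem eventually_codiscrete_ne (c : ℂ) : ∀ᶠ x in codiscrete ℂ, x ≠ c := by
  rw [eventually_codiscrete_iff]
  intro x
  by_cases hx : x = c
  · rw [hx]
    exact self_mem_nhdsWithin
  · exact nhdsWithin_le_nhds (isOpen_ne.mem_nhds hx)

theorem isCanonicalAtPlus_iff {h : ℝ} (hh : h ≠ 0) (A : RatMat n) (Y : ℂ → CMat n) :
    IsCanonicalAtPlus h A Y ↔ IsCanonical true h A Y := by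
  have h1 : (∀ᶠ x in codiscrete ℂ, hDelta h Y x = evalMat A x * Y x) ↔
      ∀ᶠ x in codiscrete ℂ, Y (x - h) = stepMat true h A x * Y x :=
    eventually_congr ((eventually_codiscrete_ne h).mono fun x hx => hDelta_eq_iff hh hx _ _)
  rw [IsCanonicalAtPlus, IsCanonical, IsMeromorphicSolution, h1, and_assoc]
  rfl

/-- Evaluated at h - x, the equation reads Z(x) = C(x) Z(x - h), with Z(x) = Y(-x) and C =
`minusMat`. Off the zeros of det C it can be solved for Z(x - h). -/
theorem isCanonicalAtMinus_iff {h : ℝ} (hh : h ≠ 0) (A : RatMat n) (Y : ℂ → CMat n) :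
    IsCanonicalAtMinus h A Y ↔ IsCanonical false h A fun x => Y (-x) := by
  have h1 : ∀ A₀, HasValueAtInfinity A A₀ →
      ((∀ᶠ x in codiscrete ℂ, hDelta h Y x = evalMat A x * Y x) ↔
      ∀ᶠ x : ℂ in codiscrete ℂ, Y (-(x - h)) = stepMat false h A x * Y (-x)) := by
    intro A₀ hA₀
    have k1 : (∀ᶠ x in codiscrete ℂ, hDelta h Y x = evalMat A x * Y x) ↔
        ∀ᶠ x : ℂ in codiscrete ℂ, hDelta h Y (h - x) = evalMat A (h - x) * Y (h - x) := by
      constructor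
      · intro H
        exact eventually_codiscrete_comp H (g := fun x : ℂ => h - x) (by fun_prop)
          (sub_right_injective)
      · intro H
        have := eventually_codiscrete_comp H (g := fun x : ℂ => h - x) (by fun_prop)
          (sub_right_injective)
        simpa using this
    rw [k1]
    refine eventually_congr ?_
    filter_upwards [eventually_codiscrete_ne 0, eventually_det_minusMat_ne_zero h hA₀] with x hx hd
    rw [hDelta_eq_iff hh (by simpa using hx)]
    have e1 : (h : ℂ) - x - h = -x := by ring
    have e2 : -(x - (h : ℂ)) = h - x := by ring
    rw [e1, e2, div_neg, neg_neg]
    change Y (-x) = minusMat h A x * Y (h - x) ↔ Y (h - x) = (minusMat h A x)⁻¹ * Y (-x)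
    have hu : IsUnit (minusMat h A x).det := isUnit_iff_ne_zero.2 hd
    constructor
    · intro he
      rw [he, Matrix.nonsing_inv_mul_cancel_left _ _ hu]
    · intro he
      rw [he, Matrix.mul_nonsing_inv_cancel_left _ _ hu]
  have h2 : MatNF Y ↔ MatNF fun x => Y (-x) :=
    ⟨fun H => H.comp_neg, fun H => by simpa using H.comp_neg⟩
  constructor
  · rintro ⟨⟨k1, k2⟩, A₀, k3, k4⟩
    exact ⟨h2.1 k1, (h1 A₀ k3).1 k2, A₀, k3, k4⟩
  · rintro ⟨k1, k2, A₀, k3, k4⟩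
    exact ⟨⟨h2.2 k1, (h1 A₀ k3).2 k2⟩, A₀, k3, k4⟩

end Step

/-! ### Data at infinity and the step matrices there -/

section Local

variable {n : ℕ}

attribute [local instance] Matrix.linftyOpNormedRing Matrix.linftyOpNormedAlgebra

theorem AnalyticAt.matAnalyticAt {Y : ℂ → CMat n} {x : ℂ} (hY : AnalyticAt ℂ Y x) :
    MatAnalyticAt Y x := fun i j =>
  ((LinearMap.toContinuousLinearMap (Matrix.entryLinearMap ℂ ℂ i j)).analyticAt (Y x)).comp hY

theorem MatAnalyticAt.analyticAt {Y : ℂ → CMat n} {x : ℂ} (hY : MatAnalyticAt Y x) :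
    AnalyticAt ℂ Y x := by
  have e : Y = fun x => ∑ i, ∑ j, Y x i j • Matrix.single i j (1 : ℂ) := by
    funext x
    conv_lhs => rw [Matrix.matrix_eq_sum_single (Y x)]
    simp [Matrix.smul_single]
  rw [e]
  exact Finset.analyticAt_fun_sum _ fun i _ => Finset.analyticAt_fun_sum _ fun j _ =>
    (hY i j).smul analyticAt_const

/-- Near `+∞`, or near `-∞` after `x ↦ -x`, the `A h` are series of factorials of a common type with
convergent coefficients. -/
structure LocalData (plus : Bool) (A : ℝ → RatMat n) (a : ℝ → ℕ → CMat n) (a₀ : ℕ → CMat n)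
    (C lam : ℝ) : Prop where
  one_le : 1 ≤ lam
  typed : ∀ᶠ h in 𝓝[>] (0 : ℝ), IsTyped h C lam (a h)
  tendsto : ∀ s, Tendsto (fun h => a h s) (𝓝[>] 0) (𝓝 (a₀ s))
  eval_eq : ∀ᶠ h in 𝓝[>] (0 : ℝ), ∀ x : ℂ, lam + 3 < x.re →
    facSum h (a h) x = evalMat (A h) (if plus then x else -x)
  jordan : ∀ᶠ h in 𝓝[>] (0 : ℝ), ∃ S J, IsJordanReduction (a h 0) S J
  value : ∀ᶠ h in 𝓝[>] (0 : ℝ), HasValueAtInfinity (A h) (a h 0)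
  nonres : ∀ m : ℕ, 1 ≤ m → ∀ X : CMat n, (m : ℂ) • X + (a₀ 0 * X - X * a₀ 0) = 0 → X = 0

variable {plus : Bool} {A : ℝ → RatMat n} {a : ℝ → ℕ → CMat n} {a₀ : ℕ → CMat n} {C lam : ℝ}

theorem eventually_pos_le_one : ∀ᶠ h in 𝓝[>] (0 : ℝ), 0 < h ∧ h ≤ 1 := by
  filter_upwards [self_mem_nhdsWithin, nhdsWithin_le_nhds (Iic_mem_nhds one_pos)] with h h1 h2
  exact ⟨h1, h2⟩

theorem isOpen_lt_re (R : ℝ) : IsOpen {x : ℂ | R < x.re} :=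
  isOpen_lt continuous_const Complex.continuous_re

theorem matAnalyticAt_facSum {c : ℕ → CMat n} {h : ℝ} (hc : IsTyped h C lam c) (hh : 0 ≤ h)
    (h1 : h ≤ 1) (hl : 1 ≤ lam) {x : ℂ} (hx : lam + 3 < x.re) : MatAnalyticAt (facSum h c) x :=
  ((differentiableOn_facSum hc hh h1 hl).analyticAt
    ((isOpen_lt_re _).mem_nhds hx)).matAnalyticAt

/-- The step matrices near infinity. -/
theorem LocalData.eventually_step (L : LocalData plus A a a₀ C lam) :
    ∀ᶠ h in 𝓝[>] (0 : ℝ), ∀ x : ℂ, lam + 5 < x.re →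
      MatAnalyticAt (stepMat plus h (A h)) x ∧ ∀ F : ℂ → CMat n, IsGauge plus h (a h) F x ↔
        F (x - h) * (1 - ((h : ℂ) / (x - h)) • a h 0) = stepMat plus h (A h) x * F x := by
  have hl := L.one_le
  have hb : ∀ᶠ h in 𝓝[>] (0 : ℝ), ‖a h 0‖ ≤ ‖a₀ 0‖ + 1 :=
    (L.tendsto 0).norm.eventually (ge_mem_nhds (by linarith))
  -- Keeps h a(x - h)/x below 1 in norm, so that `minusMat` is invertible by a Neumann series.
  have hs : ∀ᶠ h in 𝓝[>] (0 : ℝ), h * (‖a₀ 0‖ + 1 + C) < 1 := by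
    have := tendsto_id_nhdsGT.mul_const (‖a₀ 0‖ + 1 + C)
    rw [zero_mul] at this
    exact this.eventually (gt_mem_nhds one_pos)
  filter_upwards [L.typed, L.eval_eq, eventually_pos_le_one, hb, hs] with h h1 h2 h3 h4 h5 x hx
  have hre : (x - h).re = x.re - h := by simp
  have hx0 : x - h ≠ 0 := fun h0 => by
    have : (x - h).re = 0 := by rw [h0]; rfl
    linarith
  have hxn : x ≠ 0 := fun h0 => by
    have : x.re = 0 := by rw [h0]; rfl
    linarith
  have hev : ∀ y : ℂ, lam + 3 < y.re → (fun y => facSum h (a h) y) =ᶠ[𝓝 y]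
      fun y => evalMat (A h) (if plus then y else -y) := fun y hy =>
    (eventually_nhds_lt_re hy).mono fun z hz => h2 z hz
  cases plus with
  | true =>
    constructor
    · refine MatAnalyticAt.one_add_smul ((matAnalyticAt_facSum h1 h3.1.le h3.2 hl
        (by linarith)).congr (hev x (by linarith))) ?_
      exact ((analyticAt_const).div (analyticAt_id.sub analyticAt_const) hx0).neg
    · intro F
      have e : stepMat true h (A h) x = 1 - ((h : ℂ) / (x - h)) • facSum h (a h) x := by
        rw [h2 x (by linarith), stepMat, neg_smul, ← sub_eq_add_neg]
        rfl
      rw [e]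
      exact Iff.rfl
  | false =>
    have e1 : evalMat (A h) (h - x) = facSum h (a h) (x - h) := by
      rw [h2 (x - h) (by rw [hre]; linarith)]
      simp
    have hC : 0 ≤ C := h1.nonneg
    have e2 : minusMat h (A h) x = 1 - (-((h : ℂ) / x)) • facSum h (a h) (x - h) := by
      rw [minusMat, e1, neg_smul, sub_neg_eq_add]
    have hn : ‖facSum h (a h) (x - h)‖ ≤ ‖a₀ 0‖ + 1 + C := by
      have k1 := h1.norm_facSum_sub_le h3.1.le (by linarith) (x := x - h) (by rw [hre]; linarith)
      have k2 : C / ((x - h).re - lam) ≤ C := div_le_self hC (by rw [hre]; linarith)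
      have k3 := norm_le_insert' (facSum h (a h) (x - h)) (a h 0)
      linarith
    have hu : IsUnit (minusMat h (A h) x).det := by
      rw [← Matrix.isUnit_iff_isUnit_det, e2]
      refine isUnit_one_sub_of_norm_lt_one ?_
      rw [norm_smul, norm_neg, norm_div, Complex.norm_of_nonneg h3.1.le]
      have k1 : 1 ≤ ‖x‖ := by linarith [(le_abs_self _).trans (Complex.abs_re_le_norm x)]
      calc h / ‖x‖ * ‖facSum h (a h) (x - h)‖ ≤ h * (‖a₀ 0‖ + 1 + C) :=
            mul_le_mul (div_le_self h3.1.le k1) hn (norm_nonneg _) h3.1.le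
        _ < 1 := h5
    constructor
    · refine MatAnalyticAt.inv (Y := minusMat h (A h)) ?_ hu.ne_zero
      refine MatAnalyticAt.one_add_smul (Y := fun y => evalMat (A h) (h - y)) ?_
        (analyticAt_const.div analyticAt_id hxn)
      have k1 : MatAnalyticAt (fun y => evalMat (A h) (if false = true then y else -y)) (x - h) :=
        (matAnalyticAt_facSum h1 h3.1.le h3.2 hl (by rw [hre]; linarith)).congr
          (hev (x - h) (by rw [hre]; linarith))
      have k2 := k1.comp (x := x) (g := fun y : ℂ => y - h) (by fun_prop)
      simpa using k2
    · intro F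
      have e3 : stepMat false h (A h) x = (minusMat h (A h) x)⁻¹ := rfl
      change F x = (1 + ((h : ℂ) / x) • facSum h (a h) (x - h)) * F (x - h) *
        (1 - ((h : ℂ) / (x - h)) • a h 0) ↔ _
      rw [e3, ← e1, mul_assoc]
      change F x = minusMat h (A h) x * _ ↔ _
      constructor
      · intro he
        rw [he, Matrix.nonsing_inv_mul_cancel_left _ _ hu]
      · intro he
        rw [he, Matrix.mul_nonsing_inv_cancel_left _ _ hu]

end Local

end

noncomputable section

/-! ### Canonical solutions on a right half-plane -/

section Local

variable {n : ℕ}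

attribute [local instance] Matrix.linftyOpNormedRing Matrix.linftyOpNormedAlgebra

variable {plus : Bool} {A : ℝ → RatMat n} {a : ℝ → ℕ → CMat n} {a₀ : ℕ → CMat n} {C lam : ℝ}

theorem IsJordanReduction.matAnalyticAt_matChar {h : ℝ} (hh : 0 < h) {A S J : CMat n}
    (hA : IsJordanReduction A S J) {x : ℂ} (hx : 0 < x.re) : MatAnalyticAt (matChar h A) x := by
  intro i j
  have hd : DifferentiableOn ℂ (fun x => matChar h A x i j) {x | 0 < x.re} := fun y hy =>
    (hA.differentiableAt_matChar hh hy i j).differentiableWithinAt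
  exact hd.analyticAt ((isOpen_lt_re 0).mem_nhds hx)

/-- The canonical form of a solution, in terms of typed coefficients. -/
theorem HasCanonicalForm.exists_coeff {h : ℝ} (hh : 0 < h) {A₀ : CMat n} {Y : ℂ → CMat n}
    (hY : HasCanonicalForm h A₀ Y) : ∃ (c : ℕ → CMat n) (C lam R : ℝ), c 0 = 1 ∧ 1 ≤ lam ∧
      IsTyped h C lam c ∧ ∀ x : ℂ, R < x.re → Y x = facSum h c x * matChar h A₀ x := by
  obtain ⟨S, J, c, F, hJ, hc0, ⟨R₁, hF⟩, R₂, hYF⟩ := hY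
  have hs : Summable (facTerm h c ((max 1 (R₁ + 1) : ℝ) : ℂ)) :=
    (hF _ (by
      rw [Complex.ofReal_re]
      linarith [le_max_right 1 (R₁ + 1)])).summable
  obtain ⟨C, lam, hl, hc⟩ := exists_isTyped_of_summable hh.le (le_max_left _ _) hs
  refine ⟨c, C, lam, max R₁ R₂, hc0, hl, hc, fun x hx => ?_⟩
  rw [hYF x ((le_max_right _ _).trans_lt hx), hJ.conj_jordanSolution hh]
  congr 1
  exact (hF x ((le_max_left _ _).trans_lt hx)).tsum_eq.symm

theorem exists_forall_mul_re_lt (h : ℝ) (J : CMat n) : ∃ R : ℝ, ∀ i, h * (J i i).re < R := by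
  obtain ⟨R, hR⟩ := (Set.finite_range fun i => h * (J i i).re).bddAbove
  exact ⟨R + 1, fun i => lt_of_le_of_lt (hR ⟨i, rfl⟩) (by linarith)⟩

/-- The limits of the canonical solutions on a right half-plane. -/
structure RightLimit (Y : ℝ → ℂ → CMat n) (c₀ : ℕ → CMat n) (At₀ : CMat n) (R : ℝ) : Prop where
  analyticAt : ∀ᶠ h in 𝓝[>] (0 : ℝ), ∀ x : ℂ, R < x.re → AnalyticAt ℂ (Y h) x
  bounded : ∀ K : Set ℂ, IsCompact K → (∀ x ∈ K, R < x.re) →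
    ∃ M : ℝ, ∀ᶠ h in 𝓝[>] (0 : ℝ), ∀ x ∈ K, ‖Y h x‖ ≤ M
  coeff_zero : c₀ 0 = 1
  summable : ∀ x : ℂ, R < x.re → Summable fun s => (x⁻¹) ^ s • c₀ s
  tendsto : ∀ x : ℂ, R < x.re → Tendsto (fun h => Y h x) (𝓝[>] 0)
    (𝓝 ((∑' s, (x⁻¹) ^ s • c₀ s) * NormedSpace.exp (Complex.log x • At₀)))

/-- Existence, uniqueness, and convergence on a right half-plane of the canonical solutions. -/
theorem LocalData.exists_canonical (L : LocalData plus A a a₀ C lam) :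
    ∃ (Y : ℝ → ℂ → CMat n) (c₀ : ℕ → CMat n) (R : ℝ),
      (∀ᶠ h in 𝓝[>] (0 : ℝ), IsCanonical plus h (A h) (Y h) ∧
        ∀ Y', IsCanonical plus h (A h) Y' → Y' = Y h) ∧ RightLimit Y c₀ (a₀ 0) R := by
  obtain ⟨c, c₀, M, mu, hmu, hc₀, hclim, hc⟩ := exists_gauge_family plus L.one_le L.typed L.tendsto
    L.nonres
  have hmu1 : 1 ≤ mu := L.one_le.trans hmu
  set R : ℝ := mu + 5 with hR
  have hex : ∀ᶠ h in 𝓝[>] (0 : ℝ), ∃ Y, (IsCanonical plus h (A h) Y ∧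
      ∀ Y', IsCanonical plus h (A h) Y' → Y' = Y) ∧
      ∀ x : ℂ, R < x.re → MatAnalyticAt Y x ∧ Y x = facSum h (c h) x * matChar h (a h 0) x := by
    filter_upwards [hc, L.eventually_step, L.jordan, L.value] with h h1 h2 h3 h4
    obtain ⟨hh, hh1, hc0, hct, hg, hcu⟩ := h1
    obtain ⟨S, J, hJ⟩ := h3
    set Y₀ : ℂ → CMat n := fun x => facSum h (c h) x * matChar h (a h 0) x with hY₀
    have hY₀a : ∀ x : ℂ, R < x.re → MatAnalyticAt Y₀ x := fun x hx =>
      (matAnalyticAt_facSum hct hh.le hh1 hmu1 (by linarith)).mul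
        (hJ.matAnalyticAt_matChar hh (by linarith))
    -- The factor 1 - h a_0/(x - h) produced by `matChar_sub` is the one in the gauge relation, so
    -- the two combine into the equation of step h.
    have hY₀e : ∀ x : ℂ, R + h < x.re → Y₀ (x - h) = stepMat plus h (A h) x * Y₀ x := by
      intro x hx
      have k1 := ((h2 x (by linarith)).2 _).1 (hg x (by linarith))
      simp only [hY₀]
      rw [matChar_sub hh _ (by linarith), ← mul_assoc, k1, mul_assoc]
    obtain ⟨Y, hYn, hYe, hYr⟩ := exists_matNF_extension hh
      (fun x => matMeromorphicAt_stepMat plus h (A h) x) hY₀a hY₀e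
    have hYa : ∀ x : ℂ, R < x.re → MatAnalyticAt Y x := fun x hx =>
      (hY₀a x hx).congr ((eventually_nhds_lt_re hx).mono fun y hy => (hYr y hy).symm)
    refine ⟨Y, ⟨⟨hYn, hYe, a h 0, h4, S, J, c h, facSum h (c h), hJ, hc0, ⟨mu, fun x hx =>
      hct.hasSum hh.le (by linarith) hx⟩, R, fun x hx => ?_⟩, ?_⟩, fun x hx => ⟨hYa x hx,
        hYr x hx⟩⟩
    · rw [hYr x hx, hJ.conj_jordanSolution hh]
    -- Uniqueness: far to the right, `matChar` is invertible and can be cancelled in the equation of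
    -- Y', which leaves a gauge relation for its factorial series. The coefficients are then those
    -- of `c h`, and the identity theorem gives Y' = Y.
    · rintro Y' ⟨hn, he, A₀, hA₀, hform⟩
      rw [hA₀.unique h4] at hform
      obtain ⟨c', C', lam', R', hc'0, hl', hc't, hY'⟩ := hform.exists_coeff hh
      obtain ⟨R₁, hR₁⟩ := exists_forall_mul_re_lt h J
      set R₂ : ℝ := max (max R R') (max (lam' + 3) R₁) + 1 with hR₂
      have hb1 : R + 1 ≤ R₂ := by
        linarith [(le_max_left R R').trans (le_max_left _ (max (lam' + 3) R₁))]
      have hb2 : R' + 1 ≤ R₂ := by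
        linarith [(le_max_right R R').trans (le_max_left _ (max (lam' + 3) R₁))]
      have hb3 : lam' + 3 + 1 ≤ R₂ := by
        linarith [(le_max_left (lam' + 3) R₁).trans (le_max_right (max R R') _)]
      have hb4 : R₁ + 1 ≤ R₂ := by
        linarith [(le_max_right (lam' + 3) R₁).trans (le_max_right (max R R') _)]
      have hgauge : ∀ x : ℂ, R₂ < x.re → IsGauge plus h (a h) (facSum h c') x := by
        intro x hx
        obtain ⟨k1, k2⟩ := h2 x (by linarith)
        rw [k2]
        have hY'a : MatAnalyticAt Y' x :=
          ((matAnalyticAt_facSum hc't hh.le hh1 hl' (by linarith)).mul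
            (hJ.matAnalyticAt_matChar hh (by linarith))).congr
            ((eventually_nhds_lt_re (show R' < x.re by linarith)).mono fun y hy => (hY' y hy).symm)
        have k3 := (MatNF.step hn he k1 hY'a).2
        rw [hY' x (by linarith), hY' (x - h) (by simp; linarith), matChar_sub hh _ (by linarith),
          ← mul_assoc, ← mul_assoc] at k3
        have hu := hJ.isUnit_det_matChar hh (x := x) (by linarith)
          (fun i => (hR₁ i).trans (by linarith))
        have k4 := congrArg (fun X => X * (matChar h (a h 0) x)⁻¹) k3
        simpa only [Matrix.mul_nonsing_inv_cancel_right _ _ hu] using k4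
      have hcc := hcu c' hc'0 ⟨C', lam', hl', hc't⟩ ⟨R₂, hgauge⟩
      refine hn.eq_of_eventuallyEq (x₀ := ((R₂ + 1 : ℝ) : ℂ)) hYn (nhdsWithin_le_nhds ?_)
      refine (eventually_nhds_lt_re (show R₂ < ((R₂ + 1 : ℝ) : ℂ).re by simp)).mono fun y hy => ?_
      rw [hY' y (by linarith), hYr y (by linarith), hcc]
  obtain ⟨Y, hY⟩ := hex.choice
  refine ⟨Y, c₀, R, hY.mono fun h hh => hh.1, ?_, ?_, hc₀, fun x hx => ?_, fun x hx => ?_⟩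
  · exact hY.mono fun h hh x hx => (hh.2 x hx).1.analyticAt
  · intro K hK hKR
    obtain ⟨M', hM'⟩ := eventually_norm_matChar_le (L.tendsto 0) hK
      (fun x hx => by linarith [hKR x hx])
    refine ⟨(‖(1 : CMat n)‖ + M) * M', ?_⟩
    filter_upwards [hY, hc, hM'] with h h1 h2 h3 x hx
    obtain ⟨hh, hh1, hc0, hct, -⟩ := h2
    have hx' := hKR x hx
    rw [(h1.2 x hx').2]
    have hM0 : 0 ≤ M := hct.nonneg
    have k1 := hct.norm_facSum_sub_le hh.le (by linarith) (x := x) (by linarith)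
    have k2 : M / (x.re - mu) ≤ M := div_le_self hM0 (by linarith)
    have k3 := norm_le_insert' (facSum h (c h) x) (c h 0)
    rw [hc0] at k1 k3
    exact (norm_mul_le _ _).trans (mul_le_mul (by linarith) (h3 x hx) (norm_nonneg _)
      (by positivity))
  · exact (tendsto_facSum hmu1 (hc.mono fun h hh => hh.2.2.2.1) hclim (by linarith)).1
  · refine (((tendsto_facSum hmu1 (hc.mono fun h hh => hh.2.2.2.1) hclim (x := x)
      (by linarith)).2.mul (tendsto_matChar (L.tendsto 0) (x := x) (by linarith))).congr' ?_)
    filter_upwards [hY] with h h1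
    exact (h1.2 x hx).2.symm

end Local

end

noncomputable section

/-! ### Convergence of the step matrices on compact sets -/

section Confluent

variable {n : ℕ}

attribute [local instance] Matrix.linftyOpNormedRing Matrix.linftyOpNormedAlgebra

theorem norm_le_of_forall_entry_le {M : CMat n} {ε : ℝ} (hε : 0 ≤ ε)
    (hM : ∀ i j, ‖M i j‖ ≤ ε) : ‖M‖ ≤ n * ε := by
  have h1 : ‖M‖ = ((Finset.univ.sup fun i => ∑ j, ‖M i j‖₊ : NNReal) : ℝ) :=
    Matrix.linfty_opNorm_def M
  rw [h1, ← Real.coe_toNNReal (n * ε) (by positivity), NNReal.coe_le_coe]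
  refine Finset.sup_le fun i _ => ?_
  rw [← NNReal.coe_le_coe, Real.coe_toNNReal _ (by positivity)]
  push_cast
  calc ∑ j, ‖M i j‖ ≤ ∑ _j : Fin n, ε := Finset.sum_le_sum fun j _ => hM i j
    _ = _ := by simp

theorem matAnalyticAt_evalMat {A : RatMat n} {x : ℂ} (hx : x ∉ poleSet A) :
    MatAnalyticAt (evalMat A) x := by
  intro i j
  simp only [evalMat, Matrix.map_apply, RatFunc.eval, Polynomial.eval₂_id]
  refine ((Polynomial.differentiable _).analyticAt x).div
    ((Polynomial.differentiable _).analyticAt x) fun h0 => hx ⟨i, j, h0⟩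

theorem continuousOn_evalMat {A : RatMat n} {K : Set ℂ} (hK : Disjoint (poleSet A) K) :
    ContinuousOn (evalMat A) K := fun _ hx =>
  (matAnalyticAt_evalMat (hK.notMem_of_mem_right hx)).analyticAt.continuousAt.continuousWithinAt

theorem ConvergesUniformlyOn.tendstoUniformlyOn {A : ℝ → RatMat n} {At : RatMat n} {K : Set ℂ}
    (H : ConvergesUniformlyOn A At K) :
    TendstoUniformlyOn (fun h x => evalMat (A h) x) (evalMat At) (𝓝[>] 0) K := by
  refine Metric.tendstoUniformlyOn_iff.2 ?_
  intro ε hε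
  have h1 : ∀ i j, ∀ᶠ h in 𝓝[>] (0 : ℝ), ∀ x ∈ K,
      dist (evalMat At x i j) (evalMat (A h) x i j) < ε / (n + 1) := fun i j =>
    Metric.tendstoUniformlyOn_iff.1 (H.2 i j) _ (by positivity)
  filter_upwards [eventually_all.2 fun i => eventually_all.2 (h1 i)] with h hh x hx
  rw [dist_eq_norm]
  have h2 : ‖evalMat At x - evalMat (A h) x‖ ≤ n * (ε / (n + 1)) :=
    norm_le_of_forall_entry_le (by positivity) fun i j => by
      have := (hh i j x hx).le
      rwa [dist_eq_norm] at this
  refine h2.trans_lt ?_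
  rw [mul_div_assoc', div_lt_iff₀ (by positivity)]
  nlinarith

/-- The limit of `(1 - B_h) / h`. -/
def limitCoeff (plus : Bool) (At : RatMat n) (x : ℂ) : CMat n :=
  x⁻¹ • evalMat At (if plus then x else -x)

theorem exists_pos_le_norm {K : Set ℂ} (hK : IsCompact K) (h0 : (0 : ℂ) ∉ K) :
    ∃ δ : ℝ, 0 < δ ∧ ∀ x ∈ K, δ ≤ ‖x‖ := by
  obtain ⟨δ, hδ, hd⟩ := Metric.isOpen_iff.1 hK.isClosed.isOpen_compl 0 h0
  refine ⟨δ, hδ, fun x hx => not_lt.1 fun h => hd (mem_ball_zero_iff.2 h) hx⟩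

/-- The matrices of the difference equations, in the plus case. -/
theorem tendstoUniformlyOn_plus {A : ℝ → RatMat n} {At : RatMat n} {K : Set ℂ} (hK : IsCompact K)
    (h0 : (0 : ℂ) ∉ K) (hAt : Disjoint (poleSet At) K) (H : ConvergesUniformlyOn A At K) :
    (∀ᶠ h in 𝓝[>] (0 : ℝ), ∀ x ∈ K, MatAnalyticAt (stepMat true h (A h)) x) ∧
    TendstoUniformlyOn (fun (h : ℝ) x => (h : ℂ)⁻¹ • (1 - stepMat true h (A h) x))
      (limitCoeff true At) (𝓝[>] 0) K := by
  obtain ⟨δ, hδ, hKδ⟩ := exists_pos_le_norm hK h0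
  have hsmall : ∀ᶠ h in 𝓝[>] (0 : ℝ), h < δ / 2 :=
    tendsto_id_nhdsGT.eventually (gt_mem_nhds (by positivity))
  have hxh : ∀ h : ℝ, 0 < h → h < δ / 2 → ∀ x ∈ K, δ / 2 ≤ ‖x - h‖ := by
    intro h hh hd x hx
    have := norm_sub_norm_le x h
    rw [Complex.norm_of_nonneg hh.le] at this
    linarith [hKδ x hx]
  constructor
  · filter_upwards [H.1, hsmall, self_mem_nhdsWithin] with h h1 h2 h3 x hx
    refine (matAnalyticAt_evalMat (h1.notMem_of_mem_right hx)).one_add_smul ?_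
    refine (analyticAt_const.div (analyticAt_id.sub analyticAt_const) fun h4 => ?_).neg
    have h5 := hxh h h3 h2 x hx
    rw [show x - (h : ℂ) = 0 from h4, norm_zero] at h5
    linarith
  · obtain ⟨M, hM⟩ := hK.exists_bound_of_continuousOn (continuousOn_evalMat hAt)
    refine Metric.tendstoUniformlyOn_iff.2 ?_
    intro ε hε
    have hlim : Tendsto (fun h : ℝ => h * ((2 / δ) * (1 / δ) * max M 0)) (𝓝[>] 0) (𝓝 0) := by
      simpa using tendsto_id_nhdsGT.mul_const ((2 / δ) * (1 / δ) * max M 0)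
    filter_upwards [hsmall, self_mem_nhdsWithin, Metric.tendstoUniformlyOn_iff.1
      H.tendstoUniformlyOn (ε * δ / 4) (by positivity),
      hlim.eventually (gt_mem_nhds (half_pos hε))] with h h1 h2 h3 h4 x hx
    have hh : 0 < h := h2
    have hhc : (h : ℂ) ≠ 0 := by exact_mod_cast hh.ne'
    have k1 := hxh h hh h1 x hx
    have k2 := hKδ x hx
    have hx0 : x ≠ 0 := norm_pos_iff.1 (hδ.trans_le k2)
    have hxh0 : x - h ≠ 0 := norm_pos_iff.1 ((half_pos hδ).trans_le k1)
    -- Splits the error into the contributions of A h - At and of 1/(x - h) - 1/x.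
    have e : (h : ℂ)⁻¹ • (1 - stepMat true h (A h) x) - limitCoeff true At x =
        (x - h)⁻¹ • (evalMat (A h) x - evalMat At x) +
          ((h : ℂ) * ((x - h)⁻¹ * x⁻¹)) • evalMat At x := by
      have e1 : stepMat true h (A h) x = 1 + (-((h : ℂ) / (x - h))) • evalMat (A h) x := rfl
      have e2 : limitCoeff true At x = x⁻¹ • evalMat At x := rfl
      rw [e1, e2, sub_add_cancel_left, smul_neg, smul_smul, ← neg_smul, smul_sub,
        sub_add, ← sub_smul]
      congr 2
      · field_simp
      · field_simp
    rw [dist_comm, dist_eq_norm, e]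
    have k3 : ‖(x - h)⁻¹‖ ≤ 2 / δ := by
      rw [norm_inv, ← inv_div]
      exact inv_anti₀ (by positivity) k1
    have k4 : ‖x⁻¹‖ ≤ 1 / δ := by
      rw [norm_inv, one_div]
      exact inv_anti₀ hδ k2
    have k5 := (h3 x hx).le
    rw [dist_comm, dist_eq_norm] at k5
    have k6 := (hM x hx).trans (le_max_left M 0)
    calc _ ≤ ‖(x - h)⁻¹‖ * ‖evalMat (A h) x - evalMat At x‖ +
          ‖(h : ℂ)‖ * (‖(x - h)⁻¹‖ * ‖x⁻¹‖) * ‖evalMat At x‖ := by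
          refine (norm_add_le _ _).trans ?_
          rw [norm_smul, norm_smul, norm_mul, norm_mul]
      _ ≤ (2 / δ) * (ε * δ / 4) + h * ((2 / δ) * (1 / δ)) * max M 0 := by
          rw [Complex.norm_of_nonneg hh.le]
          gcongr
      _ = ε / 2 + h * ((2 / δ) * (1 / δ) * max M 0) := by
          field_simp
          ring
      _ < ε := by linarith

/-- The matrices of the difference equations, in the minus case. -/
theorem tendstoUniformlyOn_minus {A : ℝ → RatMat n} {At : RatMat n} {K : Set ℂ}
    (hK : IsCompact K) (h0 : (0 : ℂ) ∉ K) {t₀ : ℝ} (ht₀ : 0 < t₀)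
    (hAt : Disjoint (poleSet At) ((fun p : ℂ × ℝ => p.1 + p.2) '' ((-K) ×ˢ Set.Icc 0 t₀)))
    (H : ConvergesUniformlyOn A At ((fun p : ℂ × ℝ => p.1 + p.2) '' ((-K) ×ˢ Set.Icc 0 t₀))) :
    (∀ᶠ h in 𝓝[>] (0 : ℝ), ∀ x ∈ K, MatAnalyticAt (stepMat false h (A h)) x) ∧
    TendstoUniformlyOn (fun (h : ℝ) x => (h : ℂ)⁻¹ • (1 - stepMat false h (A h) x))
      (limitCoeff false At) (𝓝[>] 0) K := by
  -- The step matrix at x involves `A h` at h - x instead of -x, so uniform convergence is required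
  -- on a thickening of -K to the right.
  set L := (fun p : ℂ × ℝ => p.1 + p.2) '' ((-K) ×ˢ Set.Icc 0 t₀) with hL
  have hLc : IsCompact L := isCompact_translates hK.neg _ _
  obtain ⟨δ, hδ, hKδ⟩ := exists_pos_le_norm hK h0
  have hcont := continuousOn_evalMat hAt
  obtain ⟨M₀, hM₀⟩ := hLc.exists_bound_of_continuousOn hcont
  set M := max M₀ 0 + 1 with hM
  have hMpos : 0 < M := by positivity
  have hmem : ∀ h : ℝ, 0 ≤ h → h ≤ t₀ → ∀ x ∈ K, (h : ℂ) - x ∈ L := by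
    intro h hh ht x hx
    exact ⟨(-x, h), ⟨by simpa using hx, hh, ht⟩, by ring⟩
  have hsmall : ∀ᶠ h in 𝓝[>] (0 : ℝ), h ≤ t₀ :=
    tendsto_id_nhdsGT.eventually (ge_mem_nhds ht₀)
  have hunif := Metric.tendstoUniformlyOn_iff.1 H.tendstoUniformlyOn
  have hbound : ∀ᶠ h in 𝓝[>] (0 : ℝ), ∀ x ∈ K,
      ‖x⁻¹ • evalMat (A h) (h - x)‖ ≤ M / δ := by
    filter_upwards [hsmall, self_mem_nhdsWithin, hunif 1 one_pos] with h h1 h2 h3 x hx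
    have h4 := hmem h (le_of_lt h2) h1 x hx
    have h5 := (h3 _ h4).le
    rw [dist_comm, dist_eq_norm] at h5
    have h6 := norm_le_insert' (evalMat (A h) (h - x)) (evalMat At (h - x))
    have h7 := (hM₀ _ h4).trans (le_max_left M₀ 0)
    rw [norm_smul, norm_inv, div_eq_inv_mul]
    exact mul_le_mul (inv_anti₀ hδ (hKδ x hx)) (by linarith) (norm_nonneg _) (by positivity)
  have hsmall2 : ∀ᶠ h in 𝓝[>] (0 : ℝ), h * (M / δ) < 1 / 2 := by
    have := tendsto_id_nhdsGT.mul_const (M / δ)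
    rw [zero_mul] at this
    exact this.eventually (gt_mem_nhds (by norm_num))
  have hmain : ∀ᶠ h in 𝓝[>] (0 : ℝ), ∀ x ∈ K, minusMat h (A h) x =
      1 + (h : ℂ) • (x⁻¹ • evalMat (A h) (h - x)) ∧ IsUnit (minusMat h (A h) x).det ∧
      ‖(minusMat h (A h) x)⁻¹‖ ≤ 2 * ‖(1 : CMat n)‖ := by
    filter_upwards [hbound, hsmall2, self_mem_nhdsWithin] with h h1 h2 h3 x hx
    have hh : 0 < h := h3
    set D := x⁻¹ • evalMat (A h) (h - x) with hD
    have e : minusMat h (A h) x = 1 + (h : ℂ) • D := by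
      rw [minusMat, hD, smul_smul, div_eq_mul_inv]
    have hn : ‖(h : ℂ) • D‖ ≤ 1 / 2 := by
      rw [norm_smul, Complex.norm_of_nonneg hh.le]
      exact (mul_le_mul_of_nonneg_left (h1 x hx) hh.le).trans h2.le
    have hu : IsUnit (minusMat h (A h) x).det := by
      rw [← Matrix.isUnit_iff_isUnit_det, e, ← sub_neg_eq_add]
      refine isUnit_one_sub_of_norm_lt_one ?_
      rw [norm_neg]
      linarith
    refine ⟨e, hu, ?_⟩
    -- As ‖h D‖ ≤ 1/2, this identity bounds the inverse by 2‖1‖. The norm of 1 is kept, since it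
    -- vanishes for n = 0.
    have e2 : (minusMat h (A h) x)⁻¹ = 1 - (minusMat h (A h) x)⁻¹ * ((h : ℂ) • D) := by
      have := Matrix.nonsing_inv_mul _ hu
      conv_rhs at this => skip
      rw [eq_sub_iff_add_eq]
      calc (minusMat h (A h) x)⁻¹ + (minusMat h (A h) x)⁻¹ * ((h : ℂ) • D) =
            (minusMat h (A h) x)⁻¹ * (1 + (h : ℂ) • D) := by rw [mul_add, mul_one]
        _ = 1 := by rw [← e, this]
    have h4 : ‖(minusMat h (A h) x)⁻¹‖ ≤ ‖(1 : CMat n)‖ +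
        ‖(minusMat h (A h) x)⁻¹‖ * (1 / 2) := by
      conv_lhs => rw [e2]
      refine (norm_sub_le _ _).trans ?_
      gcongr
      exact (norm_mul_le _ _).trans (by gcongr)
    linarith
  constructor
  · filter_upwards [H.1, hsmall, self_mem_nhdsWithin, hmain] with h h1 h2 h3 h4 x hx
    have hx0 : x ≠ 0 := norm_pos_iff.1 (hδ.trans_le (hKδ x hx))
    refine MatAnalyticAt.inv (Y := minusMat h (A h)) ?_ (h4 x hx).2.1.ne_zero
    refine MatAnalyticAt.one_add_smul (Y := fun y => evalMat (A h) (h - y)) ?_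
      (analyticAt_const.div analyticAt_id hx0)
    exact (matAnalyticAt_evalMat (h1.notMem_of_mem_right (hmem h (le_of_lt h3) h2 x hx))).comp
      (g := fun y : ℂ => h - y) (by fun_prop)
  · refine Metric.tendstoUniformlyOn_iff.2 ?_
    intro ε hε
    have huc := Metric.uniformContinuousOn_iff.1 (hLc.uniformContinuousOn_of_continuous hcont)
      (ε * δ / 4) (by positivity)
    obtain ⟨η, hη, hηc⟩ := huc
    have hlim : Tendsto (fun h : ℝ => h * (2 * ‖(1 : CMat n)‖ * (M / δ) * (M / δ))) (𝓝[>] 0)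
        (𝓝 0) := by
      simpa using tendsto_id_nhdsGT.mul_const (2 * ‖(1 : CMat n)‖ * (M / δ) * (M / δ))
    filter_upwards [hsmall, self_mem_nhdsWithin, hunif (ε * δ / 4) (by positivity), hmain, hbound,
      tendsto_id_nhdsGT.eventually (gt_mem_nhds hη),
      hlim.eventually (gt_mem_nhds (half_pos hε))] with h h1 h2 h3 h4 h5 h6 h7 x hx
    have hh : 0 < h := h2
    have hhc : (h : ℂ) ≠ 0 := by exact_mod_cast hh.ne'
    obtain ⟨e, hu, hinv⟩ := h4 x hx
    have hD := h5 x hx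
    set D := x⁻¹ • evalMat (A h) (h - x) with hDdef
    set Ci := (minusMat h (A h) x)⁻¹ with hCi
    have e1 : Ci * (1 + (h : ℂ) • D) = 1 := by rw [← e, hCi, Matrix.nonsing_inv_mul _ hu]
    have e1' : 1 - Ci = (h : ℂ) • (Ci * D) := by
      rw [mul_add, mul_one, mul_smul_comm] at e1
      rw [← e1, add_sub_cancel_left]
    -- From (1 + hD)⁻¹ = 1 - hD + O(h²), the quotient is D up to a term of order h; D is close to
    -- its limit by uniform convergence and by the uniform continuity of At.
    have e2 : (h : ℂ)⁻¹ • (1 - stepMat false h (A h) x) = D - (h : ℂ) • (Ci * D * D) := by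
      change (h : ℂ)⁻¹ • (1 - Ci) = _
      rw [e1', smul_smul, inv_mul_cancel₀ hhc, one_smul, ← smul_mul_assoc, ← e1', sub_mul, one_mul,
        sub_sub_cancel]
    have e3 : limitCoeff false At x = x⁻¹ • evalMat At (-x) := rfl
    rw [dist_comm, dist_eq_norm, e2, e3]
    have h8 := hmem h hh.le h1 x hx
    have h9 := hmem 0 le_rfl ht₀.le x hx
    rw [Complex.ofReal_zero, zero_sub] at h9
    have k1 := (h3 _ h8).le
    have k2 := (hηc _ h8 _ h9 (by
      rw [dist_eq_norm, sub_neg_eq_add, sub_add_cancel]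
      simpa [abs_of_pos hh] using h6)).le
    rw [dist_comm, dist_eq_norm] at k1
    rw [dist_eq_norm] at k2
    have k3 : ‖x⁻¹‖ ≤ 1 / δ := by
      rw [norm_inv, one_div]
      exact inv_anti₀ hδ (hKδ x hx)
    have k4 : ‖D - x⁻¹ • evalMat At (-x)‖ ≤ 1 / δ * (ε * δ / 4 + ε * δ / 4) := by
      rw [hDdef, ← smul_sub, norm_smul]
      refine mul_le_mul k3 ?_ (norm_nonneg _) (by positivity)
      calc _ = ‖(evalMat (A h) (h - x) - evalMat At (h - x)) +
            (evalMat At (h - x) - evalMat At (-x))‖ := by rw [sub_add_sub_cancel]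
        _ ≤ _ := (norm_add_le _ _).trans (add_le_add k1 k2)
    have k5 : ‖(h : ℂ) • (Ci * D * D)‖ ≤ h * (2 * ‖(1 : CMat n)‖ * (M / δ) * (M / δ)) := by
      rw [norm_smul, Complex.norm_of_nonneg hh.le]
      gcongr
      refine (norm_mul_le _ _).trans ?_
      refine mul_le_mul ((norm_mul_le _ _).trans ?_) hD (norm_nonneg _) (by positivity)
      exact mul_le_mul hinv hD (norm_nonneg _) (by positivity)
    calc _ = ‖(D - x⁻¹ • evalMat At (-x)) - (h : ℂ) • (Ci * D * D)‖ := by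
          rw [sub_right_comm]
      _ ≤ 1 / δ * (ε * δ / 4 + ε * δ / 4) +
          h * (2 * ‖(1 : CMat n)‖ * (M / δ) * (M / δ)) :=
          (norm_sub_le _ _).trans (add_le_add k4 k5)
      _ = ε / 2 + h * (2 * ‖(1 : CMat n)‖ * (M / δ) * (M / δ)) := by
          field_simp
          ring
      _ < ε := by linarith

end Confluent

end

noncomputable section

/-! ### Convergence on cut planes to a fundamental system -/

section Confluent

variable {n : ℕ}

attribute [local instance] Matrix.linftyOpNormedRing Matrix.linftyOpNormedAlgebra

/-- A power series in `1 / x` tends to its constant term along horizontal half-lines. -/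
theorem tendsto_tsum_inv_pow {c₀ : ℕ → CMat n} {R : ℝ}
    (hs : ∀ x : ℂ, R < x.re → Summable fun s => (x⁻¹) ^ s • c₀ s) (x : ℂ) :
    Tendsto (fun t : ℝ => ∑' s, ((x + t)⁻¹) ^ s • c₀ s) atTop (𝓝 (c₀ 0)) := by
  set ρ : ℝ := max R 0 + 1 with hρ
  have hρ0 : 0 < ρ := by positivity
  have h1 := hs (ρ : ℂ) (by rw [Complex.ofReal_re]; linarith [le_max_left R 0])
  have h2 : Summable fun s => ‖((ρ : ℂ)⁻¹) ^ s • c₀ s‖ := by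
    have : FiniteDimensional ℝ (CMat n) := FiniteDimensional.complexToReal _
    exact summable_norm_iff.2 h1
  have hnorm : Tendsto (fun t : ℝ => ‖x + t‖) atTop atTop := by
    refine tendsto_atTop_mono (f := fun t : ℝ => x.re + t) (fun t => ?_)
      (tendsto_atTop_add_const_left _ _ tendsto_id)
    calc x.re + t = (x + t).re := by simp
      _ ≤ |(x + t).re| := le_abs_self _
      _ ≤ _ := Complex.abs_re_le_norm _
  have h3 : Tendsto (fun t : ℝ => ∑' s, ((x + t)⁻¹) ^ s • c₀ s) atTop
      (𝓝 (∑' s, if s = 0 then c₀ 0 else 0)) := by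
    refine tendsto_tsum_of_dominated_convergence h2 (fun s => ?_) ?_
    · rcases Nat.eq_zero_or_pos s with hs0 | hs0
      · subst hs0
        simp
      · rw [if_neg hs0.ne']
        have k1 : Tendsto (fun t : ℝ => (x + t)⁻¹) atTop (𝓝 0) :=
          tendsto_inv₀_cobounded.comp (tendsto_norm_atTop_iff_cobounded.1 hnorm)
        have k2 := (k1.pow s).smul_const (c₀ s)
        rwa [zero_pow hs0.ne', zero_smul] at k2
    · filter_upwards [hnorm.eventually_ge_atTop ρ] with t ht s
      rw [norm_smul, norm_smul, norm_pow, norm_pow, norm_inv, norm_inv,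
        Complex.norm_of_nonneg hρ0.le]
      gcongr
  simpa using h3

/-- A solution of a linear differential system is invertible if it is so far to the right on each
horizontal line. -/
theorem isUnit_det_of_hasDerivAt {W : Set ℂ} {Q E : ℂ → CMat n} (hQ : ContinuousOn Q W)
    (hE : ∀ x ∈ W, HasDerivAt E (Q x * E x) x) {x : ℂ} (hx : ∀ t : ℝ, 0 ≤ t → x + t ∈ W)
    {T : ℝ} (hT : 0 ≤ T) (hu : IsUnit (E (x + T)).det) : IsUnit (E x).det := by
  rw [isUnit_iff_ne_zero]
  intro h0
  obtain ⟨v, hv0, hv⟩ := Matrix.exists_mulVec_eq_zero_iff.2 h0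
  -- A kernel vector of E x, repeated in all columns. Then E X solves the system along the half-line
  -- and vanishes at its origin; by Grönwall it vanishes at x + T, where E is invertible, so X = 0.
  set X : CMat n := Matrix.of fun i _ => v i with hX
  have hEX : E x * X = 0 := by
    ext i j
    exact congrFun hv i
  have hc : Continuous fun t : ℝ => x + t := by fun_prop
  have hmaps : Set.MapsTo (fun t : ℝ => x + (t : ℂ)) (Set.Icc 0 T) W := fun t ht => hx t ht.1
  obtain ⟨K, hK⟩ := (isCompact_Icc (a := (0 : ℝ)) (b := T)).exists_bound_of_continuousOn
    (hQ.comp hc.continuousOn hmaps)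
  have hd : ∀ t : ℝ, 0 ≤ t → HasDerivAt (fun t : ℝ => E (x + t) * X)
      ((Q (x + t) * E (x + t)) * X) t := by
    intro t ht
    have h1 : HasDerivAt (fun t : ℝ => x + (t : ℂ)) 1 t :=
      (Complex.ofRealCLM.hasDerivAt (x := t)).const_add x
    have h2 := HasDerivAt.scomp t (hE _ (hx t ht)) h1
    rw [one_smul] at h2
    exact h2.mul_const X
  have h1 := norm_le_gronwallBound_of_norm_deriv_right_le (f := fun t : ℝ => E (x + t) * X)
    (f' := fun t : ℝ => (Q (x + t) * E (x + t)) * X) (δ := 0) (K := K) (ε := 0) (a := 0) (b := T)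
    (fun t ht => (hd t ht.1).continuousAt.continuousWithinAt)
    (fun t ht => (hd t ht.1).hasDerivWithinAt) (by simp [hEX]) (fun t ht => by
      rw [add_zero, mul_assoc]
      exact (norm_mul_le _ _).trans (mul_le_mul_of_nonneg_right (hK t ⟨ht.1, ht.2.le⟩)
        (norm_nonneg _)))
    T ⟨hT, le_rfl⟩
  rw [gronwallBound_ε0_δ0] at h1
  have h2 : E (x + T) * X = 0 := norm_le_zero_iff.1 h1
  have h3 : X = 0 := by
    rw [← Matrix.nonsing_inv_mul_cancel_left (E (x + T)) X hu, h2, mul_zero]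
  refine hv0 (funext fun i => ?_)
  exact congrFun (congrFun h3 i) i

/-- A domain on which the canonical solutions converge. -/
structure IsConfluenceDomain (plus : Bool) (At : RatMat n) (W : Set ℂ) : Prop where
  isOpen : IsOpen W
  add_mem : ∀ x ∈ W, ∀ t : ℝ, 0 ≤ t → x + t ∈ W
  exists_halfPlane : ∃ R : ℝ, ∀ x : ℂ, R < x.re → x ∈ W
  zero_notMem : (0 : ℂ) ∉ W
  notMem_poleSet : ∀ x ∈ W, (if plus then x else -x) ∉ poleSet At

theorem continuousOn_limitCoeff {plus : Bool} {At : RatMat n} {W : Set ℂ}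
    (hW : IsConfluenceDomain plus At W) : ContinuousOn (limitCoeff plus At) W := by
  have h1 : ContinuousOn (fun x : ℂ => x⁻¹) W :=
    continuousOn_id.inv₀ fun x hx h0 => hW.zero_notMem (by rwa [← show x = 0 from h0])
  refine h1.smul fun x hx => ?_
  cases plus with
  | true => exact (matAnalyticAt_evalMat (hW.notMem_poleSet x hx)).analyticAt.continuousAt.continuousWithinAt
  | false =>
    have h2 : ContinuousAt (evalMat At) (-x) :=
      (matAnalyticAt_evalMat (hW.notMem_poleSet x hx)).analyticAt.continuousAt
    exact (h2.comp (f := fun y : ℂ => -y) continuous_neg.continuousAt).continuousWithinAt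

theorem IsConfluenceDomain.tendstoUniformlyOn {plus : Bool} {A : ℝ → RatMat n} {At : RatMat n}
    {W K : Set ℂ} (hW : IsConfluenceDomain plus At W)
    (H : ∀ K : Set ℂ, IsCompact K → Disjoint (poleSet At) K → ConvergesUniformlyOn A At K)
    (hKW : K ⊆ W) (hK : IsCompact K) :
    (∀ᶠ h in 𝓝[>] (0 : ℝ), ∀ x ∈ K, MatAnalyticAt (stepMat plus h (A h)) x) ∧
    TendstoUniformlyOn (fun (h : ℝ) x => (h : ℂ)⁻¹ • (1 - stepMat plus h (A h) x))
      (limitCoeff plus At) (𝓝[>] 0) K := by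
  have h0 : (0 : ℂ) ∉ K := fun h => hW.zero_notMem (hKW h)
  cases plus with
  | true =>
    have hd : Disjoint (poleSet At) K :=
      Set.disjoint_right.2 fun x hx => hW.notMem_poleSet x (hKW hx)
    exact tendstoUniformlyOn_plus hK h0 hd (H K hK hd)
  | false =>
    -- Leaves room for the shift by h: the translates of -K by [0, t₀] still avoid the poles.
    obtain ⟨t₀, ht₀, hsub⟩ := hK.exists_cthickening_subset_open hW.isOpen hKW
    have hd : Disjoint (poleSet At)
        ((fun p : ℂ × ℝ => p.1 + p.2) '' ((-K) ×ˢ Set.Icc 0 t₀)) := by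
      refine Set.disjoint_right.2 ?_
      rintro _ ⟨⟨y, t⟩, ⟨hy, ht⟩, rfl⟩
      have h1 : -(y + t : ℂ) ∈ W := by
        refine hsub (Metric.mem_cthickening_of_dist_le _ (-y) t₀ K hy ?_)
        rw [dist_eq_norm, neg_sub_neg, sub_add_cancel_left, norm_neg,
          Complex.norm_of_nonneg ht.1]
        exact ht.2
      have h2 := hW.notMem_poleSet _ h1
      simpa using h2
    exact tendstoUniformlyOn_minus hK h0 ht₀ hd (H _ (isCompact_translates hK.neg _ _) hd)

/-- The canonical solutions converge to a fundamental system of solutions of the differential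
system. -/
theorem LocalData.exists_limit {plus : Bool} {A : ℝ → RatMat n} {At : RatMat n}
    {a : ℝ → ℕ → CMat n} {a₀ : ℕ → CMat n} {C lam : ℝ} (L : LocalData plus A a a₀ C lam) {W : Set ℂ}
    (hW : IsConfluenceDomain plus At W)
    (H : ∀ K : Set ℂ, IsCompact K → Disjoint (poleSet At) K → ConvergesUniformlyOn A At K) :
    ∃ (Y : ℝ → ℂ → CMat n) (E F : ℂ → CMat n) (c₀ : ℕ → CMat n) (R : ℝ),
      (∀ᶠ h in 𝓝[>] (0 : ℝ), IsCanonical plus h (A h) (Y h) ∧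
        ∀ Y', IsCanonical plus h (A h) Y' → Y' = Y h) ∧
      (∀ x ∈ W, Tendsto (fun h => Y h x) (𝓝[>] 0) (𝓝 (E x))) ∧
      (∀ x ∈ W, HasDerivAt E (limitCoeff plus At x * E x) x ∧ IsUnit (E x).det) ∧
      c₀ 0 = 1 ∧ ∀ x : ℂ, R < x.re → HasSum (fun s => (x⁻¹) ^ s • c₀ s) (F x) ∧
        E x = F x * NormedSpace.exp (Complex.log x • a₀ 0) := by
  obtain ⟨Y, c₀, R₁, hY, hR⟩ := L.exists_canonical
  obtain ⟨R₂, hR₂⟩ := hW.exists_halfPlane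
  set R := max R₁ R₂ with hRdef
  have hRR₁ : ∀ x : ℂ, R < x.re → R₁ < x.re := fun x hx => (le_max_left _ _).trans_lt hx
  have hfam : ConfluentFamily W (limitCoeff plus At) (fun h => stepMat plus h (A h)) Y R :=
    { isOpen := hW.isOpen
      add_mem := hW.add_mem
      halfPlane_subset := fun x hx => hR₂ x ((le_max_right _ _).trans_lt hx)
      step := fun K hKW hK => by
        filter_upwards [hY, (hW.tendstoUniformlyOn H hKW hK).1] with h h1 h2 x hx h3
        obtain ⟨h4, h5⟩ := MatNF.step h1.1.1 h1.1.2.1 (h2 x hx) h3.matAnalyticAt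
        exact ⟨h4.analyticAt, h5⟩
      tendsto_coeff := fun K hKW hK => (hW.tendstoUniformlyOn H hKW hK).2
      continuousOn := continuousOn_limitCoeff hW
      analyticAt_right := hR.analyticAt.mono fun h hh x hx => hh x (hRR₁ x hx)
      bounded_right := fun K hK hKR => hR.bounded K hK fun x hx => hRR₁ x (hKR x hx)
      tendsto_right := fun x hx => ⟨_, hR.tendsto x (hRR₁ x hx)⟩ }
  obtain ⟨E, hE, hEd⟩ := hfam.exists_limit
  have hEF : ∀ x : ℂ, R < x.re →
      E x = (∑' s, (x⁻¹) ^ s • c₀ s) * NormedSpace.exp (Complex.log x • a₀ 0) := fun x hx =>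
    tendsto_nhds_unique (hE x (hfam.halfPlane_subset x hx)) (hR.tendsto x (hRR₁ x hx))
  refine ⟨Y, E, fun x => ∑' s, (x⁻¹) ^ s • c₀ s, c₀, R, hY, hE, fun x hx => ⟨hEd x hx, ?_⟩,
    hR.coeff_zero, fun x hx => ⟨(hR.summable x (hRR₁ x hx)).hasSum, hEF x hx⟩⟩
  -- Far to the right, E is a matrix close to 1 times an exponential, hence invertible;
  -- `isUnit_det_of_hasDerivAt` brings this back to x.
  have h1 := tendsto_tsum_inv_pow hR.summable x
  rw [hR.coeff_zero] at h1
  have h2 : Tendsto (fun t : ℝ => (∑' s, ((x + t)⁻¹) ^ s • c₀ s).det) atTop (𝓝 1) := by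
    have := ((Continuous.matrix_det continuous_id).tendsto (1 : CMat n)).comp h1
    simpa [Function.comp_def] using this
  obtain ⟨T, hT1, hT2, hT3⟩ := ((h2.eventually_ne one_ne_zero).and
    ((eventually_ge_atTop 0).and (eventually_gt_atTop (R - x.re)))).exists
  refine isUnit_det_of_hasDerivAt hfam.continuousOn hEd (hW.add_mem x hx) hT2 ?_
  rw [hEF (x + T) (by simp; linarith), Matrix.det_mul]
  refine (isUnit_iff_ne_zero.2 hT1).mul ?_
  rw [← Matrix.isUnit_iff_isUnit_det]
  exact @NormedSpace.isUnit_exp _ _ (NormedAlgebra.restrictScalars ℚ ℂ (CMat n)) _ _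

end Confluent

end

noncomputable section

/-! ### Rational matrices: values at infinity and analytic identities -/

section Rational

variable {n : ℕ}

theorem meromorphicAt_polynomial_inv (p : Polynomial ℂ) :
    MeromorphicAt (fun w : ℂ => p.eval w⁻¹) 0 := by
  simp only [Polynomial.eval_eq_sum_range]
  exact MeromorphicAt.fun_sum fun k _ => (MeromorphicAt.const _ _).mul ((MeromorphicAt.id 0).inv.pow k)

/-- A rational matrix that converges along a sequence that goes to infinity is holomorphic at
infinity. -/
theorem hasValueAtInfinity_of_tendsto {A : RatMat n} {V : CMat n} {u : ℝ → ℂ}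
    (hu : Tendsto u atTop (Bornology.cobounded ℂ))
    (hV : Tendsto (fun t => evalMat A (u t)) atTop (𝓝 V)) : HasValueAtInfinity A V := by
  refine tendsto_pi_nhds.2 fun i => tendsto_pi_nhds.2 fun j => ?_
  have hVij : Tendsto (fun t => evalMat A (u t) i j) atTop (𝓝 (V i j)) :=
    tendsto_pi_nhds.1 (tendsto_pi_nhds.1 hV i) j
  set φ : ℂ → ℂ := fun w => evalMat A w⁻¹ i j with hφ
  have hm : MeromorphicAt φ 0 := by
    simp only [hφ, evalMat, Matrix.map_apply, RatFunc.eval, Polynomial.eval₂_id]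
    exact (meromorphicAt_polynomial_inv _).div (meromorphicAt_polynomial_inv _)
  have hu' : Tendsto (fun t => (u t)⁻¹) atTop (𝓝[≠] 0) := tendsto_inv₀_cobounded'.comp hu
  have hφu : ∀ t, φ (u t)⁻¹ = evalMat A (u t) i j := fun t => by simp [hφ]
  have hlim : Tendsto φ (𝓝[≠] 0) (𝓝 (V i j)) := by
    -- φ is the entry in the coordinate 1/x. A pole of φ at 0 would make the entry unbounded along
    -- u, where it converges.
    rcases lt_or_ge (meromorphicOrderAt φ 0) 0 with ho | ho
    · have h1 := (tendsto_cobounded_of_meromorphicOrderAt_neg ho).comp hu'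
      have h2 : Tendsto (fun t => evalMat A (u t) i j) atTop (Bornology.cobounded ℂ) :=
        h1.congr hφu
      exact absurd (tendsto_norm_cobounded_atTop.comp h2) (not_tendsto_atTop_of_tendsto_nhds
        hVij.norm)
    · obtain ⟨c, hc⟩ := tendsto_nhds_of_meromorphicOrderAt_nonneg hm ho
      rwa [← tendsto_nhds_unique ((hc.comp hu').congr hφu) hVij]
  have := hlim.comp tendsto_inv₀_cobounded'
  refine this.congr fun x => ?_
  simp [hφ]

/-- The identity num = denom · g extends to U, so a zero of the denominator would be a common zero,
against coprimality. In particular no value of the fraction on U is the default one of a division by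
zero. -/
theorem RatFunc.eval_eq_of_analytic {f : RatFunc ℂ} {g : ℂ → ℂ} {U : Set ℂ}
    (hg : AnalyticOnNhd ℂ g U) (hU : IsPreconnected U) {x₀ : ℂ} (hx₀ : x₀ ∈ U)
    (h0 : (fun x => f.eval (RingHom.id ℂ) x) =ᶠ[𝓝 x₀] g) {x : ℂ} (hx : x ∈ U) :
    f.denom.eval x ≠ 0 ∧ f.eval (RingHom.id ℂ) x = g x := by
  have hpoly : ∀ p : Polynomial ℂ, AnalyticOnNhd ℂ (fun x => p.eval x) U := fun p x _ =>
    p.differentiable.analyticAt x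
  have hd : ∀ᶠ x in 𝓝[≠] x₀, f.denom.eval x ≠ 0 := by
    rcases ((hpoly f.denom x₀ hx₀).eventually_eq_zero_or_eventually_ne_zero) with h | h
    · exfalso
      have h2 : Set.Infinite {x | f.denom.IsRoot x} :=
        infinite_of_mem_nhds x₀ (h.mono fun y hy => hy)
      exact h2 (Polynomial.finite_setOfPred_isRoot f.denom_ne_zero)
    · exact h
  have h1 : (fun x => f.num.eval x) =ᶠ[𝓝[≠] x₀] fun x => f.denom.eval x * g x := by
    filter_upwards [hd, nhdsWithin_le_nhds h0] with y h2 h3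
    rw [← h3, RatFunc.eval, Polynomial.eval₂_id, Polynomial.eval₂_id, mul_div_cancel₀ _ h2]
  have h2 : Set.EqOn (fun x => f.num.eval x) (fun x => f.denom.eval x * g x) U :=
    AnalyticOnNhd.eqOn_of_preconnected_of_frequently_eq (hpoly _) ((hpoly _).mul hg) hU hx₀
      h1.frequently
  have h3 : f.num.eval x = f.denom.eval x * g x := h2 hx
  have h4 : f.denom.eval x ≠ 0 := by
    intro h5
    obtain ⟨a, b, hab⟩ := f.isCoprime_num_denom
    have := congrArg (fun p => Polynomial.eval x p) hab
    simp [h5, h3] at this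
  refine ⟨h4, ?_⟩
  rw [RatFunc.eval, Polynomial.eval₂_id, Polynomial.eval₂_id, h3, mul_div_cancel_left₀ _ h4]

theorem finite_poleSet (A : RatMat n) : (poleSet A).Finite := by
  have h1 : poleSet A = ⋃ i, ⋃ j, {x | (A i j).denom.IsRoot x} := by
    ext x
    simp [poleSet, Polynomial.IsRoot]
  rw [h1]
  exact Set.finite_iUnion fun i => Set.finite_iUnion fun j =>
    Polynomial.finite_setOfPred_isRoot (A i j).denom_ne_zero

end Rational

/-! ### Non-resonance and the Sylvester equation -/

section NonResonance

variable {n : ℕ}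

attribute [local instance] Matrix.linftyOpNormedRing Matrix.linftyOpNormedAlgebra

/-- The hypothesis reads M X = X (M - m), whence p(M) X = X p(M - m) for every polynomial p. For the
characteristic polynomial of M the left side vanishes by Cayley–Hamilton, while p(M - m) is
invertible because no two eigenvalues of M differ by m. -/
theorem NonResonant.eq_zero {M : CMat n} (hM : NonResonant M) {m : ℕ} (hm : 1 ≤ m) {X : CMat n}
    (hX : (m : ℂ) • X + (M * X - X * M) = 0) : X = 0 := by
  rcases subsingleton_or_nontrivial (CMat n) with hs | hs
  · exact Subsingleton.elim _ _
  set T : CMat n := M - algebraMap ℂ (CMat n) m with hT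
  have h1 : M * X = X * T := by
    rw [hT, mul_sub, ← Algebra.commutes, ← Algebra.smul_def, eq_sub_iff_add_eq, ← sub_eq_zero,
      ← hX]
    abel
  have h2 : ∀ p : Polynomial ℂ, Polynomial.aeval M p * X = X * Polynomial.aeval T p := by
    intro p
    induction p using Polynomial.induction_on' with
    | add p q hp hq => rw [map_add, map_add, add_mul, mul_add, hp, hq]
    | monomial k c =>
      have h3 : M ^ k * X = X * T ^ k := by
        induction k with
        | zero => simp
        | succ k ih => rw [pow_succ', mul_assoc, ih, ← mul_assoc, h1, mul_assoc, ← pow_succ']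
      rw [Polynomial.aeval_monomial, Polynomial.aeval_monomial, mul_assoc, h3, ← mul_assoc,
        Algebra.commutes, mul_assoc]
  have h4 := h2 M.charpoly
  rw [Matrix.aeval_self_charpoly, zero_mul] at h4
  have h5 : IsUnit (Polynomial.aeval T M.charpoly) := by
    by_contra hu
    have h6 : (0 : ℂ) ∈ spectrum ℂ (Polynomial.aeval T M.charpoly) := spectrum.zero_mem ℂ hu
    rw [spectrum.map_polynomial_aeval] at h6
    obtain ⟨b, hb, hb0⟩ := h6
    have h7 : b ∈ spectrum ℂ M := Matrix.mem_spectrum_iff_isRoot_charpoly.2 hb0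
    rw [hT, ← spectrum.sub_singleton_eq, Set.mem_sub] at hb
    obtain ⟨c, hc, d, hd, hcd⟩ := hb
    rw [Set.mem_singleton_iff] at hd
    have h8 := hM c hc b h7 m (by rw [← hcd, hd]; push_cast; ring)
    omega
  exact (h5.mul_left_eq_zero).1 h4.symm

end NonResonance

/-! ### Local data from confluence of the first kind -/

section FactorialCase

variable {n : ℕ}

attribute [local instance] Matrix.linftyOpNormedRing Matrix.linftyOpNormedAlgebra

/-- The real half-line that goes to `+∞` or to `-∞`. -/
def signedRay (plus : Bool) (t : ℝ) : ℂ := if plus then (t : ℂ) else -(t : ℂ)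

theorem tendsto_signedRay (plus : Bool) :
    Tendsto (signedRay plus) atTop (Bornology.cobounded ℂ) := by
  rw [← tendsto_norm_atTop_iff_cobounded]
  have h1 : (fun t => ‖signedRay plus t‖) = fun t : ℝ => |t| := by
    funext t
    cases plus <;> simp [signedRay]
  rw [h1]
  exact tendsto_abs_atTop_atTop

theorem IsTyped.tendsto_facSum_atTop {h C lam : ℝ} {a : ℕ → CMat n} (ha : IsTyped h C lam a)
    (hh : 0 ≤ h) (hl : 0 ≤ lam) :
    Tendsto (fun t : ℝ => facSum h a (t : ℂ)) atTop (𝓝 (a 0)) := by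
  refine tendsto_iff_norm_sub_tendsto_zero.2 ?_
  have h1 : Tendsto (fun t : ℝ => C / (t - lam)) atTop (𝓝 0) :=
    Tendsto.div_atTop tendsto_const_nhds (tendsto_atTop_add_const_right _ _ tendsto_id)
  refine squeeze_zero' (Eventually.of_forall fun t => norm_nonneg _) ?_ h1
  filter_upwards [eventually_gt_atTop lam] with t ht
  have := ha.norm_facSum_sub_le hh hl (x := (t : ℂ)) (by simpa using ht)
  simpa using this

theorem hasValueAtInfinity_of_facSum {plus : Bool} {A : RatMat n} {h C lam R : ℝ}
    {a : ℕ → CMat n} (ha : IsTyped h C lam a) (hh : 0 ≤ h) (hl : 0 ≤ lam)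
    (hA : ∀ x : ℂ, R < x.re → facSum h a x = evalMat A (if plus then x else -x)) :
    HasValueAtInfinity A (a 0) := by
  refine hasValueAtInfinity_of_tendsto (tendsto_signedRay plus) ?_
  refine (ha.tendsto_facSum_atTop hh hl).congr' ?_
  filter_upwards [eventually_gt_atTop R] with t ht
  exact hA t (by simpa using ht)

/-- The half-plane where the expansion is assumed may depend on h. Analytic continuation carries the
identity to a half-plane that depends on lam only, which also excludes poles of A there. -/
theorem evalMat_eq_of_facSum {plus : Bool} {A : RatMat n} {h C lam R : ℝ} {a : ℕ → CMat n}
    (ha : IsTyped h C lam a) (hh : 0 ≤ h) (h1 : h ≤ 1) (hl : 1 ≤ lam)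
    (hA : ∀ x : ℂ, R < x.re → facSum h a x = evalMat A (if plus then x else -x)) {x : ℂ}
    (hx : lam + 3 < x.re) : facSum h a x = evalMat A (if plus then x else -x) := by
  set σ : ℂ → ℂ := fun x => if plus then x else -x with hσ
  have hσσ : ∀ x, σ (σ x) = x := fun x => by cases plus <;> simp [hσ]
  have hσa : ∀ x, AnalyticAt ℂ σ x := fun x => by
    cases plus
    · simp only [hσ, Bool.false_eq_true, if_false]
      fun_prop
    · simp only [hσ, if_true]
      fun_prop
  set U : Set ℂ := {x | lam + 3 < (σ x).re} with hU
  have hUc : Convex ℝ U := by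
    cases plus
    · have : U = {x : ℂ | x.re < -(lam + 3)} := by
        ext x
        simp only [hU, hσ, Bool.false_eq_true, if_false, Set.mem_ofPred_eq, Complex.neg_re]
        constructor <;> intro h <;> linarith
      rw [this]
      exact convex_halfSpace_re_lt _
    · exact convex_halfSpace_re_gt _
  ext i j
  have hg : AnalyticOnNhd ℂ (fun x => facSum h a (σ x) i j) U := fun y hy =>
    (matAnalyticAt_facSum ha hh h1 hl (x := σ y) hy).comp (hσa y) i j
  set x₀ : ℂ := σ ((max R (lam + 3) + 1 : ℝ) : ℂ) with hx₀
  have hx₀' : σ x₀ = ((max R (lam + 3) + 1 : ℝ) : ℂ) := hσσ _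
  have hx₀U : x₀ ∈ U := by
    change lam + 3 < (σ x₀).re
    rw [hx₀', Complex.ofReal_re]
    linarith [le_max_right R (lam + 3)]
  have h0 : (fun x => (A i j).eval (RingHom.id ℂ) x) =ᶠ[𝓝 x₀] fun x => facSum h a (σ x) i j := by
    have hev : ∀ᶠ y in 𝓝 x₀, R < (σ y).re := by
      refine (Complex.continuous_re.continuousAt.comp (hσa x₀).continuousAt).eventually
        (lt_mem_nhds ?_)
      change R < (σ x₀).re
      rw [hx₀', Complex.ofReal_re]
      linarith [le_max_left R (lam + 3)]
    refine hev.mono fun y hy => ?_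
    have h2 : facSum h a (σ y) = evalMat A (σ (σ y)) := hA (σ y) hy
    rw [hσσ] at h2
    exact congrArg (fun M : CMat n => M i j) h2.symm
  have := (RatFunc.eval_eq_of_analytic hg hUc.isPreconnected hx₀U h0 (x := σ x) (by
    change lam + 3 < (σ (σ x)).re
    rwa [hσσ])).2
  rw [hσσ] at this
  exact this.symm

/-- The first kind of confluence gives local data. -/
theorem LocalConfluence.exists_localData {plus : Bool} {h₀ : ℝ} (hh₀ : 0 < h₀)
    {A : ℝ → RatMat n} {At : RatMat n}
    (H : LocalConfluence h₀ (fun h x => evalMat (A h) (if plus then x else -x))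
      fun x => evalMat At (if plus then x else -x)) :
    ∃ a a₀ C lam, LocalData plus A a a₀ C lam ∧ HasValueAtInfinity At (a₀ 0) := by
  obtain ⟨a, a₀, hexp, ⟨C, lam, hC, hlam, ⟨h₁, hh₁, htype⟩, -⟩, hlim, ⟨R, hAt⟩, hJ, hnr⟩ := H
  set lam' := max lam 1 with hlam'
  have hl1 : 1 ≤ lam' := le_max_right _ _
  have hIoo : ∀ b : ℝ, 0 < b → ∀ᶠ h in 𝓝[>] (0 : ℝ), h ∈ Set.Ioo 0 b := fun b hb =>
    Ioo_mem_nhdsGT hb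
  -- Passing from bounds on the entries to the operator norm costs a factor n; enlarging lam is
  -- allowed because rising factorials are monotone.
  have htyped : ∀ᶠ h in 𝓝[>] (0 : ℝ), IsTyped h (n * C) lam' (a h) := by
    filter_upwards [hIoo h₁ hh₁.1] with h hh
    have h1 : IsTyped h (n * C) lam (a h) := fun s => by
      have h2 : 0 ≤ hRising h lam s := hRising_nonneg hh.1.le hlam s
      rw [mul_assoc]
      exact norm_le_of_forall_entry_le (by positivity) fun i j => by
        simpa using htype h hh (s + 1) (by omega) i j
    exact h1.mono hh.1.le hlam le_rfl (le_max_left _ _)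
  have heq : ∀ᶠ h in 𝓝[>] (0 : ℝ), ∃ R : ℝ, ∀ x : ℂ, R < x.re →
      facSum h (a h) x = evalMat (A h) (if plus then x else -x) := by
    filter_upwards [hIoo h₀ hh₀] with h hh
    obtain ⟨R, hR⟩ := hexp h hh
    exact ⟨R, fun x hx => (hR x hx).tsum_eq⟩
  refine ⟨a, a₀, n * C, lam', ⟨hl1, htyped, hlim, ?_, ?_, ?_, fun m hm X hX => hnr.eq_zero hm hX⟩,
    ?_⟩
  · filter_upwards [htyped, heq, eventually_pos_le_one] with h h1 h2 h3 x hx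
    obtain ⟨R, hR⟩ := h2
    exact evalMat_eq_of_facSum h1 h3.1.le h3.2 hl1 hR hx
  · obtain ⟨St, Jt, S, J, -, hSJ, -, -⟩ := hJ
    exact hSJ.mono fun h hh => ⟨_, _, hh⟩
  · filter_upwards [htyped, heq, eventually_pos_le_one] with h h1 h2 h3
    obtain ⟨R, hR⟩ := h2
    exact hasValueAtInfinity_of_facSum h1 h3.1.le (by linarith) hR
  · refine hasValueAtInfinity_of_tendsto (tendsto_signedRay plus) ?_
    have h1 := tendsto_tsum_inv_pow (c₀ := a₀) (R := R) (fun x hx => (hAt x (hx.trans_le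
      ((le_abs_self _).trans (Complex.abs_re_le_norm x)))).summable) 0
    refine h1.congr' ?_
    filter_upwards [eventually_gt_atTop |R|] with t ht
    rw [zero_add]
    refine (hAt t ?_).tsum_eq
    rw [Complex.norm_of_nonneg ((abs_nonneg R).trans ht.le)]
    exact (le_abs_self R).trans_lt ht

end FactorialCase

end

noncomputable section

/-! ### Series of factorials of functions holomorphic at infinity -/

section Cauchy

variable {E : Type*} [NormedAddCommGroup E] [NormedSpace ℂ E] [CompleteSpace E]

/-- The coefficients of the expansion in a series of `h`-factorials of a function that is
holomorphic on `{ρ ≤ |x|}` and at infinity, with value `v` there. -/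
def cauchyFacCoeff (ρ h : ℝ) (f : ℂ → E) (v : E) : ℕ → E
  | 0 => v
  | s + 1 => (2 * Real.pi * Complex.I : ℂ)⁻¹ •
      ∮ w in C(0, ρ⁻¹), (w⁻¹ ^ 2 * hRising (h : ℂ) w⁻¹ s) • f w⁻¹

theorem norm_circle_inv {ρ : ℝ} {w : ℂ} (hw : w ∈ Metric.sphere (0 : ℂ) ρ⁻¹) :
    ‖w⁻¹‖ = ρ := by
  rw [mem_sphere_zero_iff_norm] at hw
  rw [norm_inv, hw, inv_inv]

omit [CompleteSpace E] in
-- With t = 1/w of modulus ρ, the integrand is at most ρ² ρ^{[s]} M, and the circle in w has radius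
-- 1/ρ.
theorem isTyped_cauchyFacCoeff {ρ h M : ℝ} (hρ : 0 < ρ) (hh : 0 ≤ h) {f : ℂ → E} {v : E}
    (hM : ∀ x, ‖x‖ = ρ → ‖f x‖ ≤ M) : IsTyped h (ρ * M) ρ (cauchyFacCoeff ρ h f v) := by
  intro s
  have hM0 : 0 ≤ M := (norm_nonneg _).trans (hM (ρ : ℂ) (by simp [abs_of_pos hρ]))
  have h1 := circleIntegral.norm_two_pi_i_inv_smul_integral_le_of_norm_le_const (c := 0) (R := ρ⁻¹)
    (C := ρ ^ 2 * hRising h ρ s * M) (inv_pos.2 hρ).le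
    (f := fun w => (w⁻¹ ^ 2 * hRising (h : ℂ) w⁻¹ s) • f w⁻¹) (fun w hw => by
      have h2 := norm_circle_inv hw
      rw [norm_smul, norm_mul, norm_pow, h2]
      have h3 := norm_hRising_le hh w⁻¹ s
      rw [h2] at h3
      exact mul_le_mul (mul_le_mul_of_nonneg_left h3 (by positivity)) (hM _ h2) (norm_nonneg _)
        (mul_nonneg (by positivity) (hRising_nonneg hh hρ.le s)))
  refine h1.trans (le_of_eq ?_)
  field_simp

/-- The function w ↦ f(1/w), extended by v at 0, is holomorphic on the disc of radius 1/ρ. The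
difference of its Cauchy formulas at 1/x and at 0 is the integral of w⁻² (x - 1/w)⁻¹ f(1/w), and
expanding 1/(x - t) at t = 1/w in h-factorials under the integral gives the coefficients. -/
theorem facSum_cauchyFacCoeff {ρ h M : ℝ} (hρ : 0 < ρ) (hh : 0 < h) {f : ℂ → E} {v : E}
    (hM : ∀ x, ‖x‖ = ρ → ‖f x‖ ≤ M) (hd : ∀ x, ρ ≤ ‖x‖ → DifferentiableAt ℂ f x)
    (hv : Tendsto f (Bornology.cobounded ℂ) (𝓝 v)) {x : ℂ} (hx : ρ + h < x.re) :
    facSum h (cauchyFacCoeff ρ h f v) x = f x := by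
  have hρi : 0 < ρ⁻¹ := inv_pos.2 hρ
  have hxρ : ρ < ‖x‖ := by
    linarith [(le_abs_self _).trans (Complex.abs_re_le_norm x)]
  have hx0 : x ≠ 0 := norm_pos_iff.1 (hρ.trans hxρ)
  set G : ℂ → E := Function.update (fun w => f w⁻¹) 0 v with hG
  have hG0 : G 0 = v := by simp [hG]
  have hGne : ∀ w, w ≠ 0 → G w = f w⁻¹ := fun w hw => by simp [hG, hw]
  have hGd' : ∀ w ∈ Metric.closedBall (0 : ℂ) ρ⁻¹, w ≠ 0 → DifferentiableAt ℂ G w := by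
    intro w hw hw0
    have h1 : DifferentiableAt ℂ (fun w => f w⁻¹) w := by
      refine DifferentiableAt.fun_comp' (g := f) w (hd _ ?_) (differentiableAt_inv hw0)
      rw [mem_closedBall_zero_iff] at hw
      rw [norm_inv]
      exact (le_inv_comm₀ hρ (norm_pos_iff.2 hw0)).2 hw
    refine h1.congr_of_eventuallyEq ?_
    exact (isOpen_ne.mem_nhds hw0 : {w : ℂ | w ≠ 0} ∈ 𝓝 w) |> fun h => mem_of_superset h hGne
  have hGc : ContinuousAt G 0 := by
    rw [continuousAt_update_same]
    exact hv.comp tendsto_inv₀_nhdsNE_zero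
  have hGd : DifferentiableOn ℂ G (Metric.closedBall 0 ρ⁻¹) := by
    intro w hw
    by_cases hw0 : w = 0
    · rw [hw0]
      refine (Complex.analyticAt_of_differentiable_on_punctured_nhds_of_continuousAt ?_
        hGc).differentiableAt.differentiableWithinAt
      filter_upwards [self_mem_nhdsWithin,
        nhdsWithin_le_nhds (Metric.closedBall_mem_nhds (0 : ℂ) hρi)] with y h1 h2
      exact hGd' y h2 h1
    · exact (hGd' w hw hw0).differentiableWithinAt
  have hxi : x⁻¹ ∈ Metric.ball (0 : ℂ) ρ⁻¹ := by
    rw [mem_ball_zero_iff, norm_inv]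
    exact inv_strictAnti₀ hρ hxρ
  have hc1 := hGd.circleIntegral_sub_inv_smul hxi
  have hc0 := hGd.circleIntegral_sub_inv_smul (Metric.mem_ball_self hρi)
  rw [hGne _ (inv_ne_zero hx0), inv_inv] at hc1
  rw [hG0] at hc0
  have hGcont : ContinuousOn G (Metric.sphere 0 ρ⁻¹) :=
    hGd.continuousOn.mono Metric.sphere_subset_closedBall
  have hsph0 : ∀ w ∈ Metric.sphere (0 : ℂ) ρ⁻¹, w ≠ 0 := fun w hw h0 => by
    rw [h0, mem_sphere_zero_iff_norm, norm_zero] at hw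
    exact hρi.ne hw
  have hci : ∀ y ∈ Metric.ball (0 : ℂ) ρ⁻¹,
      CircleIntegrable (fun w => (w - y)⁻¹ • G w) 0 ρ⁻¹ := fun y hy =>
    ContinuousOn.circleIntegrable hρi.le (ContinuousOn.smul (ContinuousOn.inv₀ (by fun_prop)
      (fun w hw h0 => by
        rw [sub_eq_zero.1 h0] at hw
        exact absurd (mem_sphere_zero_iff_norm.1 hw) (mem_ball_zero_iff.1 hy).ne)) hGcont)
  have hdiff : (∮ w in C(0, ρ⁻¹), (w⁻¹ ^ 2 * (1 / (x - w⁻¹))) • f w⁻¹) =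
      (2 * Real.pi * Complex.I : ℂ) • (f x - v) := by
    rw [smul_sub, ← hc1, ← hc0, ← circleIntegral.integral_sub (hci _ hxi)
      (hci _ (Metric.mem_ball_self hρi))]
    refine circleIntegral.integral_congr hρi.le fun w hw => ?_
    have hw0 := hsph0 w hw
    have h1 : x - w⁻¹ ≠ 0 := by
      intro h0
      have := norm_circle_inv hw
      rw [← sub_eq_zero.1 h0] at this
      linarith
    have h2 : w - x⁻¹ ≠ 0 := by
      intro h0
      apply h1
      rw [sub_eq_zero.1 h0, inv_inv, sub_self]
    have h3 : x * w - 1 ≠ 0 := by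
      intro h0
      apply h1
      field_simp
      rw [h0, mul_zero]
    rw [hGne w hw0, ← sub_smul]
    congr 1
    rw [sub_zero]
    have e1 : x - w⁻¹ = (x * w - 1) / w := by field_simp
    have e2 : w - x⁻¹ = (x * w - 1) / x := by field_simp
    rw [e1, e2]
    obtain ⟨u, hu⟩ : ∃ u, u = x * w - 1 := ⟨_, rfl⟩
    rw [← hu] at h3 ⊢
    field_simp
    linear_combination hu
  have hsum : HasSum (fun s => ∮ w in C(0, ρ⁻¹),
      (w⁻¹ ^ 2 * (hRising (h : ℂ) w⁻¹ s / hRising (h : ℂ) x (s + 1))) • f w⁻¹)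
      (∮ w in C(0, ρ⁻¹), (w⁻¹ ^ 2 * (1 / (x - w⁻¹))) • f w⁻¹) := by
    have hsm := summable_hRising_div hh.le hρ.le (show ρ < x.re by linarith)
    have hmem : ∀ θ, circleMap 0 ρ⁻¹ θ ∈ Metric.sphere (0 : ℂ) ρ⁻¹ := fun θ =>
      circleMap_mem_sphere 0 hρi.le θ
    refine intervalIntegral.hasSum_integral_of_dominated_convergence
      (fun s _ => ρ⁻¹ * (ρ ^ 2 * (hRising h ρ s / hRising h x.re (s + 1)) * M)) ?_ ?_ ?_ ?_ ?_
    · intro s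
      refine Continuous.aestronglyMeasurable ?_
      have hcm := continuous_circleMap 0 ρ⁻¹
      have hinv : Continuous fun θ => (circleMap 0 ρ⁻¹ θ)⁻¹ :=
        hcm.inv₀ fun θ => hsph0 _ (hmem θ)
      have hf : Continuous fun θ => f (circleMap 0 ρ⁻¹ θ)⁻¹ := by
        have := hGcont.comp_continuous hcm hmem
        refine this.congr fun θ => hGne _ (hsph0 _ (hmem θ))
      have hr : Continuous fun θ => hRising (h : ℂ) (circleMap 0 ρ⁻¹ θ)⁻¹ s := by
        unfold hRising
        fun_prop
      simp only [deriv_circleMap]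
      exact (hcm.mul continuous_const).smul (((hinv.pow 2).mul (hr.div_const _)).smul hf)
    · intro s
      refine Eventually.of_forall fun θ _ => ?_
      have h2 := norm_circle_inv (hmem θ)
      simp only [deriv_circleMap, norm_smul, norm_mul, norm_pow, norm_div, h2,
        norm_circleMap_zero, Complex.norm_I, mul_one, abs_of_pos hρi]
      have h3 := norm_hRising_le hh.le (circleMap 0 ρ⁻¹ θ)⁻¹ s
      rw [h2] at h3
      have h4 := hRising_re_le_norm hh.le (x := x) (by linarith) (s + 1)
      have h5 : 0 < hRising h x.re (s + 1) := hRising_pos hh.le (by linarith) _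
      have h6 := hM _ h2
      have h7 : 0 ≤ hRising h ρ s := hRising_nonneg hh.le hρ.le s
      gcongr
    · refine Eventually.of_forall fun θ _ => ?_
      exact ((hsm.mul_left _).mul_right _).mul_left _
    · exact intervalIntegrable_const
    · refine Eventually.of_forall fun θ _ => ?_
      have h2 := norm_circle_inv (hmem θ)
      have h3 := hasSum_hRising_div hh (t := (circleMap 0 ρ⁻¹ θ)⁻¹) (x := x) (by rw [h2]; exact hx)
      exact ((h3.mul_left _).smul_const _).const_smul _
  have hfin : HasSum (fun s => facTerm h (cauchyFacCoeff ρ h f v) x (s + 1)) (f x - v) := by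
    have h1 := hsum.const_smul (2 * Real.pi * Complex.I : ℂ)⁻¹
    rw [hdiff, smul_smul, inv_mul_cancel₀ Complex.two_pi_I_ne_zero, one_smul] at h1
    refine HasSum.of_eq h1 fun s => ?_
    rw [facTerm, cauchyFacCoeff, smul_comm, ← circleIntegral.integral_smul]
    congr 2
    funext w
    rw [smul_smul]
    congr 1
    rw [div_eq_mul_inv]
    ring
  have := (hasSum_nat_add_iff' (f := facTerm h (cauchyFacCoeff ρ h f v) x) 1).1 (by
    rw [Finset.sum_range_one, facTerm_zero]
    exact hfin)
  exact this.tsum_eq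

theorem tendsto_hRising_pow (x : ℂ) (s : ℕ) :
    Tendsto (fun h : ℝ => hRising (h : ℂ) x s) (𝓝[>] 0) (𝓝 (x ^ s)) := by
  have h1 : Continuous fun h : ℝ => hRising (h : ℂ) x s := by
    unfold hRising
    fun_prop
  have h2 : hRising ((0 : ℝ) : ℂ) x s = x ^ s := by simp [hRising]
  have := (h1.tendsto 0).mono_left (nhdsWithin_le_nhds (s := Set.Ioi 0))
  rwa [h2] at this

-- For h = 0 the rising factorials are powers, so the limit has the form of a coefficient of the
-- expansion in powers of 1/x. For h ≤ 1 the integrands are dominated by their majorants at h = 1.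
omit [CompleteSpace E] in
theorem tendsto_cauchyFacCoeff {ρ M : ℝ} (hρ : 0 < ρ) {f : ℝ → ℂ → E} {f₀ : ℂ → E} {v : ℝ → E}
    {v₀ : E} (hM : ∀ᶠ h in 𝓝[>] (0 : ℝ), ∀ x, ‖x‖ = ρ → ‖f h x‖ ≤ M)
    (hc : ∀ᶠ h in 𝓝[>] (0 : ℝ), ContinuousOn (f h) (Metric.sphere 0 ρ))
    (hlim : ∀ x, ‖x‖ = ρ → Tendsto (fun h => f h x) (𝓝[>] 0) (𝓝 (f₀ x)))
    (hv : Tendsto v (𝓝[>] 0) (𝓝 v₀)) (s : ℕ) :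
    Tendsto (fun h => cauchyFacCoeff ρ h (f h) (v h) s) (𝓝[>] 0)
      (𝓝 (cauchyFacCoeff ρ 0 f₀ v₀ s)) := by
  cases s with
  | zero => exact hv
  | succ s =>
    have hρi : 0 < ρ⁻¹ := inv_pos.2 hρ
    have hmem : ∀ θ, circleMap 0 ρ⁻¹ θ ∈ Metric.sphere (0 : ℂ) ρ⁻¹ := fun θ =>
      circleMap_mem_sphere 0 hρi.le θ
    have hne : ∀ θ, circleMap 0 ρ⁻¹ θ ≠ 0 := fun θ => circleMap_ne_center hρi.ne'
    simp only [cauchyFacCoeff]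
    refine Tendsto.const_smul ?_ _
    refine intervalIntegral.tendsto_integral_filter_of_dominated_convergence
      (fun _ => ρ⁻¹ * (ρ ^ 2 * hRising 1 ρ s * M)) ?_ ?_ intervalIntegrable_const ?_
    · filter_upwards [hc] with h hh
      refine Continuous.aestronglyMeasurable ?_
      have hcm := continuous_circleMap 0 ρ⁻¹
      have hinv : Continuous fun θ => (circleMap 0 ρ⁻¹ θ)⁻¹ := hcm.inv₀ hne
      have hf : Continuous fun θ => f h (circleMap 0 ρ⁻¹ θ)⁻¹ :=
        hh.comp_continuous hinv fun θ =>
          mem_sphere_zero_iff_norm.2 (norm_circle_inv (hmem θ))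
      have hr : Continuous fun θ => hRising (h : ℂ) (circleMap 0 ρ⁻¹ θ)⁻¹ s := by
        unfold hRising
        fun_prop
      simp only [deriv_circleMap]
      exact (hcm.mul continuous_const).smul (((hinv.pow 2).mul hr).smul hf)
    · filter_upwards [hM, eventually_pos_le_one] with h h1 hh
      refine Eventually.of_forall fun θ _ => ?_
      have h2 := norm_circle_inv (hmem θ)
      simp only [deriv_circleMap, norm_smul, norm_mul, norm_pow, h2,
        norm_circleMap_zero, Complex.norm_I, mul_one, abs_of_pos hρi]
      have h3 := norm_hRising_le hh.1.le (circleMap 0 ρ⁻¹ θ)⁻¹ s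
      rw [h2] at h3
      have h4 : hRising h ρ s ≤ hRising 1 ρ s := by
        unfold hRising
        refine Finset.prod_le_prod (fun k _ => by have := hh.1.le; positivity) fun k _ => ?_
        gcongr
        exact hh.2
      have h6 := h1 _ h2
      have h7 : 0 ≤ hRising 1 ρ s := hRising_nonneg zero_le_one hρ.le s
      have h8 := h3.trans h4
      gcongr
    · refine Eventually.of_forall fun θ _ => ?_
      have h2 := norm_circle_inv (hmem θ)
      have h3 : hRising ((0 : ℝ) : ℂ) (circleMap 0 ρ⁻¹ θ)⁻¹ s = (circleMap 0 ρ⁻¹ θ)⁻¹ ^ s := by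
        simp [hRising]
      beta_reduce
      rw [h3]
      exact (((tendsto_hRising_pow _ s).const_mul _).smul (hlim _ h2)).const_smul _

end Cauchy

end

noncomputable section

/-! ### Local data from confluence of the second kind -/

section UniformCase

attribute [local instance] Matrix.linftyOpNormedRing Matrix.linftyOpNormedAlgebra

variable {n : ℕ}

theorem norm_signed (plus : Bool) (x : ℂ) : ‖(if plus then x else -x)‖ = ‖x‖ := by
  cases plus <;> simp

theorem tendsto_signed_cobounded (plus : Bool) :
    Tendsto (fun x : ℂ => if plus then x else -x) (Bornology.cobounded ℂ)
      (Bornology.cobounded ℂ) := by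
  refine tendsto_norm_atTop_iff_cobounded.1 ?_
  simp only [norm_signed]
  exact tendsto_norm_cobounded_atTop

theorem exists_poleSet_subset_ball (A : RatMat n) :
    ∃ ρ : ℝ, 1 ≤ ρ ∧ Disjoint (poleSet A) {x | ρ ≤ ‖x‖} := by
  obtain ⟨ρ, hρ⟩ := (finite_poleSet A).isBounded.exists_norm_le
  refine ⟨max 1 (ρ + 1), le_max_left _ _, Set.disjoint_left.2 fun x hx h => ?_⟩
  have h1 := hρ x hx
  have h2 : max 1 (ρ + 1) ≤ ‖x‖ := h
  linarith [le_max_right 1 (ρ + 1)]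

/-- The second kind of confluence gives local data. -/
theorem ConfluenceUniform.exists_localData {A : ℝ → RatMat n} {At : RatMat n}
    (H : ConfluenceUniform A At) (plus : Bool) :
    ∃ a a₀ C lam, LocalData plus A a a₀ C lam ∧ HasValueAtInfinity At (a₀ 0) := by
  obtain ⟨hunif, At₀, A₀, hAt₀, hnr, hA₀, hJ⟩ := H
  obtain ⟨ρ, hρ1, hρ⟩ := exists_poleSet_subset_ball At
  have hρ0 : 0 < ρ := by linarith
  set K : Set ℂ := {x | ρ ≤ ‖x‖} with hK
  have hKc : IsClosed K := isClosed_le continuous_const continuous_norm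
  have hconv := hunif K hKc hρ
  have hu := Metric.tendstoUniformlyOn_iff.1 hconv.tendstoUniformlyOn
  have hKmem : ∀ x : ℂ, ρ ≤ ‖x‖ → (if plus then x else -x) ∈ K := fun x hx => by
    change ρ ≤ ‖_‖
    rwa [norm_signed]
  have hsK : Metric.sphere (0 : ℂ) ρ ⊆ K := fun x hx => (mem_sphere_zero_iff_norm.1 hx).ge
  obtain ⟨M, hM⟩ := (isCompact_sphere (0 : ℂ) ρ).exists_bound_of_continuousOn
    ((continuousOn_evalMat hρ).mono hsK)
  -- The estimate of A h - At is uniform up to infinity; letting x tend to infinity gives the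
  -- convergence of the values there.
  have hA₀lim : Tendsto A₀ (𝓝[>] 0) (𝓝 At₀) := by
    refine Metric.tendsto_nhds.2 fun ε hε => ?_
    filter_upwards [hu (ε / 2) (by positivity), hA₀] with h h1 h2
    have h3 : Tendsto (fun x => dist (evalMat At x) (evalMat (A h) x)) (Bornology.cobounded ℂ)
        (𝓝 (dist At₀ (A₀ h))) := Tendsto.dist hAt₀ h2
    have h4 : dist At₀ (A₀ h) ≤ ε / 2 := by
      refine le_of_tendsto h3 ?_
      filter_upwards [tendsto_norm_cobounded_atTop.eventually (eventually_ge_atTop ρ)] with x hx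
      exact (h1 x hx).le
    rw [dist_comm]
    linarith
  set f : ℝ → ℂ → CMat n := fun h x => evalMat (A h) (if plus then x else -x) with hf
  set f₀ : ℂ → CMat n := fun x => evalMat At (if plus then x else -x) with hf₀
  have hfM : ∀ᶠ h in 𝓝[>] (0 : ℝ), ∀ x, ‖x‖ = ρ → ‖f h x‖ ≤ M + 1 := by
    filter_upwards [hu 1 one_pos] with h h1 x hx
    have h2 := h1 _ (hKmem x hx.ge)
    have h3 := hM (if plus then x else -x) (mem_sphere_zero_iff_norm.2 (by rwa [norm_signed]))
    rw [dist_comm, dist_eq_norm] at h2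
    calc ‖f h x‖ = ‖(f h x - f₀ x) + f₀ x‖ := by rw [sub_add_cancel]
      _ ≤ ‖f h x - f₀ x‖ + ‖f₀ x‖ := norm_add_le _ _
      _ ≤ M + 1 := by linarith
  have hfd : ∀ᶠ h in 𝓝[>] (0 : ℝ), ∀ x, ρ ≤ ‖x‖ → DifferentiableAt ℂ (f h) x := by
    filter_upwards [hconv.1] with h h1 x hx
    have h2 := (matAnalyticAt_evalMat
      (h1.notMem_of_mem_right (hKmem x hx))).analyticAt.differentiableAt
    refine DifferentiableAt.fun_comp' (g := evalMat (A h)) x h2 ?_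
    cases plus
    · simp only [Bool.false_eq_true, if_false]
      fun_prop
    · simp only [if_true]
      fun_prop
  have hfv : ∀ᶠ h in 𝓝[>] (0 : ℝ), Tendsto (f h) (Bornology.cobounded ℂ) (𝓝 (A₀ h)) :=
    hA₀.mono fun h h1 => Tendsto.comp (g := evalMat (A h)) h1 (tendsto_signed_cobounded plus)
  refine ⟨fun h => cauchyFacCoeff ρ h (f h) (A₀ h), cauchyFacCoeff ρ 0 f₀ At₀, ρ * (M + 1), ρ,
    ⟨hρ1, ?_, ?_, ?_, ?_, hA₀, fun m hm X hX => hnr.eq_zero hm hX⟩, hAt₀⟩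
  · filter_upwards [hfM, eventually_pos_le_one] with h h1 h2
    exact isTyped_cauchyFacCoeff hρ0 h2.1.le h1
  · refine tendsto_cauchyFacCoeff hρ0 hfM ?_ ?_ hA₀lim
    · filter_upwards [hfd] with h h1 x hx
      exact (h1 x (mem_sphere_zero_iff_norm.1 hx).ge).continuousAt.continuousWithinAt
    · intro x hx
      exact hconv.tendstoUniformlyOn.tendsto_at (hKmem x hx.ge)
  · filter_upwards [hfM, hfd, hfv, eventually_pos_le_one] with h h1 h2 h3 h4 x hx
    exact facSum_cauchyFacCoeff hρ0 h4.1 h1 h2 h3 (by linarith)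
  · obtain ⟨St, Jt, S, J, -, hSJ, -, -⟩ := hJ
    exact hSJ.mono fun h hh => ⟨_, _, hh⟩

/-- Both kinds of confluence give local data at both ends, and locally uniform convergence. -/
theorem exists_localData {h₀ : ℝ} (hh₀ : 0 < h₀) {A : ℝ → RatMat n} {At : RatMat n}
    (H : ConfluenceFactorial h₀ A At ∨ ConfluenceUniform A At) :
    (∀ plus : Bool, ∃ a a₀ C lam, LocalData plus A a a₀ C lam ∧ HasValueAtInfinity At (a₀ 0)) ∧
    ∀ K : Set ℂ, IsCompact K → Disjoint (poleSet At) K → ConvergesUniformlyOn A At K := by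
  rcases H with ⟨h1, h2, h3⟩ | H
  · refine ⟨fun plus => ?_, h3⟩
    cases plus
    · exact LocalConfluence.exists_localData hh₀ (plus := false) (by simpa using h2)
    · exact LocalConfluence.exists_localData hh₀ (plus := true) (by simpa using h1)
  · exact ⟨H.exists_localData, fun K hK => H.1 K hK.isClosed⟩

end UniformCase

end

noncomputable section

/-! ### Cut planes and strips -/

section Geometry

variable {n r : ℕ} {z : Fin r → ℂ}

theorem isOpen_cutPlus (z : Fin r → ℂ) : IsOpen (cutPlus z) := by
  have h1 : cutPlus z = ⋂ j, {x : ℂ | x.im = (z j).im ∧ x.re ≤ (z j).re}ᶜ := by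
    ext x
    simp [cutPlus]
  rw [h1]
  refine isOpen_iInter_of_finite fun j => IsClosed.isOpen_compl (self := ?_)
  exact (isClosed_eq Complex.continuous_im continuous_const).inter
    (isClosed_le Complex.continuous_re continuous_const)

theorem neg_mem_cutMinus {x : ℂ} : -x ∈ cutMinus z ↔ x ∈ cutPlus fun j => -z j := by
  simp [cutMinus, cutPlus, neg_eq_iff_eq_neg, neg_lt]

theorem isOpen_cutMinus (z : Fin r → ℂ) : IsOpen (cutMinus z) := by
  have h1 : cutMinus z = (fun x => -x) ⁻¹' cutPlus fun j => -z j := by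
    ext x
    rw [Set.mem_preimage, ← neg_mem_cutMinus, neg_neg]
  rw [h1]
  exact (isOpen_cutPlus _).preimage continuous_neg

theorem notMem_cutPlus (j : Fin r) : z j ∉ cutPlus z := fun h => h j ⟨rfl, le_rfl⟩

theorem isConfluenceDomain_cutPlus {plus : Bool} {At : RatMat n}
    (hzr : ∀ x, x ∈ Set.range z ↔ (if plus then x else -x) ∈ poleSet At ∪ {0}) :
    IsConfluenceDomain plus At (cutPlus z) where
  isOpen := isOpen_cutPlus z
  add_mem x hx t ht j hj := by
    simp only [Complex.add_im, Complex.ofReal_im, add_zero, Complex.add_re,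
      Complex.ofReal_re] at hj
    exact hx j ⟨hj.1, by linarith [hj.2]⟩
  exists_halfPlane := by
    obtain ⟨R, hR⟩ := (Set.finite_range fun j => (z j).re).bddAbove
    refine ⟨R, fun x hx j hj => ?_⟩
    have : (z j).re ≤ R := hR ⟨j, rfl⟩
    linarith [hj.2]
  zero_notMem h := by
    obtain ⟨j, hj⟩ := (hzr 0).2 (by right; cases plus <;> simp)
    exact notMem_cutPlus j (hj ▸ h)
  notMem_poleSet x hx hp := by
    obtain ⟨j, rfl⟩ := (hzr x).2 (Or.inl hp)
    exact notMem_cutPlus j hx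

theorem strip_subset_cutPlus (k : Fin (r + 1)) : strip z k ⊆ cutPlus z := fun x hx j hj => by
  rcases lt_or_ge j.castSucc k with h | h
  · exact ((hx j).1 h).ne' hj.1
  · exact ((hx j).2 h).ne hj.1

theorem strip_subset_cutMinus (k : Fin (r + 1)) : strip z k ⊆ cutMinus z := fun x hx j hj => by
  rcases lt_or_ge j.castSucc k with h | h
  · exact ((hx j).1 h).ne' hj.1
  · exact ((hx j).2 h).ne hj.1

theorem strip_eq_iInter (k : Fin (r + 1)) :
    strip z k = ⋂ j : Fin r, if j.castSucc < k then {x : ℂ | (z j).im < x.im}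
      else {x : ℂ | x.im < (z j).im} := by
  ext x
  simp only [strip, Set.mem_iInter, Set.mem_ofPred_eq]
  refine forall_congr' fun j => ?_
  by_cases h : j.castSucc < k
  · simp [h, not_le.2 h]
  · simp [h, not_lt.1 h]

theorem isOpen_strip (k : Fin (r + 1)) : IsOpen (strip z k) := by
  rw [strip_eq_iInter]
  refine isOpen_iInter_of_finite fun j => ?_
  split_ifs
  · exact isOpen_lt continuous_const Complex.continuous_im
  · exact isOpen_lt Complex.continuous_im continuous_const

theorem convex_strip (k : Fin (r + 1)) : Convex ℝ (strip z k) := by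
  rw [strip_eq_iInter]
  refine convex_iInter fun j => ?_
  split_ifs
  · exact convex_halfSpace_im_gt _
  · exact convex_halfSpace_im_lt _

/-- The gap serves as a radius: the disc of radius ε about z j meets no line z i + ℝ other than its
own, hence no cut but those issued from z j. -/
theorem exists_im_gap (hz : StrictMono fun j => (z j).im) (j : Fin r) :
    ∃ ε : ℝ, 0 < ε ∧ ∀ i, i ≠ j → ε ≤ |(z i).im - (z j).im| := by
  have h1 : ∀ᶠ ε in 𝓝[>] (0 : ℝ), ∀ i, i ≠ j → ε ≤ |(z i).im - (z j).im| := by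
    refine eventually_all.2 fun i => ?_
    by_cases hij : i = j
    · exact Eventually.of_forall fun _ h => absurd hij h
    · have h2 : 0 < |(z i).im - (z j).im| := abs_pos.2 (sub_ne_zero.2 fun h => hij (hz.injective h))
      filter_upwards [nhdsWithin_le_nhds (Iic_mem_nhds h2)] with _ h _ using h
  obtain ⟨ε, h, h0⟩ := (h1.and self_mem_nhdsWithin).exists
  exact ⟨ε, h0, h⟩

variable {j : Fin r} {ε : ℝ} {x : ℂ}

theorem mem_cutPlus_of_norm_lt (hε : ∀ i, i ≠ j → ε ≤ |(z i).im - (z j).im|)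
    (hx : ‖x - z j‖ < ε) (hj : ¬ (x.im = (z j).im ∧ x.re ≤ (z j).re)) : x ∈ cutPlus z := by
  intro i hi
  by_cases hij : i = j
  · exact hj (hij ▸ hi)
  · have h1 := (Complex.abs_im_le_norm (x - z j)).trans_lt hx
    rw [Complex.sub_im, hi.1] at h1
    exact (hε i hij).not_gt h1

theorem mem_cutMinus_of_norm_lt (hε : ∀ i, i ≠ j → ε ≤ |(z i).im - (z j).im|)
    (hx : ‖x - z j‖ < ε) (hj : ¬ (x.im = (z j).im ∧ (z j).re ≤ x.re)) : x ∈ cutMinus z := by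
  intro i hi
  by_cases hij : i = j
  · exact hj (hij ▸ hi)
  · have h1 := (Complex.abs_im_le_norm (x - z j)).trans_lt hx
    rw [Complex.sub_im, hi.1] at h1
    exact (hε i hij).not_gt h1

theorem mem_strip_succ (hz : StrictMono fun j => (z j).im)
    (hε : ∀ i, i ≠ j → ε ≤ |(z i).im - (z j).im|) (hx : ‖x - z j‖ < ε) (hj : (z j).im < x.im) :
    x ∈ strip z j.succ := by
  have h1 := (Complex.abs_im_le_norm (x - z j)).trans_lt hx
  rw [Complex.sub_im, abs_of_pos (by linarith)] at h1
  refine fun i => ⟨fun hi => ?_, fun hi => ?_⟩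
  · exact (hz.monotone (Fin.castSucc_lt_succ_iff.1 hi)).trans_lt hj
  · have h2 : j < i := Fin.succ_le_castSucc_iff.1 hi
    have h3 := hε i h2.ne'
    rw [abs_of_pos (by linarith [show (z j).im < (z i).im from hz h2])] at h3
    linarith

theorem mem_strip_castSucc (hz : StrictMono fun j => (z j).im)
    (hε : ∀ i, i ≠ j → ε ≤ |(z i).im - (z j).im|) (hx : ‖x - z j‖ < ε) (hj : x.im < (z j).im) :
    x ∈ strip z j.castSucc := by
  have h1 := (Complex.abs_im_le_norm (x - z j)).trans_lt hx
  rw [Complex.sub_im, abs_of_neg (by linarith)] at h1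
  refine fun i => ⟨fun hi => ?_, fun hi => ?_⟩
  · have h2 : i < j := Fin.castSucc_lt_castSucc_iff.1 hi
    have h3 := hε i h2.ne
    rw [abs_of_neg (by linarith [show (z i).im < (z j).im from hz h2])] at h3
    linarith
  · exact hj.trans_le (hz.monotone (Fin.castSucc_le_castSucc_iff.1 hi))

theorem strip_nonempty (hz : StrictMono fun j => (z j).im) (hr : 0 < r) (k : Fin (r + 1)) :
    (strip z k).Nonempty := by
  have key : ∀ (j : Fin r) (σ : ℝ), |σ| = 1 → ∃ ε : ℝ, 0 < ε ∧
      (∀ i, i ≠ j → ε ≤ |(z i).im - (z j).im|) ∧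
      ‖(z j + (σ * (ε / 2) : ℝ) * Complex.I) - z j‖ < ε := fun j σ hσ => by
    obtain ⟨ε, hε, h⟩ := exists_im_gap hz j
    refine ⟨ε, hε, h, ?_⟩
    rw [add_sub_cancel_left, norm_mul, Complex.norm_I, mul_one, Complex.norm_real,
      Real.norm_eq_abs, abs_mul, hσ, abs_of_pos (by positivity)]
    linarith
  rcases Fin.eq_zero_or_eq_succ k with rfl | ⟨j, rfl⟩
  · obtain ⟨ε, hε, h, h1⟩ := key ⟨0, hr⟩ (-1) (by simp)
    exact ⟨_, mem_strip_castSucc (j := ⟨0, hr⟩) hz h h1 (by simp; positivity)⟩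
  · obtain ⟨ε, hε, h, h1⟩ := key j 1 (by simp)
    exact ⟨_, mem_strip_succ hz h h1 (by simp; positivity)⟩

end Geometry

/-! ### Connection matrices and monodromy of differential systems -/

section Monodromy

attribute [local instance] Matrix.linftyOpNormedRing Matrix.linftyOpNormedAlgebra

variable {n : ℕ}

theorem hasDerivAt_matrix_inv {E : ℂ → CMat n} {E' : CMat n} {x : ℂ} (hE : HasDerivAt E E' x)
    (hu : IsUnit (E x).det) :
    HasDerivAt (fun y => (E y)⁻¹) (-((E x)⁻¹ * E' * (E x)⁻¹)) x := by
  obtain ⟨u, hu'⟩ := (Matrix.isUnit_iff_isUnit_det _).2 hu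
  have h1 := hasFDerivAt_ringInverse (𝕜 := ℂ) u
  rw [hu'] at h1
  have h2 := h1.comp_hasDerivAt x hE
  have h3 : ((u⁻¹ : (CMat n)ˣ) : CMat n) = (E x)⁻¹ := by rw [Matrix.coe_units_inv, hu']
  rw [h3] at h2
  simp only [Function.comp_def, ← Matrix.nonsing_inv_eq_ringInverse] at h2
  exact h2

/-- The derivative of E₁⁻¹ E₂ is -E₁⁻¹ Q E₂ + E₁⁻¹ Q E₂ = 0. -/
theorem inv_mul_eq_of_hasDerivAt {U : Set ℂ} (hU : IsOpen U) (hUc : IsPreconnected U)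
    {Q E₁ E₂ : ℂ → CMat n} (h₁ : ∀ x ∈ U, HasDerivAt E₁ (Q x * E₁ x) x ∧ IsUnit (E₁ x).det)
    (h₂ : ∀ x ∈ U, HasDerivAt E₂ (Q x * E₂ x) x) {x y : ℂ} (hx : x ∈ U) (hy : y ∈ U) :
    (E₁ x)⁻¹ * E₂ x = (E₁ y)⁻¹ * E₂ y := by
  have hd : ∀ x ∈ U, HasDerivAt (fun x => (E₁ x)⁻¹ * E₂ x) 0 x := fun x hx => by
    have h3 := (hasDerivAt_matrix_inv (h₁ x hx).1 (h₁ x hx).2).mul (h₂ x hx)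
    refine h3.congr_deriv ?_
    have h4 : (E₁ x) * (E₁ x)⁻¹ = 1 := Matrix.mul_nonsing_inv _ (h₁ x hx).2
    rw [mul_assoc (E₁ x)⁻¹, mul_assoc (Q x), h4, mul_one, neg_mul, mul_assoc, neg_add_cancel]
  exact hU.is_const_of_deriv_eq_zero hUc
    (fun x hx => (hd x hx).differentiableAt.differentiableWithinAt)
    (fun x hx => (hd x hx).deriv) hx hy

theorem HasDerivAt.matrix_entry {E : ℂ → CMat n} {E' : CMat n} {x : ℂ} (hE : HasDerivAt E E' x)
    (i j : Fin n) : HasDerivAt (fun y => E y i j) (E' i j) x :=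
  (LinearMap.toContinuousLinearMap (Matrix.entryLinearMap ℂ ℂ i j)).hasFDerivAt.comp_hasDerivAt x hE

theorem matAnalyticAt_of_hasDerivAt {U : Set ℂ} (hU : IsOpen U) {E E' : ℂ → CMat n}
    (hE : ∀ x ∈ U, HasDerivAt E (E' x) x) {x : ℂ} (hx : x ∈ U) : MatAnalyticAt E x := by
  have h1 : DifferentiableOn ℂ E U := fun y hy => (hE y hy).differentiableAt.differentiableWithinAt
  exact (h1.analyticAt (hU.mem_nhds hx)).matAnalyticAt

theorem MatAnalyticAt.mul_const {E : ℂ → CMat n} {x : ℂ} (hE : MatAnalyticAt E x) (M : CMat n) :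
    MatAnalyticAt (fun y => E y * M) x :=
  (hE.analyticAt.mul analyticAt_const).matAnalyticAt

/-- If two functions are analytic around `p` outside the left and the right ray issued from `p`
respectively, and are related by constant matrices on the two half-discs, then these matrices give
the monodromy around `p`. -/
theorem isMonodromyAround_of_connection {p : ℂ} {U V : Set ℂ} {Ep Em : ℂ → CMat n}
    {Pl Pu : CMat n} {ε : ℝ} (hε : 0 < ε)
    (hUp : ∀ x ∈ U, ¬ (x.im = p.im ∧ x.re ≤ p.re))
    (hU : ∀ x, ‖x - p‖ < ε → ¬ (x.im = p.im ∧ x.re ≤ p.re) → x ∈ U)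
    (hV : ∀ x, ‖x - p‖ < ε → ¬ (x.im = p.im ∧ p.re ≤ x.re) → x ∈ V)
    (hEp : ∀ x ∈ U, MatAnalyticAt Ep x) (hEm : ∀ x ∈ V, MatAnalyticAt Em x)
    (hu : ∀ x, ‖x - p‖ < ε → p.im < x.im → Ep x = Em x * Pu⁻¹)
    (hl : ∀ x, ‖x - p‖ < ε → x.im < p.im → Em x = Ep x * Pl) :
    IsMonodromyAround p U Ep (Pl * Pu⁻¹) := by
  refine ⟨ε, hε, fun x hxU hx0 hxε => ?_⟩
  set θ := (x - p).arg with hθ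
  set ρ := ‖x - p‖ with hρ
  have hxp : x - p = ρ * Complex.exp (θ * Complex.I) := (Complex.norm_mul_exp_arg_mul_I _).symm
  set φ : ℝ → ℝ := fun t => θ + 2 * Real.pi * t with hφ
  set γ : ℝ → ℂ := fun t => p + (x - p) * Complex.exp (2 * Real.pi * Complex.I * t) with hγ
  have hγφ : ∀ t, γ t - p = ρ * Complex.exp ((φ t : ℝ) * Complex.I) := fun t => by
    simp only [hγ, hφ, add_sub_cancel_left]
    rw [hxp, mul_assoc, ← Complex.exp_add]
    congr 2
    push_cast
    ring
  have hγn : ∀ t, ‖γ t - p‖ < ε := fun t => by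
    rw [hγφ, norm_mul, Complex.norm_exp_ofReal_mul_I, mul_one, Complex.norm_real,
      Real.norm_of_nonneg hx0.le]
    exact hxε
  have hre : ∀ t, (γ t).re - p.re = ρ * Real.cos (φ t) := fun t => by
    rw [← Complex.sub_re, hγφ, Complex.re_ofReal_mul, Complex.exp_ofReal_mul_I_re]
  have him : ∀ t, (γ t).im - p.im = ρ * Real.sin (φ t) := fun t => by
    rw [← Complex.sub_im, hγφ, Complex.im_ofReal_mul, Complex.exp_ofReal_mul_I_im]
  have hmemU : ∀ t, ∀ k : ℤ, -Real.pi < φ t - k * (2 * Real.pi) →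
      φ t - k * (2 * Real.pi) < Real.pi → γ t ∈ U := fun t k h1 h2 => by
    refine hU _ (hγn t) fun ⟨h3, h4⟩ => ?_
    have h5 : Real.sin (φ t - k * (2 * Real.pi)) = 0 := by
      rw [Real.sin_sub_int_mul_two_pi]
      have := him t
      rw [h3, sub_self] at this
      exact (mul_eq_zero.1 this.symm).resolve_left hx0.ne'
    rw [Real.sin_eq_zero_iff_of_lt_of_lt h1 h2] at h5
    have h6 : Real.cos (φ t) = 1 := by
      rw [← Real.cos_sub_int_mul_two_pi _ k, h5, Real.cos_zero]
    have h7 := hre t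
    rw [h6] at h7
    linarith
  -- The starting point is not on the left ray, so -π < θ < π. The angle φ, running from θ to θ +
  -- 2π, passes π once and stays below 3π: the left ray is crossed exactly once.
  have hθπ : θ < Real.pi := by
    refine lt_of_le_of_ne (Complex.arg_le_pi _) fun h => hUp x hxU ?_
    have h1 := Complex.arg_eq_pi_iff.1 h
    rw [Complex.sub_re, Complex.sub_im] at h1
    exact ⟨by linarith [h1.2], by linarith [h1.1]⟩
  have hθπ' : -Real.pi < θ := Complex.neg_pi_lt_arg _
  have hπ := Real.pi_pos
  have hφc : Continuous φ := by fun_prop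
  have hγc : Continuous γ := by fun_prop
  have hball : ∀ t, ∀ᶠ y in 𝓝 (γ t), ‖y - p‖ < ε := fun t =>
    (show Continuous fun y : ℂ => ‖y - p‖ by fun_prop).continuousAt.eventually_lt_const (hγn t)
  -- Ep before the crossing; at the crossing Em Pu⁻¹, which agrees with Ep above the ray and is
  -- holomorphic across it; afterwards Em is rewritten as Ep Pl.
  let f : ℝ → ℂ → CMat n := fun t => if φ t < Real.pi then Ep else
    if φ t = Real.pi then fun y => Em y * Pu⁻¹ else fun y => Ep y * (Pl * Pu⁻¹)
  have hf1 : ∀ t, φ t < Real.pi → f t = Ep := fun t ht => if_pos ht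
  have hf2 : ∀ t, φ t = Real.pi → f t = fun y => Em y * Pu⁻¹ := fun t ht => by
    simp only [f, ht, lt_irrefl, if_true, if_false]
  have hf3 : ∀ t, Real.pi < φ t → f t = fun y => Ep y * (Pl * Pu⁻¹) := fun t ht => by
    simp only [f, ht.not_gt, ht.ne', if_false]
  refine ⟨f, fun t ht => ?_, ?_, ?_⟩
  · have ht1 : θ ≤ φ t := by
      have := mul_nonneg (by positivity : 0 ≤ 2 * Real.pi) ht.1
      simp only [hφ]
      linarith
    have ht2 : φ t ≤ θ + 2 * Real.pi := by
      have := mul_le_mul_of_nonneg_left ht.2 (by positivity : 0 ≤ 2 * Real.pi)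
      simp only [hφ]
      linarith
    rcases lt_trichotomy (φ t) Real.pi with h | h | h
    · rw [hf1 t h]
      refine ⟨hEp _ (hmemU t 0 (by simp; linarith) (by simpa using h)), nhdsWithin_le_nhds ?_⟩
      filter_upwards [hφc.continuousAt.eventually_lt_const h] with s hs
      rw [hf1 s hs]
    · rw [hf2 t h]
      refine ⟨(hEm _ (hV _ (hγn t) fun h1 => ?_)).mul_const _, nhdsWithin_le_nhds ?_⟩
      · have h2 := hre t
        rw [h, Real.cos_pi] at h2
        linarith [h1.2]
      -- Near the crossing the angle lies in ]0, 2π[: before π the point is above p and `hu`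
      -- applies, after π it is below and `hl` applies.
      · filter_upwards [hφc.continuousAt.eventually_lt_const (show φ t < 2 * Real.pi by linarith),
          hφc.continuousAt.eventually_const_lt (show 0 < φ t by linarith)] with s hs1 hs2
        rcases lt_trichotomy (φ s) Real.pi with h' | h' | h'
        · rw [hf1 s h']
          have h3 : p.im < (γ s).im := by
            have := mul_pos hx0 (Real.sin_pos_of_pos_of_lt_pi hs2 h')
            linarith [him s]
          filter_upwards [hball s, Complex.continuous_im.continuousAt.eventually_const_lt h3] with
            y hy1 hy2
          exact hu y hy1 hy2
        · rw [hf2 s h']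
        · rw [hf3 s h']
          have h3 : (γ s).im < p.im := by
            have h4 := Real.sin_pos_of_pos_of_lt_pi (x := φ s - Real.pi) (by linarith) (by linarith)
            rw [Real.sin_sub_pi] at h4
            have := mul_pos hx0 h4
            linarith [him s]
          filter_upwards [hball s, Complex.continuous_im.continuousAt.eventually_lt_const h3] with
            y hy1 hy2
          rw [hl y hy1 hy2, mul_assoc]
    · rw [hf3 t h]
      refine ⟨(hEp _ (hmemU t 1 (by simp; linarith) (by simp; linarith))).mul_const _,
        nhdsWithin_le_nhds ?_⟩
      filter_upwards [hφc.continuousAt.eventually_const_lt h] with s hs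
      rw [hf3 s hs]
  · rw [hf1 0 (by simpa [hφ] using hθπ)]
  · rw [hf3 1 (by simp only [hφ, mul_one]; linarith)]

end Monodromy

end

noncomputable section

/-! ### Assembly of the theorem -/

section Assembly

attribute [local instance] Matrix.linftyOpNormedRing Matrix.linftyOpNormedAlgebra

variable {n r : ℕ}

theorem tendsto_matrix_inv {ι : Type*} {l : Filter ι} {Y : ι → CMat n} {E : CMat n}
    (hY : Tendsto Y l (𝓝 E)) (hE : IsUnit E.det) : Tendsto (fun h => (Y h)⁻¹) l (𝓝 E⁻¹) := by
  obtain ⟨u, rfl⟩ := (Matrix.isUnit_iff_isUnit_det _).2 hE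
  have h2 := (NormedRing.inverse_continuousAt u).tendsto.comp hY
  simp only [Function.comp_def, ← Matrix.nonsing_inv_eq_ringInverse] at h2
  exact h2

theorem isFundamentalSolutionOn_of_hasDerivAt {At : RatMat n} {U : Set ℂ} {E : ℂ → CMat n}
    (hE : ∀ x ∈ U, HasDerivAt E (limitCoeff true At x * E x) x ∧ IsUnit (E x).det) :
    IsFundamentalSolutionOn At U E := by
  refine fun x hx => ⟨fun i j => ?_, (hE x hx).2⟩
  refine ((hE x hx).1.matrix_entry i j).congr_deriv ?_
  simp only [limitCoeff, if_true, smul_mul_assoc, Matrix.smul_apply, smul_eq_mul]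
  rw [inv_mul_eq_div]

theorem existsUnique_isCanonicalAtPlus {h : ℝ} (hh : h ≠ 0) {A : RatMat n} {Y : ℂ → CMat n}
    (hY : IsCanonical true h A Y ∧ ∀ Y', IsCanonical true h A Y' → Y' = Y) :
    IsCanonicalAtPlus h A Y ∧ ∀ Y', IsCanonicalAtPlus h A Y' → Y' = Y :=
  ⟨(isCanonicalAtPlus_iff hh A Y).2 hY.1, fun Y' h' => hY.2 Y' ((isCanonicalAtPlus_iff hh A Y').1 h')⟩

theorem existsUnique_isCanonicalAtMinus {h : ℝ} (hh : h ≠ 0) {A : RatMat n} {Y : ℂ → CMat n}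
    (hY : IsCanonical false h A Y ∧ ∀ Y', IsCanonical false h A Y' → Y' = Y) :
    IsCanonicalAtMinus h A (fun x => Y (-x)) ∧
      ∀ Y', IsCanonicalAtMinus h A Y' → Y' = fun x => Y (-x) := by
  refine ⟨(isCanonicalAtMinus_iff hh A _).2 (by simpa using hY.1), fun Y' h' => ?_⟩
  have h1 := hY.2 _ ((isCanonicalAtMinus_iff hh A Y').1 h')
  funext x
  rw [← h1]
  simp

end Assembly

theorem mainTheorem2 (n : ℕ) (h₀ : ℝ) (hh₀ : 0 < h₀) (A : ℝ → RatMat n) (At : RatMat n)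
    (hyp : ConfluenceHypothesis h₀ A At)
    (r : ℕ) (z : Fin r → ℂ) (hz : StrictMono fun j => (z j).im)
    (hzr : Set.range z = poleSet At ∪ {0}) :
    (∀ᶠ h in 𝓝[>] (0 : ℝ), ∃! Y : ℂ → CMat n, IsCanonicalAtPlus h (A h) Y) ∧
    (∀ᶠ h in 𝓝[>] (0 : ℝ), ∃! Y : ℂ → CMat n, IsCanonicalAtMinus h (A h) Y) ∧
    ∃ (At₀ : CMat n) (Ep Em : ℂ → CMat n) (P : Fin (r + 1) → CMat n),
      HasValueAtInfinity At At₀ ∧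
      IsFundamentalSolutionOn At (cutPlus z) Ep ∧
      IsFundamentalSolutionOn At (cutMinus z) Em ∧
      HasFrobeniusForm At₀ Ep ∧
      HasFrobeniusForm At₀ (fun x => Em (-x)) ∧
      (∀ Yp Ym : ℝ → ℂ → CMat n,
        (∀ᶠ h in 𝓝[>] (0 : ℝ), IsCanonicalAtPlus h (A h) (Yp h)) →
        (∀ᶠ h in 𝓝[>] (0 : ℝ), IsCanonicalAtMinus h (A h) (Ym h)) →
        (∀ x ∈ cutPlus z, Tendsto (fun h => Yp h x) (𝓝[>] 0) (𝓝 (Ep x))) ∧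
        (∀ x ∈ cutMinus z, Tendsto (fun h => Ym h x) (𝓝[>] 0) (𝓝 (Em x))) ∧
        ∀ k, ∀ x ∈ strip z k,
          Tendsto (fun h => (Yp h x)⁻¹ * Ym h x) (𝓝[>] 0) (𝓝 (P k))) ∧
      (∀ k, IsUnit (P k).det ∧ ∀ x ∈ strip z k, (Ep x)⁻¹ * Em x = P k) ∧
      ∀ j : Fin r, IsMonodromyAround (z j) (cutPlus z) Ep (P j.castSucc * (P j.succ)⁻¹) := by
  -- The statement involves only the entrywise topology; the norm by the maximum of the row sums
  -- induces it and makes the matrices a normed algebra.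
  let _ := Matrix.linftyOpNormedRing (n := Fin n) (α := ℂ)
  let _ := Matrix.linftyOpNormedAlgebra (n := Fin n) (R := ℂ) (α := ℂ)
  obtain ⟨hdata, hunif⟩ := exists_localData hh₀ hyp.1
  obtain ⟨ap, ap₀, Cp, lp, Lp, hp₀⟩ := hdata true
  obtain ⟨am, am₀, Cm, lm, Lm, hm₀⟩ := hdata false
  have hdomp : IsConfluenceDomain true At (cutPlus z) := isConfluenceDomain_cutPlus fun x => by
    rw [hzr]
    simp
  have hdomm : IsConfluenceDomain false At (cutPlus fun j => -z j) :=
    isConfluenceDomain_cutPlus fun x => by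
      simp only [Bool.false_eq_true, if_false]
      rw [← hzr]
      simp only [Set.mem_range, neg_eq_iff_eq_neg]
  obtain ⟨Yp, Ep, Fp, cp, Rp, hYp, hEp, hEpd, hcp, hFp⟩ := Lp.exists_limit hdomp hunif
  obtain ⟨Ym, E', Fm, cm, Rm, hYm, hEm', hEmd', hcm, hFm⟩ := Lm.exists_limit hdomm hunif
  set Em : ℂ → CMat n := fun x => E' (-x) with hEm
  have hneg : ∀ x, x ∈ cutMinus z ↔ -x ∈ cutPlus fun j => -z j := fun x => by
    rw [← neg_mem_cutMinus, neg_neg]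
  have hEmd : ∀ x ∈ cutMinus z,
      HasDerivAt Em (limitCoeff true At x * Em x) x ∧ IsUnit (Em x).det := fun x hx => by
    have h1 := hEmd' _ ((hneg x).1 hx)
    refine ⟨?_, h1.2⟩
    have h2 := h1.1.scomp x (hasDerivAt_neg x)
    -- The sign from the derivative of -x cancels the one from 1/(-x), so Em satisfies the original
    -- system.
    refine h2.congr_deriv ?_
    simp [limitCoeff, hEm, inv_neg]
  have h0 : ∀ᶠ h in 𝓝[>] (0 : ℝ), h ≠ 0 := eventually_pos_le_one.mono fun h hh => hh.1.ne'
  have hYp' : ∀ᶠ h in 𝓝[>] (0 : ℝ), IsCanonicalAtPlus h (A h) (Yp h) ∧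
      ∀ Y', IsCanonicalAtPlus h (A h) Y' → Y' = Yp h := by
    filter_upwards [h0, hYp] with h h1 h2 using existsUnique_isCanonicalAtPlus h1 h2
  have hYm' : ∀ᶠ h in 𝓝[>] (0 : ℝ), IsCanonicalAtMinus h (A h) (fun x => Ym h (-x)) ∧
      ∀ Y', IsCanonicalAtMinus h (A h) Y' → Y' = fun x => Ym h (-x) := by
    filter_upwards [h0, hYm] with h h1 h2 using existsUnique_isCanonicalAtMinus h1 h2
  have hr : 0 < r := by
    have : (0 : ℂ) ∈ Set.range z := by
      rw [hzr]
      exact Or.inr rfl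
    obtain ⟨j, -⟩ := this
    exact j.pos
  choose q hq using strip_nonempty hz hr
  -- Any point of the strip may serve, since the connection matrix is constant there.
  set P : Fin (r + 1) → CMat n := fun k => (Ep (q k))⁻¹ * Em (q k) with hP
  have hconst : ∀ k, ∀ x ∈ strip z k, (Ep x)⁻¹ * Em x = P k := fun k x hx =>
    inv_mul_eq_of_hasDerivAt (isOpen_strip k) (convex_strip k).isPreconnected
      (fun y hy => hEpd y (strip_subset_cutPlus k hy))
      (fun y hy => (hEmd y (strip_subset_cutMinus k hy)).1) hx (hq k)
  have hPu : ∀ k, IsUnit (P k).det := fun k => by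
    rw [hP, Matrix.det_mul]
    exact (Matrix.isUnit_nonsing_inv_det _ (hEpd _ (strip_subset_cutPlus k (hq k))).2).mul
      (hEmd _ (strip_subset_cutMinus k (hq k))).2
  have hconn : ∀ k, ∀ x ∈ strip z k, Em x = Ep x * P k := fun k x hx => by
    rw [← hconst k x hx, Matrix.mul_nonsing_inv_cancel_left _ _
      (hEpd x (strip_subset_cutPlus k hx)).2]
  -- The constant terms found at +∞ and at -∞ are both the value of At at infinity, so one matrix
  -- serves both normal forms.
  have hvalue : am₀ 0 = ap₀ 0 := hm₀.unique hp₀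
  refine ⟨?_, ?_, ap₀ 0, Ep, Em, P, hp₀, isFundamentalSolutionOn_of_hasDerivAt hEpd,
    isFundamentalSolutionOn_of_hasDerivAt hEmd, ⟨cp, Fp, Rp, hcp, hFp⟩, ⟨cm, Fm, Rm, hcm, ?_⟩,
    ?_, fun k => ⟨hPu k, hconst k⟩, fun j => ?_⟩
  · filter_upwards [hYp'] with h hh using ⟨_, hh⟩
  · filter_upwards [hYm'] with h hh using ⟨_, hh⟩
  · intro x hx
    have h1 := hFm x hx
    rw [hvalue] at h1
    simpa [hEm] using h1
  · intro Zp Zm hZp hZm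
    have h1 : ∀ x ∈ cutPlus z, Tendsto (fun h => Zp h x) (𝓝[>] 0) (𝓝 (Ep x)) := fun x hx => by
      refine (hEp x hx).congr' ?_
      filter_upwards [hYp', hZp] with h k1 k2
      rw [k1.2 _ k2]
    have h2 : ∀ x ∈ cutMinus z, Tendsto (fun h => Zm h x) (𝓝[>] 0) (𝓝 (Em x)) := fun x hx => by
      refine (hEm' _ ((hneg x).1 hx)).congr' ?_
      filter_upwards [hYm', hZm] with h k1 k2
      rw [k1.2 _ k2]
    refine ⟨h1, h2, fun k x hx => ?_⟩
    rw [← hconst k x hx]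
    exact (tendsto_matrix_inv (h1 x (strip_subset_cutPlus k hx))
      (hEpd x (strip_subset_cutPlus k hx)).2).mul (h2 x (strip_subset_cutMinus k hx))
  · obtain ⟨ε, hε, hgap⟩ := exists_im_gap hz j
    refine isMonodromyAround_of_connection (V := cutMinus z) (Em := Em) hε (fun x hx => hx j)
      (fun x hx => mem_cutPlus_of_norm_lt hgap hx) (fun x hx => mem_cutMinus_of_norm_lt hgap hx)
      (fun x hx => matAnalyticAt_of_hasDerivAt (isOpen_cutPlus z) (fun y hy => (hEpd y hy).1) hx)
      (fun x hx => matAnalyticAt_of_hasDerivAt (isOpen_cutMinus z) (fun y hy => (hEmd y hy).1) hx)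
      (fun x hx hj => ?_) (fun x hx hj => hconn _ x (mem_strip_castSucc hz hgap hx hj))
    rw [hconn _ x (mem_strip_succ hz hgap hx hj), Matrix.mul_nonsing_inv_cancel_right _ _ (hPu _)]

end
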